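/- Let $n\ge 1$. Consider the root system of type $A_{2n+1}$ with index set $I=\{1,\dots,2n+1\}$, simple roots $\Pi=\{\alpha_i\}_{i\in I}$, positive roots $\Phi^+$, simple reflections $s_i$, longest Weyl group element $w_0$ of length $\mathsf N=|\Phi^+|$, and the diagram involution $i^\vee=i^*=2n+2-i$. Two reduced words of $w_0$ are commutation equivalent if one is obtained from the other by commutation relations $s_is_j=s_js_i$ ($|i-j|>1$); the class of $\mathbf i$ is $[\mathbf i]$. Two classes are reflection equivalent if one is obtained from the other by finitely many moves $[i_1i_2\cdots i_{\mathsf N}]\mapsto[i_2\cdots i_{\mathsf N}i_1^*]$ and $[i_1\cdots i_{\mathsf N}]\mapsto[i_{\mathsf N}^*i_1\cdots i_{\mathsf N-1}]$. A class is twisted adapted if it is reflection equivalent to the class of the reduced word $\prod_{k=0}^{2n}(1\,2\cdots n{+}1)^{k\vee}$ of $w_0$, where $(j_1\cdots j_r)^{k\vee}$ is obtained by applying $\vee$ to every letter $k$ times. A reduced word $\mathbf j=i_1\cdots i_{\mathsf N}$ of $w_0$ orders $\Phi^+$ as $\beta_1<_{\mathbf j}\cdots<_{\mathbf j}\beta_{\mathsf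 N}$, $\beta_k=s_{i_1}\cdots s_{i_{k-1}}(\alpha_{i_k})$. A sequence is a function $m:\Phi^+\to\mathbb Z_{\ge0}$, of weight $\mathrm{wt}(m)=\sum_\beta m(\beta)\beta$; a positive root $\gamma$ is identified with the sequence that is $1$ at $\gamma$ and $0$ elsewhere; a pair is a sequence with values in $\{0,1\}$ and sum $2$, that is, a set $\{\alpha,\beta\}$ of two distinct positive roots. Write $m'<^{\mathtt b}_{\mathbf j}m$ if there are $k\le s$ with $m'(\beta_t)=m(\beta_t)$ for $t<k$ and for $t>s$, $m'(\beta_k)<m(\beta_k)$ and $m'(\beta_s)<m(\beta_s)$. For a class $c$ write $m'\prec^{\mathtt b}_c m$ if $m'<^{\mathtt b}_{\mathbf j}m$ for all $\mathbf j\in c$. A pair $p$ is $c$-simple if there is no $m\prec^{\mathtt b}_c p$ with $\mathrm{wt}(m)=\mathrm{wt}(p)$. A sequence is $c$-simple if it is a multiple of one positive root or if every two distinct roots at which it is positive form a $c$-simple pair. $\mathrm{gdist}_c(m)$ is the largest $k$ for which there are sequences $m^{(1)}\prec^{\mathtt b}_c\cdots\prec^{\mathtt b}_c m^{(k)}=m$,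 all of weight $\mathrm{wt}(m)$ and none $c$-simple ($0$ if $m$ is $c$-simple). For $\gamma\in\Phi^+\setminus\Pi$, $\mathrm{rds}_c(\gamma)$ is the maximum of $\mathrm{gdist}_c(p)$ over the pairs $p$ with $\mathrm{wt}(p)=\gamma$ and $\gamma\prec^{\mathtt b}_c p$. The $c$-socle of a pair $p$ is the $c$-simple sequence $s$ with $\mathrm{wt}(s)=\mathrm{wt}(p)$ and $s=p$ or $s\prec^{\mathtt b}_c p$; it is well defined if there is exactly one such $s$. The folded multiplicity of $\gamma=\sum_i m_i\alpha_i$ is $\overline{\mathsf m}(\gamma)=\max_{i\in I}\sum_{j\in\{i,i^\vee\}}m_j$. Theorem. Let $c$ be a twisted adapted class of type $A_{2n+1}$. 1. For every pair $p$, $\mathrm{gdist}_c(p)\le\max\{\overline{\mathsf m}(\gamma)\mid\gamma\in\Phi^+\}=2$. 2. For every $\gamma\in\Phi^+\setminus\Pi$, $\mathrm{rds}_c(\gamma)\le2$, and $\mathrm{rds}_c(\gamma)=2$ implies $\overline{\mathsf m}(\gamma)=2$. 3. The $c$-socle of every pair is well defined. -/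

import Mathlib

namespace TwistedA

/-! The root system of type `A_m`. The index set `I = {1, …, m}` is `Fin m` (shifted to start
at `0`), the Weyl group is the group of permutations of `Fin (m + 1)`, the simple reflection
`s_i` is the transposition of `i` and `i + 1`, and `α_i = ε_i - ε_{i+1}`. -/

/-- The positive roots of type `A_m`: the pair `(a, b)` with `a < b` stands for
`ε_a - ε_b = α_a + α_{a+1} + ⋯ + α_{b-1}`. -/
abbrev PosRoot (m : ℕ) : Type := {p : Fin (m + 1) × Fin (m + 1) // p.1 < p.2}

/-- The simple root `α_i = ε_i - ε_{i+1}`. -/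
def simpleRoot {m : ℕ} (i : Fin m) : PosRoot m :=
  ⟨(i.castSucc, i.succ), Fin.castSucc_lt_succ⟩

/-- The coefficient `m_i` of `γ = ∑ i, m_i α_i`. -/
def PosRoot.coeff {m : ℕ} (γ : PosRoot m) (i : Fin m) : ℕ :=
  if γ.1.1 ≤ i.castSucc ∧ i.castSucc < γ.1.2 then 1 else 0

/-- The simple reflection `s_i`. -/
def simpleRefl {m : ℕ} (i : Fin m) : Equiv.Perm (Fin (m + 1)) :=
  Equiv.swap i.castSucc i.succ

/-- The product `s_{i_1} s_{i_2} ⋯ s_{i_l}` of a word. -/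
def wordProd {m : ℕ} (w : List (Fin m)) : Equiv.Perm (Fin (m + 1)) :=
  (w.map simpleRefl).prod

/-- The involution `i ↦ m + 1 - i` of the Dynkin diagram of type `A_m`. It is the involution `*`
induced by the longest element, and for `m = 2n + 1` also the automorphism `∨`. -/
def diagInv {m : ℕ} (i : Fin m) : Fin m := i.rev

/-! Commutation classes and reflection functors. -/

/-- One commutation relation `s_a s_b = s_b s_a`, for `a`, `b` distinct and not adjacent in the
diagram, applied inside a word. -/
inductive CommStep {m : ℕ} : List (Fin m) → List (Fin m) → Prop
  | swap (u v : List (Fin m)) (a b : Fin m)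
      (h : (a : ℕ) + 1 < (b : ℕ) ∨ (b : ℕ) + 1 < (a : ℕ)) :
      CommStep (u ++ a :: b :: v) (u ++ b :: a :: v)

/-- Commutation classes of words: the quotient by the equivalence relation that `CommStep`
generates. -/
def CommClass (m : ℕ) : Type := Quot (CommStep (m := m))

/-- The commutation class `[w]` of a word. -/
def commClass {m : ℕ} (w : List (Fin m)) : CommClass m := Quot.mk _ w

/-- `c'` is obtained from the class `c` by a reflection functor that acts nontrivially:
`c' = c r_i` for a sink `i` of `c`, or `c' = r_i c` for a source `i` of `c`. These moves take
classes of reduced words of the longest element to classes of reduced words of the longest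
element. -/
def ReflStep {m : ℕ} (c c' : CommClass m) : Prop :=
  ∃ (i : Fin m) (w : List (Fin m)),
    (c = commClass (i :: w) ∧ c' = commClass (w ++ [diagInv i])) ∨
    (c = commClass (w ++ [i]) ∧ c' = commClass (diagInv i :: w))

/-- Reflection equivalence of commutation classes. -/
def ReflEquiv {m : ℕ} (c c' : CommClass m) : Prop := Relation.ReflTransGen ReflStep c c'

/-- The word `1 2 ⋯ n+1` in the index set of type `A_{2n+1}`. -/
def halfWord (n : ℕ) : List (Fin (2 * n + 1)) :=
  List.ofFn fun j : Fin (n + 1) => Fin.castLE (by omega) j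

/-- The reduced word `∏_{k=0}^{2n} (1 2 ⋯ n+1)^{k∨}` of the longest element of type
`A_{2n+1}`. -/
def twistedWord (n : ℕ) : List (Fin (2 * n + 1)) :=
  ((List.range (2 * n + 1)).map fun k => (halfWord n).map (diagInv^[k])).flatten

/-- The twisted adapted classes of type `A_{2n+1}`: the members of the `r`-cluster point of
`twistedWord n`. -/
def IsTwistedAdapted (n : ℕ) (c : CommClass (2 * n + 1)) : Prop :=
  ReflEquiv (commClass (twistedWord n)) c

/-! The total order on positive roots given by a reduced word of the longest element. -/

/-- The root `β_k = s_{i_1} ⋯ s_{i_{k-1}}(α_{i_k})` of the word `w = i_1 i_2 ⋯` (with positions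
counted from `0`), as the pair `(a, b)` with `β_k = ε_a - ε_b`. -/
def betaPair {m : ℕ} (w : List (Fin m)) (k : Fin w.length) : Fin (m + 1) × Fin (m + 1) :=
  (wordProd (w.take k) (w.get k).castSucc, wordProd (w.take k) (w.get k).succ)

/-- The order `α <_w β` on the positive roots: `α = β_k` and `β = β_l` with `k < l`. -/
def WordLT {m : ℕ} (w : List (Fin m)) (α β : PosRoot m) : Prop :=
  ∃ k l : Fin w.length, k < l ∧ betaPair w k = α.1 ∧ betaPair w l = β.1

/-- Sequences of positive roots, written as multiplicity functions; this makes the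
rearrangement of a sequence with respect to another reduced word the identity. -/
abbrev RootSeq (m : ℕ) : Type := PosRoot m → ℕ

/-- The weight `∑ m_β β`, in coordinates with respect to the simple roots. -/
def wt {m : ℕ} (s : RootSeq m) : Fin m → ℕ := fun i => ∑ β : PosRoot m, s β * β.coeff i

/-- The bilexicographic order `s' <ᵇ_w s` of a word `w`. -/
def BilexLT {m : ℕ} (w : List (Fin m)) (s' s : RootSeq m) : Prop :=
  ∃ κ σ : PosRoot m, (κ = σ ∨ WordLT w κ σ) ∧
    (∀ τ, WordLT w τ κ ∨ WordLT w σ τ → s' τ = s τ) ∧ s' κ < s κ ∧ s' σ < s σ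

/-- The order `s' ≺ᵇ_c s` of a commutation class `c`. -/
def Prec {m : ℕ} (c : CommClass m) (s' s : RootSeq m) : Prop :=
  ∀ w : List (Fin m), commClass w = c → BilexLT w s' s

/-- The sequence in which only `γ` occurs, once. -/
def single {m : ℕ} (γ : PosRoot m) : RootSeq m := Pi.single γ 1

/-- A pair: a sequence with all entries at most `1` and entries adding up to `2`. -/
def IsPair {m : ℕ} (p : RootSeq m) : Prop := (∀ β, p β ≤ 1) ∧ ∑ β, p β = 2

/-- The condition that makes a pair `p` a `c`-simple pair. -/
def IsSimplePair {m : ℕ} (c : CommClass m) (p : RootSeq m) : Prop :=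
  ¬ ∃ s : RootSeq m, Prec c s p ∧ wt s = wt p

/-- A `c`-simple sequence: a multiple of one positive root, or a sequence of which any two
distinct members form a `c`-simple pair. -/
def IsSimpleSeq {m : ℕ} (c : CommClass m) (s : RootSeq m) : Prop :=
  (∃ (β : PosRoot m) (k : ℕ), s = Pi.single β k) ∨
  ∀ α β : PosRoot m, α ≠ β → 0 < s α → 0 < s β → IsSimplePair c (single α + single β)

/-- The generalized `c`-distance of `s`: the largest `k` for which there is a chain
`s₁ ≺ᵇ_c ⋯ ≺ᵇ_c s_k = s` of sequences of the weight of `s` that are not `c`-simple. If `s` itself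
is `c`-simple there is no such chain, and the value is `0`. -/
noncomputable def gdist {m : ℕ} (c : CommClass m) (s : RootSeq m) : ℕ∞ :=
  sSup {k : ℕ∞ | ∃ l : List (RootSeq m), l.IsChain (Prec c) ∧ l.getLast? = some s ∧
    (∀ t ∈ l, ¬ IsSimpleSeq c t ∧ wt t = wt s) ∧ k = (l.length : ℕ∞)}

/-- The `c`-radius of a positive root: the largest generalized distance of a pair `p` of weight
`γ` with `γ ≺ᵇ_c p`. -/
noncomputable def rds {m : ℕ} (c : CommClass m) (γ : PosRoot m) : ℕ∞ :=
  sSup {k : ℕ∞ | ∃ p : RootSeq m, IsPair p ∧ Prec c (single γ) p ∧ wt p = wt (single γ) ∧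
    k = gdist c p}

/-- `s` is a candidate for the `c`-socle of `p`: a `c`-simple sequence of the same weight with
`s ⪯ᵇ_c p`. The socle is well defined if there is exactly one such `s`. -/
def IsSocle {m : ℕ} (c : CommClass m) (p s : RootSeq m) : Prop :=
  IsSimpleSeq c s ∧ wt p = wt s ∧ (s = p ∨ Prec c s p)

/-- The folded multiplicity: the maximum over the orbits `{i, i^∨}` of the sum of the
coefficients of `γ` on the orbit. -/
def foldedMult {n : ℕ} (γ : PosRoot (2 * n + 1)) : ℕ :=
  Finset.univ.sup fun i : Fin (2 * n + 1) => ∑ j ∈ ({i, diagInv i} : Finset _), γ.coeff j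

end TwistedA

/-! ### The periodic quiver: points, strands, shift and rows -/

namespace TwistedA

/-! The heap of a twisted adapted class is a piece of an infinite periodic poset. Its points are
pairs `(p, q)` of integers with the product order. An even integer, taken modulo `4n + 2`, names one
of `2n + 1` strands of a wiring diagram, and all odd integers name one further, central strand. A
point is a crossing of two strands, and its positive root is `ε_i - ε_j`, where `i < j` are the
starting positions of these strands. The shift `tau` exchanges the two strands and dualizes the
residue. Hence a reflection functor replaces a first point `P` by `tau P` at the end, or does the
reverse. So every twisted adapted class is read off from a fundamental domain of `tau`, a slice
(`IsTwistedAdapted.exists_slice`).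

In this picture the order `≺ᵇ_c` below a pair becomes geometry: the sequences below `α + β` of the
same weight are the multisets of points of the interval strictly between `α` and `β` with the right
weight (`Model.below_iff`). Equality of weights prescribes, for each strand, the number of points
that have it as first coordinate minus the number that have it as second coordinate. Where no
columns interfere this fixes the row sums, and dually the column sums. An even row contains only its
central point and points in even columns, so very few multisets survive (`WAdm.rectOutcome`,
`WAdm.composeOutcome`, `WAdm.false_of_gap`). If there are any, one of them is a single point or two
incomparable points. At most one other exists, and it contains two central points whose weights add
up to that of a point between them (`hasSocle`). So below a pair lie one simple sequence and at most
one that is not simple, which gives both the bound `2` on distances and the uniqueness of socles.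

If `rds` of a root is `2`, the root and a nonsimple sequence lie below one pair. Up to a shift this
happens only for `α = (p, q)`, `β = (q, b)` and root `(p, b)`, with the two central points on the
strands `p` and `b` as the other multiset (`exceptional`). The central strand then starts between
the strands `p` and `b`. Counting central crossings shows that it starts in one of the two middle
positions, and further strands in between push the strands `p` and `b` away from the middle
(`IsSlice.folded_of_mem`). So the support of the root contains an orbit of two vertices. -/

/-- Points of the folded Auslander-Reiten quiver in doubled light cone coordinates. -/
def IsPt (n : ℕ) (P : ℤ × ℤ) : Prop :=
  (P.1 % 2 = 0 ∧ P.2 % 2 = 0 ∧ P.1 < P.2 ∧ P.2 < P.1 + (4 * n + 2)) ∨ P.2 = P.1 + (2 * n + 1)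

/-- The strand that passes through a coordinate; the central strand is `-1`. -/
def lab (n : ℕ) (v : ℤ) : ℤ := if v % 2 = 0 then v % (4 * n + 2) else -1

theorem lab_of_odd {n : ℕ} {v : ℤ} (h : v % 2 = 1) : lab n v = -1 := by
  unfold lab; rw [if_neg (by omega)]

theorem lab_of_even {n : ℕ} {v : ℤ} (h : v % 2 = 0) : lab n v = v % (4 * n + 2) := if_pos h

theorem lab_nonneg_of_even {n : ℕ} {v : ℤ} (h : v % 2 = 0) : 0 ≤ lab n v := by
  rw [lab_of_even h]; exact Int.emod_nonneg _ (by omega)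

theorem lab_eq_iff {n : ℕ} {u v : ℤ} :
    lab n u = lab n v ↔ (u % 2 = 1 ∧ v % 2 = 1) ∨
      (u % 2 = 0 ∧ v % 2 = 0 ∧ ∃ k : ℤ, v = u + (4 * n + 2) * k) := by
  rcases Int.emod_two_eq_zero_or_one u with hu | hu <;>
    rcases Int.emod_two_eq_zero_or_one v with hv | hv
  · rw [lab_of_even hu, lab_of_even hv]
    constructor
    · intro h
      obtain ⟨k, hk⟩ := Int.ModEq.dvd (show u ≡ v [ZMOD (4 * n + 2)] from h)
      exact Or.inr ⟨hu, hv, k, by omega⟩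
    · rintro (h | ⟨-, -, k, rfl⟩)
      · omega
      · simp
  · have := lab_nonneg_of_even (n := n) hu
    rw [lab_of_odd hv]
    constructor <;> intro h <;> omega
  · have := lab_nonneg_of_even (n := n) hv
    rw [lab_of_odd hu]
    constructor <;> intro h <;> omega
  · rw [lab_of_odd hu, lab_of_odd hv]; simp [hu, hv]

/-- Reduces congruences modulo the period to linear inequalities. -/
theorem period_mul_cases (n : ℕ) (k : ℤ) :
    (4 * (n : ℤ) + 2) * k = 0 ∨ 4 * (n : ℤ) + 2 ≤ (4 * (n : ℤ) + 2) * k ∨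
      (4 * (n : ℤ) + 2) * k ≤ -(4 * (n : ℤ) + 2) := by
  rcases lt_trichotomy k 0 with h0 | h0 | h0
  · exact Or.inr (Or.inr (by nlinarith))
  · simp [h0]
  · exact Or.inr (Or.inl (by nlinarith))

theorem lab_add_period {n : ℕ} (v : ℤ) : lab n (v + (4 * n + 2)) = lab n v := by
  rw [eq_comm, lab_eq_iff]
  rcases Int.emod_two_eq_zero_or_one v with hv | hv
  · exact Or.inr ⟨hv, by omega, 1, by ring⟩
  · exact Or.inl ⟨hv, by omega⟩

/-- Functions on labels are the functions on a period that are constant on odd numbers. -/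
theorem exists_factor_lab (n : ℕ) (p : ℤ) (h : ℤ → ℤ)
    (hodd : ∀ u v, u % 2 = 1 → v % 2 = 1 → h u = h v) :
    ∃ H : ℤ → ℤ, ∀ v, p ≤ v → v < p + (4 * n + 2) → H (lab n v) = h v := by
  refine ⟨fun o => if o = -1 then h 1 else h (p + (o - p) % (4 * n + 2)), fun v h1 h2 => ?_⟩
  rcases Int.emod_two_eq_zero_or_one v with hv | hv
  · have := lab_nonneg_of_even (n := n) hv
    simp only
    rw [if_neg (by omega), lab_of_even hv, Int.emod_sub_emod, Int.emod_eq_of_lt (by omega) (by omega)]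
    congr 1; ring
  · simp only [lab_of_odd hv, if_true]
    exact hodd _ _ (by norm_num) hv

/-- The shift of the folded quiver. -/
def tau (n : ℕ) : ℤ × ℤ ≃ ℤ × ℤ where
  toFun P := (P.2, P.1 + (4 * n + 2))
  invFun P := (P.2 - (4 * n + 2), P.1)
  left_inv P := by ext <;> simp
  right_inv P := by ext <;> simp

@[simp] theorem tau_apply (n : ℕ) (P : ℤ × ℤ) : tau n P = (P.2, P.1 + (4 * n + 2)) := rfl
@[simp] theorem tau_symm_apply (n : ℕ) (P : ℤ × ℤ) :
    (tau n).symm P = (P.2 - (4 * n + 2), P.1) := rfl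

theorem IsPt.tau {n : ℕ} {P : ℤ × ℤ} (h : IsPt n P) : IsPt n (tau n P) := by
  unfold IsPt at *; simp only [tau_apply]; omega

theorem IsPt.tau_symm {n : ℕ} {P : ℤ × ℤ} (h : IsPt n P) : IsPt n ((TwistedA.tau n).symm P) := by
  unfold IsPt at *; simp only [tau_symm_apply]; omega

theorem tau_le_tau {n : ℕ} {P Q : ℤ × ℤ} : tau n P ≤ tau n Q ↔ P ≤ Q := by
  simp only [tau_apply, Prod.le_def]; omega

theorem tau_symm_le {n : ℕ} {P Q : ℤ × ℤ} : (tau n).symm P ≤ Q ↔ P ≤ tau n Q := by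
  simp only [tau_apply, tau_symm_apply, Prod.le_def]; omega

theorem le_tau_symm {n : ℕ} {P Q : ℤ × ℤ} : P ≤ (tau n).symm Q ↔ tau n P ≤ Q := by
  simp only [tau_apply, tau_symm_apply, Prod.le_def]; omega

theorem IsPt.tau_symm_le_self {n : ℕ} {P : ℤ × ℤ} (h : IsPt n P) :
    (TwistedA.tau n).symm P ≤ P := by
  unfold IsPt at h; simp only [tau_symm_apply, Prod.le_def]; omega

theorem IsPt.le_tau_self {n : ℕ} {P : ℤ × ℤ} (h : IsPt n P) : P ≤ TwistedA.tau n P := by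
  unfold IsPt at h; simp only [tau_apply, Prod.le_def]; omega

theorem IsPt.lab_ne {n : ℕ} {P : ℤ × ℤ} (h : IsPt n P) : lab n P.1 ≠ lab n P.2 := by
  rw [Ne, lab_eq_iff]
  unfold IsPt at h
  rintro (h1 | ⟨h1, h2, k, hk⟩)
  · omega
  · rcases period_mul_cases n k with h0 | h0 | h0 <;> omega

/-- The number of the residue (row) of a point. -/
def resNat (n : ℕ) (P : ℤ × ℤ) : ℕ :=
  ((if P.2 - P.1 < 2 * n + 1 then (P.2 - P.1) / 2 - 1 else (P.2 - P.1) / 2 : ℤ)).toNat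

/-- The residue of a point as a letter. -/
def res (n : ℕ) (P : ℤ × ℤ) : Fin (2 * n + 1) := Fin.ofNat _ (resNat n P)

theorem IsPt.resNat_lt {n : ℕ} {P : ℤ × ℤ} (h : IsPt n P) : resNat n P < 2 * n + 1 := by
  unfold IsPt at h; unfold resNat; split_ifs <;> omega

theorem IsPt.res_val {n : ℕ} {P : ℤ × ℤ} (h : IsPt n P) : (res n P : ℕ) = resNat n P := by
  simp [res, Fin.ofNat, Nat.mod_eq_of_lt h.resNat_lt]

theorem IsPt.res_tau {n : ℕ} {P : ℤ × ℤ} (h : IsPt n P) :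
    res n (TwistedA.tau n P) = diagInv (res n P) := by
  ext
  rw [h.tau.res_val, diagInv, Fin.val_rev, h.res_val]
  unfold IsPt at h; unfold resNat; simp only [tau_apply]; split_ifs <;> omega

/-- Two letters that do not commute or coincide. -/
def Near {m : ℕ} (i j : Fin m) : Prop := (i : ℕ) ≤ j + 1 ∧ (j : ℕ) ≤ i + 1

/-- Between incomparable points the coordinates move in opposite directions, so `q - p` changes by
at least `4` if all coordinates are even and by at least `2` in any case. Neighbouring rows differ
by `2`, and by only `1` if one of them is the central row. -/
theorem IsPt.comparable_of_near {n : ℕ} {P Q : ℤ × ℤ} (hP : IsPt n P) (hQ : IsPt n Q)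
    (h : Near (res n P) (res n Q)) : P ≤ Q ∨ Q ≤ P := by
  unfold Near at h
  rw [hP.res_val, hQ.res_val] at h
  unfold IsPt at hP hQ; unfold resNat at h; simp only [Prod.le_def]
  split_ifs at h <;> omega

/-- Iterated, this shows that the product order is generated by pairs of points in equal or
neighbouring rows, that is, by pairs of letters that do not commute: it is the heap order. -/
theorem IsPt.exists_near_le {n : ℕ} {P Q : ℤ × ℤ} (hn : 1 ≤ n) (hP : IsPt n P) (hQ : IsPt n Q)
    (h : P ≤ Q) (hne : P ≠ Q) :
    ∃ R, IsPt n R ∧ P ≤ R ∧ P ≠ R ∧ R ≤ Q ∧ Near (res n P) (res n R) := by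
  obtain ⟨p, q⟩ := P
  obtain ⟨a, b⟩ := Q
  have key : ∃ x y : ℤ, IsPt n (x, y) ∧ p ≤ x ∧ q ≤ y ∧ ¬ (p = x ∧ q = y) ∧ x ≤ a ∧ y ≤ b ∧
      resNat n (p, q) ≤ resNat n (x, y) + 1 ∧ resNat n (x, y) ≤ resNat n (p, q) + 1 := by
    have hne' : ¬ (p = a ∧ q = b) := fun h => hne (by rw [h.1, h.2])
    simp only [Prod.mk_le_mk] at h
    unfold IsPt at *; unfold resNat
    simp only at *
    by_cases c1 : q = p + (2 * n + 1)
    · by_cases c2 : p % 2 = 0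
      · refine ⟨p, q + 1, ?_⟩
        split_ifs <;> omega
      · refine ⟨p + 1, q, ?_⟩
        split_ifs <;> omega
    · by_cases c2 : q = p + 2 * n
      · by_cases c3 : q < b
        · refine ⟨p, q + 1, ?_⟩
          split_ifs <;> omega
        · refine ⟨p + 2, q, ?_⟩
          split_ifs <;> omega
      · by_cases c3 : q = p + 2 * n + 2
        · by_cases c4 : p < a
          · refine ⟨p + 1, q, ?_⟩
            split_ifs <;> omega
          · refine ⟨p, q + 2, ?_⟩
            split_ifs <;> omega
        · by_cases c4 : q + 2 ≤ b ∧ q + 2 < p + (4 * n + 2)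
          · refine ⟨p, q + 2, ?_⟩
            split_ifs <;> omega
          · refine ⟨p + 2, q, ?_⟩
            split_ifs <;> omega
  obtain ⟨x, y, h1, h2, h3, h4, h5, h6, h7, h8⟩ := key
  refine ⟨(x, y), h1, ⟨h2, h3⟩, fun h => h4 ?_, ⟨h5, h6⟩, ?_⟩
  · simpa using h
  · unfold Near; rw [hP.res_val, h1.res_val]; exact ⟨h7, h8⟩

end TwistedA

/-! ### Weights of multisets of points, row and column sums -/

namespace TwistedA

/-- The weight of a multiset of points, paired with a function on coordinates. -/
noncomputable def flux (h : ℤ → ℤ) (f : ℤ × ℤ →₀ ℕ) : ℤ :=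
  f.sum fun P k => (k : ℤ) * (h P.1 - h P.2)

/-- The number of points with first coordinate `x`. -/
noncomputable def rowSum (f : ℤ × ℤ →₀ ℕ) (x : ℤ) : ℕ :=
  f.sum fun P k => if P.1 = x then k else 0

/-- The number of points with second coordinate `y`. -/
noncomputable def colSum (f : ℤ × ℤ →₀ ℕ) (y : ℤ) : ℕ :=
  f.sum fun P k => if P.2 = y then k else 0

theorem flux_add (h : ℤ → ℤ) (f g : ℤ × ℤ →₀ ℕ) : flux h (f + g) = flux h f + flux h g := by
  unfold flux
  rw [Finsupp.sum_add_index'] <;> intros <;> push_cast <;> ring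

@[simp] theorem flux_single (h : ℤ → ℤ) (P : ℤ × ℤ) (k : ℕ) :
    flux h (Finsupp.single P k) = k * (h P.1 - h P.2) := by
  unfold flux
  rw [Finsupp.sum_single_index] ; simp

theorem flux_indicator (f : ℤ × ℤ →₀ ℕ) (x : ℤ) :
    flux (fun v => if v = x then 1 else 0) f = (rowSum f x : ℤ) - colSum f x := by
  unfold flux rowSum colSum Finsupp.sum
  push_cast
  rw [← Finset.sum_sub_distrib]
  refine Finset.sum_congr rfl fun P _ => ?_
  split_ifs <;> simp

theorem exists_of_rowSum_pos {f : ℤ × ℤ →₀ ℕ} {x : ℤ} (h : rowSum f x ≠ 0) :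
    ∃ y, f (x, y) ≠ 0 := by
  by_contra! hc
  refine h (Finset.sum_eq_zero fun P _ => ?_)
  simp only
  split_ifs with hx
  · rw [← hc P.2, ← hx]
  · rfl

theorem exists_of_colSum_pos {f : ℤ × ℤ →₀ ℕ} {y : ℤ} (h : colSum f y ≠ 0) :
    ∃ x, f (x, y) ≠ 0 := by
  by_contra! hc
  refine h (Finset.sum_eq_zero fun P _ => ?_)
  simp only
  split_ifs with hx
  · rw [← hc P.1, ← hx]
  · rfl

theorem le_rowSum (f : ℤ × ℤ →₀ ℕ) (x y : ℤ) : f (x, y) ≤ rowSum f x := by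
  by_cases h : (x, y) ∈ f.support
  · refine le_trans ?_ (Finset.single_le_sum (fun _ _ => Nat.zero_le _) h)
    simp
  · simp [Finsupp.notMem_support_iff.1 h]

theorem le_colSum (f : ℤ × ℤ →₀ ℕ) (x y : ℤ) : f (x, y) ≤ colSum f y := by
  by_cases h : (x, y) ∈ f.support
  · refine le_trans ?_ (Finset.single_le_sum (fun _ _ => Nat.zero_le _) h)
    simp
  · simp [Finsupp.notMem_support_iff.1 h]

theorem rowSum_eq {f : ℤ × ℤ →₀ ℕ} {x : ℤ} (y z : ℤ) (hyz : y ≠ z)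
    (h : ∀ w, f (x, w) ≠ 0 → w = y ∨ w = z) : rowSum f x = f (x, y) + f (x, z) := by
  have h2 : ((x, y) : ℤ × ℤ) ≠ (x, z) := by simpa using hyz
  unfold rowSum
  rw [Finsupp.sum_of_support_subset f (s := f.support ∪ {(x, y), (x, z)})
    Finset.subset_union_left _ (by simp)]
  rw [← Finset.sum_subset (s₁ := {(x, y), (x, z)}) Finset.subset_union_right]
  · rw [Finset.sum_pair h2]; simp
  · rintro ⟨a, b⟩ _ hP
    simp only
    split_ifs with ha
    · subst ha
      by_contra hc
      rcases h b hc with rfl | rfl <;> simp at hP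
    · rfl

theorem colSum_eq {f : ℤ × ℤ →₀ ℕ} {x : ℤ} (y z : ℤ) (hyz : y ≠ z)
    (h : ∀ w, f (w, x) ≠ 0 → w = y ∨ w = z) : colSum f x = f (y, x) + f (z, x) := by
  have h2 : ((y, x) : ℤ × ℤ) ≠ (z, x) := by simpa using hyz
  unfold colSum
  rw [Finsupp.sum_of_support_subset f (s := f.support ∪ {(y, x), (z, x)})
    Finset.subset_union_left _ (by simp)]
  rw [← Finset.sum_subset (s₁ := {(y, x), (z, x)}) Finset.subset_union_right]
  · rw [Finset.sum_pair h2]; simp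
  · rintro ⟨a, b⟩ _ hP
    simp only
    split_ifs with ha
    · subst ha
      by_contra hc
      rcases h a hc with rfl | rfl <;> simp at hP
    · rfl

theorem rowSum_eq_single {f : ℤ × ℤ →₀ ℕ} {x : ℤ} (y : ℤ)
    (h : ∀ w, f (x, w) ≠ 0 → w = y) : rowSum f x = f (x, y) := by
  rw [rowSum_eq y (y + 1) (by omega) fun w hw => Or.inl (h w hw)]
  have : f (x, y + 1) = 0 := by by_contra hc; have := h _ hc; omega
  omega

theorem colSum_eq_single {f : ℤ × ℤ →₀ ℕ} {x : ℤ} (y : ℤ)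
    (h : ∀ w, f (w, x) ≠ 0 → w = y) : colSum f x = f (y, x) := by
  rw [colSum_eq y (y + 1) (by omega) fun w hw => Or.inl (h w hw)]
  have : f (y + 1, x) = 0 := by by_contra hc; have := h _ hc; omega
  omega

theorem eq_single_of_support {f : ℤ × ℤ →₀ ℕ} {x y : ℤ} (h : f (x, y) = 1)
    (h0 : ∀ a b, f (a, b) ≠ 0 → (a = x ∧ b = y)) : f = Finsupp.single (x, y) 1 := by
  ext ⟨a, b⟩
  by_cases hab : a = x ∧ b = y
  · rw [hab.1, hab.2, h]; simp
  · rw [Finsupp.single_eq_of_ne (by simpa using hab)]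
    by_contra hc; exact hab (h0 a b hc)

theorem eq_pair_of_support {f : ℤ × ℤ →₀ ℕ} {x y z w : ℤ} (hne : ¬ (x = z ∧ y = w))
    (h1 : f (x, y) = 1) (h2 : f (z, w) = 1)
    (h0 : ∀ a b, f (a, b) ≠ 0 → (a = x ∧ b = y) ∨ (a = z ∧ b = w)) :
    f = Finsupp.single (x, y) 1 + Finsupp.single (z, w) 1 := by
  ext ⟨a, b⟩
  rw [Finsupp.add_apply]
  simp only [Finsupp.single_apply, Prod.mk.injEq]
  by_cases hab : a = x ∧ b = y
  · obtain ⟨rfl, rfl⟩ := hab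
    rw [h1]; split_ifs <;> omega
  · by_cases hab' : a = z ∧ b = w
    · obtain ⟨rfl, rfl⟩ := hab'
      rw [h2]; split_ifs <;> omega
    · have h00 : f (a, b) = 0 := by by_contra hc; have := h0 a b hc; omega
      rw [h00]; split_ifs <;> omega

theorem eq_triple_of_support {f : ℤ × ℤ →₀ ℕ} {x y z w u v : ℤ} (hne : ¬ (x = z ∧ y = w))
    (hne' : ¬ (x = u ∧ y = v)) (hne'' : ¬ (z = u ∧ w = v))
    (h1 : f (x, y) = 1) (h2 : f (z, w) = 1) (h3 : f (u, v) = 1)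
    (h0 : ∀ a b, f (a, b) ≠ 0 → (a = x ∧ b = y) ∨ (a = z ∧ b = w) ∨ (a = u ∧ b = v)) :
    f = Finsupp.single (x, y) 1 + Finsupp.single (z, w) 1 + Finsupp.single (u, v) 1 := by
  ext ⟨a, b⟩
  rw [Finsupp.add_apply, Finsupp.add_apply]
  simp only [Finsupp.single_apply, Prod.mk.injEq]
  by_cases hab : a = x ∧ b = y
  · obtain ⟨rfl, rfl⟩ := hab
    rw [h1]; split_ifs <;> omega
  · by_cases hab' : a = z ∧ b = w
    · obtain ⟨rfl, rfl⟩ := hab'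
      rw [h2]; split_ifs <;> omega
    · by_cases hab'' : a = u ∧ b = v
      · obtain ⟨rfl, rfl⟩ := hab''
        rw [h3]; split_ifs <;> omega
      · have h00 : f (a, b) = 0 := by by_contra hc; have := h0 a b hc; omega
        rw [h00]; split_ifs <;> omega

/-- The multisets of points strictly between `α` and `β` with the weight of `α + β`. -/
structure Adm (n : ℕ) (α β : ℤ × ℤ) (f : ℤ × ℤ →₀ ℕ) : Prop where
  supp : ∀ P, f P ≠ 0 → IsPt n P ∧ α ≤ P ∧ P ≠ α ∧ P ≤ β ∧ P ≠ β
  bal : ∀ H : ℤ → ℤ, flux (fun v => H (lab n v)) f =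
    H (lab n α.1) - H (lab n α.2) + H (lab n β.1) - H (lab n β.2)

/-- The form that `Adm` takes inside one period. -/
structure WAdm (n : ℕ) (p q a b : ℤ) (f : ℤ × ℤ →₀ ℕ) : Prop where
  supp : ∀ x y, f (x, y) ≠ 0 → IsPt n (x, y) ∧ p ≤ x ∧ q ≤ y ∧ x ≤ a ∧ y ≤ b ∧
    ¬ (x = p ∧ y = q) ∧ ¬ (x = a ∧ y = b)
  bal : ∀ h : ℤ → ℤ, (∀ u v, u % 2 = 1 → v % 2 = 1 → h u = h v) →
    flux h f = h p - h q + h a - h b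

theorem IsPt.lt {n : ℕ} {P : ℤ × ℤ} (h : IsPt n P) : P.1 < P.2 := by
  unfold IsPt at h; omega

/-- All coordinates in the interval lie in a window of one period starting at `p`, where distinct
even numbers name distinct strands. A function constant on odd numbers therefore factors through
`lab` there. -/
theorem Adm.wAdm {n : ℕ} {p q a b : ℤ} {f : ℤ × ℤ →₀ ℕ} (hα : IsPt n (p, q)) (hβ : IsPt n (a, b))
    (hpa : p ≤ a) (hqb : q ≤ b)
    (hw : b < p + (4 * n + 2)) (hf : Adm n (p, q) (a, b) f) : WAdm n p q a b f := by
  have h1 := hα.lt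
  have h2 := hβ.lt
  simp only at h1 h2
  refine ⟨fun x y hxy => ?_, fun h hodd => ?_⟩
  · obtain ⟨i1, i2, i3, i4, i5⟩ := hf.supp _ hxy
    simp only [Prod.mk_le_mk, ne_eq, Prod.mk.injEq] at i2 i3 i4 i5
    exact ⟨i1, i2.1, i2.2, i4.1, i4.2, i3, i5⟩
  · obtain ⟨H, hH⟩ := exists_factor_lab n p h hodd
    have := hf.bal H
    rw [hH p (by omega) (by omega), hH q (by omega) (by omega), hH a (by omega) (by omega),
      hH b (by omega) (by omega)] at this
    rw [← this]
    refine Finset.sum_congr rfl fun P hP => ?_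
    obtain ⟨i1, i2, -, i4, -⟩ := hf.supp _ (Finsupp.mem_support_iff.1 hP)
    have := i1.lt
    rw [Prod.le_def] at i2 i4
    simp only at i2 i4
    simp only
    rw [hH P.1 (by omega) (by omega), hH P.2 (by omega) (by omega)]

/-- The indicator of an even number vanishes on all odd numbers, so it is an allowed test function.
Odd numbers cannot be separated in this way, which is why only even rows and columns are controlled.
-/
theorem WAdm.row_sub_col {n : ℕ} {p q a b : ℤ} {f : ℤ × ℤ →₀ ℕ} (hf : WAdm n p q a b f) {x : ℤ}
    (hx : x % 2 = 0) : (rowSum f x : ℤ) - colSum f x =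
      (if p = x then 1 else 0) - (if q = x then 1 else 0) + (if a = x then 1 else 0) -
        (if b = x then 1 else 0) := by
  rw [← flux_indicator]
  exact hf.bal _ fun u v hu hv => by rw [if_neg (by omega), if_neg (by omega)]

theorem WAdm.col_eq_zero {n : ℕ} {p q a b : ℤ} {f : ℤ × ℤ →₀ ℕ} (hf : WAdm n p q a b f) {x : ℤ}
    (hx : x < q) : colSum f x = 0 := by
  by_contra hc
  obtain ⟨y, hy⟩ := exists_of_colSum_pos hc
  have := hf.supp _ _ hy
  omega

theorem WAdm.row_eq_zero {n : ℕ} {p q a b : ℤ} {f : ℤ × ℤ →₀ ℕ} (hf : WAdm n p q a b f) {x : ℤ}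
    (hx : a < x) : rowSum f x = 0 := by
  by_contra hc
  obtain ⟨y, hy⟩ := exists_of_rowSum_pos hc
  have := hf.supp _ _ hy
  omega

/-- The number of points in a row left of all columns. -/
theorem WAdm.row {n : ℕ} {p q a b : ℤ} {f : ℤ × ℤ →₀ ℕ} (hf : WAdm n p q a b f) {x : ℤ}
    (hx : x % 2 = 0) (hq : x < q) (hqb : q ≤ b) :
    rowSum f x = (if p = x then 1 else 0) + (if a = x then 1 else 0) := by
  have h1 := hf.row_sub_col hx
  rw [hf.col_eq_zero hq, if_neg (show ¬ q = x by omega), if_neg (show ¬ b = x by omega)] at h1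
  split_ifs at h1 ⊢ <;> omega

theorem WAdm.col {n : ℕ} {p q a b : ℤ} {f : ℤ × ℤ →₀ ℕ} (hf : WAdm n p q a b f) {x : ℤ}
    (hx : x % 2 = 0) (hq : a < x) (hpa : p ≤ a) :
    colSum f x = (if q = x then 1 else 0) + (if b = x then 1 else 0) := by
  have h1 := hf.row_sub_col hx
  rw [hf.row_eq_zero hq, if_neg (show ¬ p = x by omega), if_neg (show ¬ a = x by omega)] at h1
  split_ifs at h1 ⊢ <;> omega

end TwistedA

/-! ### Admissible multisets when all rows lie left of all columns -/

namespace TwistedA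

/-- The possible multisets when rows and columns of the rectangle have distinct labels. -/
inductive RectOutcome (n : ℕ) (p q a b : ℤ) (f : ℤ × ℤ →₀ ℕ) : Prop
  | swap (h : p % 2 = 0 ∧ q % 2 = 0 ∧ a % 2 = 0 ∧ b % 2 = 0 ∧ p < a ∧ q < b)
      (hf : f = Finsupp.single (p, b) 1 + Finsupp.single (a, q) 1)
  | upper (h : p % 2 = 0 ∧ q % 2 = 0 ∧ a % 2 = 0 ∧ b % 2 = 0 ∧ p < a ∧ q < b)
      (h' : q < p + (2 * n + 1) ∧ p + (2 * n + 1) < b ∧ b < a + (2 * n + 1))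
      (hf : f = Finsupp.single (p, p + (2 * n + 1)) 1 + Finsupp.single (b - (2 * n + 1), b) 1 + Finsupp.single (a, q) 1)
  | lower (h : p % 2 = 0 ∧ q % 2 = 0 ∧ a % 2 = 0 ∧ b % 2 = 0 ∧ p < a ∧ q < b)
      (h' : p + (2 * n + 1) < q ∧ q < a + (2 * n + 1) ∧ a + (2 * n + 1) < b)
      (hf : f = Finsupp.single (q - (2 * n + 1), q) 1 + Finsupp.single (a, a + (2 * n + 1)) 1 + Finsupp.single (p, b) 1)
  | regAsc (h : p % 2 = 0 ∧ q % 2 = 0 ∧ a % 2 = 0 ∧ b = a + (2 * n + 1) ∧ p < a ∧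
      q < p + (2 * n + 1)) (hf : f = Finsupp.single (p, p + (2 * n + 1)) 1 + Finsupp.single (a, q) 1)
  | regDesc (h : p % 2 = 0 ∧ q % 2 = 0 ∧ a % 2 = 1 ∧ b = a + (2 * n + 1) ∧ q < b ∧
      p < q - (2 * n + 1)) (hf : f = Finsupp.single (p, b) 1 + Finsupp.single (q - (2 * n + 1), q) 1)
  | ascReg (h : p % 2 = 0 ∧ q = p + (2 * n + 1) ∧ a % 2 = 0 ∧ b % 2 = 0 ∧ p < a ∧
      a + (2 * n + 1) < b) (hf : f = Finsupp.single (p, b) 1 + Finsupp.single (a, a + (2 * n + 1)) 1)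
  | descReg (h : p % 2 = 1 ∧ q = p + (2 * n + 1) ∧ a % 2 = 0 ∧ b % 2 = 0 ∧ q < b ∧
      b - (2 * n + 1) < a) (hf : f = Finsupp.single (a, q) 1 + Finsupp.single (b - (2 * n + 1), b) 1)
  | ascDesc (h : p % 2 = 0 ∧ q = p + (2 * n + 1) ∧ a % 2 = 1 ∧ b = a + (2 * n + 1))
      (hf : f = Finsupp.single (p, b) 1)
  | descAsc (h : p % 2 = 1 ∧ q = p + (2 * n + 1) ∧ a % 2 = 0 ∧ b = a + (2 * n + 1))
      (hf : f = Finsupp.single (a, q) 1)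

/-- Even rows other than `p` and `a` have sum zero by `WAdm.row`, and dually for columns. -/
theorem WAdm.supp_rect {n : ℕ} {p q a b : ℤ} {f : ℤ × ℤ →₀ ℕ} (hpa : p ≤ a) (haq : a < q)
    (hqb : q ≤ b) (hf : WAdm n p q a b f) (x y : ℤ) (h : f (x, y) ≠ 0) :
    ((x % 2 = 0 ∧ y % 2 = 0 ∧ x < y ∧ y < x + (4 * n + 2)) ∨
      y = x + (2 * n + 1)) ∧ p ≤ x ∧ q ≤ y ∧ x ≤ a ∧ y ≤ b ∧
      ¬ (x = p ∧ y = q) ∧ ¬ (x = a ∧ y = b) ∧ (x % 2 = 1 ∨ x = p ∨ x = a) ∧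
      (y % 2 = 1 ∨ y = q ∨ y = b) := by
  obtain ⟨h1, h2, h3, h4, h5, h6, h7⟩ := hf.supp x y h
  refine ⟨h1, h2, h3, h4, h5, h6, h7, ?_, ?_⟩
  · by_contra hc
    have := hf.row (x := x) (by omega) (by omega) hqb
    rw [if_neg (by omega), if_neg (by omega)] at this
    have := le_rowSum f x y
    omega
  · by_contra hc
    have := hf.col (x := y) (by omega) (by omega) hpa
    rw [if_neg (by omega), if_neg (by omega)] at this
    have := le_colSum f x y
    omega

theorem WAdm.row_rect {n : ℕ} {p q a b : ℤ} {f : ℤ × ℤ →₀ ℕ} (hpa : p ≤ a) (haq : a < q)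
    (hqb : q ≤ b) (hf : WAdm n p q a b f) :
    (p % 2 = 0 → rowSum f p = if a = p then 2 else 1) ∧
      (a % 2 = 0 → rowSum f a = if a = p then 2 else 1) := by
  constructor <;> intro h <;> rw [hf.row h (by omega) hqb] <;> split_ifs <;> omega

theorem WAdm.col_rect {n : ℕ} {p q a b : ℤ} {f : ℤ × ℤ →₀ ℕ} (hpa : p ≤ a) (haq : a < q)
    (hqb : q ≤ b) (hf : WAdm n p q a b f) :
    (q % 2 = 0 → colSum f q = if b = q then 2 else 1) ∧
      (b % 2 = 0 → colSum f b = if b = q then 2 else 1) := by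
  constructor <;> intro h <;> rw [hf.col h (by omega) hpa] <;> split_ifs <;> omega

theorem WAdm.rectOutcome_central_central {n : ℕ} {p q a b : ℤ} {f : ℤ × ℤ →₀ ℕ}
    (hpa : p ≤ a) (haq : a < q) (hqb : q ≤ b)
    (hf : WAdm n p q a b f) (hmα : q = p + (2 * n + 1))
    (hmβ : b = a + (2 * n + 1)) : RectOutcome n p q a b f := by
  have S := hf.supp_rect hpa haq hqb
  obtain ⟨Rp, Ra⟩ := hf.row_rect hpa haq hqb
  obtain ⟨Cq, Cb⟩ := hf.col_rect hpa haq hqb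
  rcases Int.emod_two_eq_zero_or_one p with hp | hp <;>
    rcases Int.emod_two_eq_zero_or_one a with ha | ha
  · exfalso
    -- Row `p` is not empty. Since `q` and `b` are odd, its point would have an odd column and be
    -- central, hence equal to `α`.
    have h1 := Rp hp
    obtain ⟨y, hy⟩ := exists_of_rowSum_pos (f := f) (x := p) (by split_ifs at h1 <;> omega)
    have := S _ _ hy
    omega
  · refine .ascDesc (by omega) (eq_single_of_support ?_ fun x y h => by have := S x y h; omega)
    have h1 := Rp hp
    rw [rowSum_eq_single b fun w hw => by have := S _ _ hw; omega, if_neg (by omega)] at h1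
    exact h1
  · refine .descAsc (by omega) (eq_single_of_support ?_ fun x y h => by have := S x y h; omega)
    have h1 := Ra ha
    rw [rowSum_eq_single q fun w hw => by have := S _ _ hw; omega, if_neg (by omega)] at h1
    exact h1
  · exfalso
    have h1 := Cq (by omega)
    obtain ⟨y, hy⟩ := exists_of_colSum_pos (f := f) (y := q) (by split_ifs at h1 <;> omega)
    have := S _ _ hy
    omega

theorem WAdm.rectOutcome_central_regular {n : ℕ} {p q a b : ℤ} {f : ℤ × ℤ →₀ ℕ}
    (hβ : IsPt n (a, b)) (hpa : p ≤ a) (haq : a < q) (hqb : q ≤ b)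
    (hf : WAdm n p q a b f) (hmα : q = p + (2 * n + 1))
    (hmβ : ¬ b = a + (2 * n + 1)) : RectOutcome n p q a b f := by
  have S := hf.supp_rect hpa haq hqb
  obtain ⟨Rp, Ra⟩ := hf.row_rect hpa haq hqb
  obtain ⟨Cq, Cb⟩ := hf.col_rect hpa haq hqb
  unfold IsPt at hβ
  simp only at hβ
  rcases Int.emod_two_eq_zero_or_one p with hp | hp
  · have h1 := Rp hp
    have hlt : p < a := by
      by_contra hc
      obtain ⟨y, hy⟩ := exists_of_rowSum_pos (f := f) (x := p) (by split_ifs at h1 <;> omega)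
      have := S _ _ hy
      omega
    rw [rowSum_eq_single b fun w hw => by have := S _ _ hw; omega, if_neg (by omega)] at h1
    have h2 := Ra (by omega)
    rw [rowSum_eq_single (a + (2 * n + 1)) fun w hw => by have := S _ _ hw; omega,
      if_neg (by omega)] at h2
    have h3 := S a (a + (2 * n + 1)) (by omega)
    have h4 := Cb (by omega)
    rw [colSum_eq p (b - (2 * n + 1)) (by omega) fun w hw => by have := S _ _ hw; omega,
      if_neg (by omega)] at h4
    refine .ascReg (by omega) (eq_pair_of_support (by omega) h1 h2 fun x y h => ?_)
    have := S x y h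
    by_cases hc : x = b - (2 * n + 1) ∧ y = b
    · rw [hc.1, hc.2] at h; omega
    · omega
  · have h1 := Cq (by omega)
    have hlt : q < b := by
      by_contra hc
      obtain ⟨y, hy⟩ := exists_of_colSum_pos (f := f) (y := q) (by split_ifs at h1 <;> omega)
      have := S _ _ hy
      omega
    rw [colSum_eq_single a fun w hw => by have := S _ _ hw; omega, if_neg (by omega)] at h1
    have h2 := Cb (by omega)
    rw [colSum_eq_single (b - (2 * n + 1)) fun w hw => by have := S _ _ hw; omega,
      if_neg (by omega)] at h2
    have h3 := S (b - (2 * n + 1)) b (by omega)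
    have h4 := Ra (by omega)
    rw [rowSum_eq q (a + (2 * n + 1)) (by omega) fun w hw => by have := S _ _ hw; omega,
      if_neg (by omega)] at h4
    refine .descReg (by omega) (eq_pair_of_support (by omega) h1 h2 fun x y h => ?_)
    have := S x y h
    by_cases hc : x = a ∧ y = a + (2 * n + 1)
    · rw [hc.1, hc.2] at h; omega
    · omega

theorem WAdm.rectOutcome_regular_central {n : ℕ} {p q a b : ℤ} {f : ℤ × ℤ →₀ ℕ}
    (hα : IsPt n (p, q)) (hβ : IsPt n (a, b)) (hpa : p ≤ a) (haq : a < q) (hqb : q ≤ b)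
    (hf : WAdm n p q a b f) (hmα : ¬ q = p + (2 * n + 1))
    (hmβ : b = a + (2 * n + 1)) : RectOutcome n p q a b f := by
  have S := hf.supp_rect hpa haq hqb
  obtain ⟨Rp, Ra⟩ := hf.row_rect hpa haq hqb
  obtain ⟨Cq, Cb⟩ := hf.col_rect hpa haq hqb
  unfold IsPt at hα hβ
  simp only at hα hβ
  rcases Int.emod_two_eq_zero_or_one a with ha | ha
  · have h1 := Rp (by omega)
    have hlt : p < a := by
      by_contra hc
      obtain ⟨y, hy⟩ := exists_of_rowSum_pos (f := f) (x := p) (by split_ifs at h1 <;> omega)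
      have := S _ _ hy
      omega
    rw [rowSum_eq_single (p + (2 * n + 1)) fun w hw => by have := S _ _ hw; omega,
      if_neg (by omega)] at h1
    have h2 := Ra (by omega)
    rw [rowSum_eq_single q fun w hw => by have := S _ _ hw; omega,
      if_neg (by omega)] at h2
    have h3 := S p (p + (2 * n + 1)) (by omega)
    have h4 := Cq (by omega)
    rw [colSum_eq a (q - (2 * n + 1)) (by omega) fun w hw => by have := S _ _ hw; omega,
      if_neg (by omega)] at h4
    refine .regAsc (by omega) (eq_pair_of_support (by omega) h1 h2 fun x y h => ?_)
    have := S x y h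
    by_cases hc : x = q - (2 * n + 1) ∧ y = q
    · rw [hc.1, hc.2] at h; omega
    · omega
  · have h1 := Cq (by omega)
    have hlt : q < b := by
      by_contra hc
      obtain ⟨y, hy⟩ := exists_of_colSum_pos (f := f) (y := q) (by split_ifs at h1 <;> omega)
      have := S _ _ hy
      omega
    rw [colSum_eq_single (q - (2 * n + 1)) fun w hw => by have := S _ _ hw; omega,
      if_neg (by omega)] at h1
    have h2 := Cb (by omega)
    rw [colSum_eq_single p fun w hw => by have := S _ _ hw; omega,
      if_neg (by omega)] at h2
    have h3 := S (q - (2 * n + 1)) q (by omega)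
    have h4 := Rp (by omega)
    rw [rowSum_eq b (p + (2 * n + 1)) (by omega) fun w hw => by have := S _ _ hw; omega,
      if_neg (by omega)] at h4
    refine .regDesc (by omega) (eq_pair_of_support (by omega) h2 h1 fun x y h => ?_)
    have := S x y h
    by_cases hc : x = p ∧ y = p + (2 * n + 1)
    · rw [hc.1, hc.2] at h; omega
    · omega

theorem WAdm.rectOutcome_regular_regular {n : ℕ} {p q a b : ℤ} {f : ℤ × ℤ →₀ ℕ}
    (hα : IsPt n (p, q)) (hβ : IsPt n (a, b)) (hpa : p ≤ a) (haq : a < q) (hqb : q ≤ b)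
    (hb : b < p + (4 * n + 2)) (hf : WAdm n p q a b f) (hmα : ¬ q = p + (2 * n + 1))
    (hmβ : ¬ b = a + (2 * n + 1)) : RectOutcome n p q a b f := by
  have S := hf.supp_rect hpa haq hqb
  obtain ⟨Rp, Ra⟩ := hf.row_rect hpa haq hqb
  obtain ⟨Cq, Cb⟩ := hf.col_rect hpa haq hqb
  unfold IsPt at hα hβ
  simp only at hα hβ
  have hp : p % 2 = 0 := by omega
  have hq : q % 2 = 0 := by omega
  have ha : a % 2 = 0 := by omega
  have hb' : b % 2 = 0 := by omega
  have h1 := Rp hp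
  have h2 := Ra ha
  have h3 := Cq hq
  have h4 := Cb hb'
  have hlt : p < a := by
    by_contra hc
    obtain rfl : p = a := by omega
    have h0 : f (p, p + (2 * n + 1)) = 0 := by
      by_contra h0
      obtain ⟨x, hx⟩ := exists_of_colSum_pos (f := f) (y := b) (by split_ifs at h4 <;> omega)
      have := S _ _ h0
      have := S _ _ hx
      omega
    rw [rowSum_eq_single (p + (2 * n + 1)) fun w hw => by have := S _ _ hw; omega,
      if_pos rfl] at h1
    omega
  have hlt' : q < b := by
    by_contra hc
    obtain rfl : q = b := by omega
    have h0 : f (q - (2 * n + 1), q) = 0 := by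
      by_contra h0
      obtain ⟨x, hx⟩ := exists_of_rowSum_pos (f := f) (x := p) (by split_ifs at h1 <;> omega)
      have := S _ _ h0
      have := S _ _ hx
      omega
    rw [colSum_eq_single (q - (2 * n + 1)) fun w hw => by have := S _ _ hw; omega,
      if_pos rfl] at h3
    omega
  rw [if_neg (by omega)] at h1 h2 h3 h4
  -- In each of the two rows and two columns only a corner other than `α`, `β` and a central point
  -- remain possible, so every unit sum selects one of these two.
  rw [rowSum_eq b (p + (2 * n + 1)) (by omega) fun w hw => by have := S _ _ hw; omega] at h1
  rw [rowSum_eq q (a + (2 * n + 1)) (by omega) fun w hw => by have := S _ _ hw; omega] at h2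
  rw [colSum_eq a (q - (2 * n + 1)) (by omega) fun w hw => by have := S _ _ hw; omega] at h3
  rw [colSum_eq p (b - (2 * n + 1)) (by omega) fun w hw => by have := S _ _ hw; omega] at h4
  by_cases hc : f (a, q) = 1
  · by_cases hd : f (p, b) = 1
    · refine .swap (by omega) (eq_pair_of_support (by omega) hd hc fun x y h => ?_)
      have := S x y h
      by_cases hx : x = p
      · by_cases hy : y = p + (2 * n + 1)
        · subst hx hy; omega
        · omega
      · by_cases hx : x = a
        · by_cases hy : y = a + (2 * n + 1)
          · subst hx hy; omega
          · omega
        · rcases (show y = q ∨ y = b by omega) with rfl | rfl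
          · obtain rfl : x = y - (2 * n + 1) := by omega
            omega
          · obtain rfl : x = y - (2 * n + 1) := by omega
            omega
    · have h5 := S p (p + (2 * n + 1)) (by omega)
      have h6 := S (b - (2 * n + 1)) b (by omega)
      refine .upper (by omega) (by omega)
        (eq_triple_of_support (by omega) (by omega) (by omega) (by omega) (by omega) hc
          fun x y h => ?_)
      have := S x y h
      by_cases hx : x = p
      · by_cases hy : y = b
        · subst hx hy; omega
        · omega
      · by_cases hx : x = a
        · by_cases hy : y = a + (2 * n + 1)
          · subst hx hy; omega
          · omega
        · rcases (show y = q ∨ y = b by omega) with rfl | rfl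
          · obtain rfl : x = y - (2 * n + 1) := by omega
            omega
          · omega
  · have h5 := S a (a + (2 * n + 1)) (by omega)
    have h6 := S (q - (2 * n + 1)) q (by omega)
    -- Since `q - (2n + 1)` occurs as a row, it is at least `p`; by parity `p + (2n + 1)` lies
    -- strictly left of column `q`, outside the interval.
    have h7 : f (p, p + (2 * n + 1)) = 0 := by
      by_contra h0
      have := S _ _ h0
      omega
    refine .lower (by omega) (by omega)
        (eq_triple_of_support (by omega) (by omega) (by omega) (by omega) (by omega) (by omega)
          fun x y h => ?_)
    have := S x y h
    by_cases hx : x = p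
    · by_cases hy : y = p + (2 * n + 1)
      · subst hx hy; omega
      · omega
    · by_cases hx : x = a
      · by_cases hy : y = q
        · subst hx hy; omega
        · omega
      · rcases (show y = q ∨ y = b by omega) with rfl | rfl
        · omega
        · obtain rfl : x = y - (2 * n + 1) := by omega
          omega

theorem WAdm.rectOutcome {n : ℕ} {p q a b : ℤ} {f : ℤ × ℤ →₀ ℕ} (hα : IsPt n (p, q))
    (hβ : IsPt n (a, b)) (hpa : p ≤ a) (haq : a < q) (hqb : q ≤ b) (hb : b < p + (4 * n + 2))
    (hf : WAdm n p q a b f) : RectOutcome n p q a b f := by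
  by_cases hmα : q = p + (2 * n + 1) <;> by_cases hmβ : b = a + (2 * n + 1)
  · exact hf.rectOutcome_central_central hpa haq hqb hmα hmβ
  · exact hf.rectOutcome_central_regular hβ hpa haq hqb hmα hmβ
  · exact hf.rectOutcome_regular_central hα hβ hpa haq hqb hmα hmβ
  · exact hf.rectOutcome_regular_regular hα hβ hpa haq hqb hb hmα hmβ

end TwistedA

/-! ### Admissible multisets when the ranges of rows and columns meet -/

namespace TwistedA

theorem flux_eq_zero_of_nonneg {h : ℤ → ℤ} {f : ℤ × ℤ →₀ ℕ} (h0 : flux h f = 0)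
    (hP : ∀ x y, f (x, y) ≠ 0 → h y ≤ h x) (x y : ℤ) (hxy : f (x, y) ≠ 0) : h x = h y := by
  have := (Finset.sum_eq_zero_iff_of_nonneg (fun P hPs => ?_)).1 h0 (x, y)
    (Finsupp.mem_support_iff.2 hxy)
  · rcases mul_eq_zero.1 this with h1 | h1
    · exact absurd (by exact_mod_cast h1) hxy
    · simp only at h1; omega
  · have := hP P.1 P.2 (Finsupp.mem_support_iff.1 hPs)
    exact mul_nonneg (by positivity) (by omega)

/-- No multiset of points is admissible when the columns start strictly left of the last row. -/
theorem WAdm.false_of_gap {n : ℕ} {p q a b : ℤ} {f : ℤ × ℤ →₀ ℕ} (hα : IsPt n (p, q))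
    (hβ : IsPt n (a, b)) (hpa : p ≤ a) (hqa : q < a) (hqb : q ≤ b) (hb : b < p + (4 * n + 2))
    (hf : WAdm n p q a b f) : False := by
  have hpq := hα.lt
  have hab := hβ.lt
  simp only at hpq hab
  -- The test function is a step at `q` on even numbers. Its constant value on odd numbers is chosen
  -- such that the total weight vanishes while every point of the support contributes a nonnegative
  -- amount; so every contribution is zero.
  have key : ∀ x y, f (x, y) ≠ 0 →
      (if x % 2 = 0 then (if x ≤ q then 1 else 0) else (if b - (2 * n + 1) ≤ q then 1 else 0) : ℤ) =
      (if y % 2 = 0 then (if y ≤ q then 1 else 0) else (if b - (2 * n + 1) ≤ q then 1 else 0)) := by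
    refine flux_eq_zero_of_nonneg (h := fun x => if x % 2 = 0 then (if x ≤ q then 1 else 0) else
      (if b - (2 * n + 1) ≤ q then 1 else 0)) ?_ ?_
    · rw [hf.bal _ fun u v hu hv => by simp [hu, hv]]
      unfold IsPt at hα hβ
      simp only at hα hβ ⊢
      rcases Int.emod_two_eq_zero_or_one p with h1 | h1 <;>
        rcases Int.emod_two_eq_zero_or_one q with h2 | h2 <;>
        rcases Int.emod_two_eq_zero_or_one a with h3 | h3 <;>
        rcases Int.emod_two_eq_zero_or_one b with h4 | h4 <;>
        simp only [h1, h2, h3, h4, if_true, one_ne_zero, if_false] <;> split_ifs <;> omega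
    · intro x y hxy
      obtain ⟨i1, i2, i3, i4, i5, i6, i7⟩ := hf.supp x y hxy
      unfold IsPt at i1
      simp only at i1 ⊢
      split_ifs <;> omega
  have Row : ∀ x, x % 2 = 0 → x < q → rowSum f x = if p = x then 1 else 0 := fun x hx hxq => by
    rw [hf.row hx hxq hqb, if_neg (show ¬ a = x by omega), add_zero]
  have hrow : p % 2 = 0 → ∃ y, f (p, y) ≠ 0 := fun hp =>
    exists_of_rowSum_pos (by rw [Row p hp hpq, if_pos rfl]; omega)
  rcases Int.emod_two_eq_zero_or_one q with hq | hq
  · have h1 := hf.row_sub_col hq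
    rw [if_neg (by omega), if_pos rfl, if_neg (by omega), if_neg (by omega)] at h1
    -- The sum of column `q` exceeds that of row `q` by one. A point there with even `x` would lie
    -- in row `p`, hence be `α`. An odd `x` makes the point central, so `p + (2n + 1)` is not right
    -- of `q`; then nothing is left for the nonempty row `p`.
    obtain ⟨x, hx⟩ := exists_of_colSum_pos (f := f) (y := q) (by omega)
    have h2 := key x q hx
    obtain ⟨i1, i2, i3, i4, i5, i6, i7⟩ := hf.supp _ _ hx
    unfold IsPt at i1
    simp only at i1
    rw [if_pos hq, if_pos le_rfl] at h2
    rcases Int.emod_two_eq_zero_or_one x with hx2 | hx2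
    · have h3 := Row x hx2 (by omega)
      rw [if_neg (by omega)] at h3
      have := le_rowSum f x q
      omega
    · have hp : p % 2 = 0 := by
        clear hrow
        by_contra hp
        unfold IsPt at hα
        simp only at hα
        omega
      obtain ⟨y, hy⟩ := hrow hp
      have h4 := key _ _ hy
      obtain ⟨j1, j2, j3, j4, j5, j6, j7⟩ := hf.supp _ _ hy
      unfold IsPt at j1
      simp only at j1
      rw [if_pos hp, if_pos (by omega)] at h4
      split_ifs at h4 <;> omega
  · have hα' := hα
    unfold IsPt at hα'
    simp only at hα'
    obtain ⟨y, hy⟩ := hrow (by omega)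
    have h4 := key _ _ hy
    obtain ⟨j1, j2, j3, j4, j5, j6, j7⟩ := hf.supp _ _ hy
    unfold IsPt at j1
    simp only at j1
    rw [if_pos (by omega), if_pos (by omega)] at h4
    split_ifs at h4 <;> omega

/-- The possible multisets when the two points compose to a third one. -/
inductive ComposeOutcome (n : ℕ) (p b : ℤ) (f : ℤ × ℤ →₀ ℕ) : Prop
  | direct (h : p % 2 = 0 ∧ b % 2 = 0) (hf : f = Finsupp.single (p, b) 1)
  | central (h : p % 2 = 0 ∧ b % 2 = 0)
      (hf : f = Finsupp.single (p, p + (2 * n + 1)) 1 + Finsupp.single (b - (2 * n + 1), b) 1)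
  | asc (h : p % 2 = 0 ∧ b % 2 = 1) (hf : f = Finsupp.single (p, p + (2 * n + 1)) 1)
  | desc (h : p % 2 = 1 ∧ b % 2 = 0) (hf : f = Finsupp.single (b - (2 * n + 1), b) 1)

theorem WAdm.composeOutcome {n : ℕ} {p q b : ℤ} {f : ℤ × ℤ →₀ ℕ} (hα : IsPt n (p, q))
    (hβ : IsPt n (q, b)) (hb : b < p + (4 * n + 2))
    (hf : WAdm n p q q b f) : ComposeOutcome n p b f := by
  have hpq := hα.lt
  have hab := hβ.lt
  simp only at hpq hab
  unfold IsPt at hα hβ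
  simp only at hα hβ
  have Row : ∀ x, x % 2 = 0 → x < q → rowSum f x = if p = x then 1 else 0 := fun x hx hxq => by
    rw [hf.row hx hxq (by omega), if_neg (show ¬ q = x by omega), add_zero]
  have Col : ∀ x, x % 2 = 0 → q < x → colSum f x = if b = x then 1 else 0 := fun x hx hxq => by
    rw [hf.col hx hxq (by omega), if_neg (show ¬ q = x by omega), zero_add]
  have hq : q % 2 = 0 := by omega
  have S : ∀ x y, f (x, y) ≠ 0 → ((x % 2 = 0 ∧ y % 2 = 0) ∨ y = x + (2 * n + 1)) ∧ p ≤ x ∧ y ≤ b ∧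
      ¬ (x = p ∧ y = q) ∧ ¬ (x = q ∧ y = b) ∧ (x % 2 = 1 ∨ x = p ∨ x = q) ∧
      (y % 2 = 1 ∨ y = q ∨ y = b) ∧ x < y := by
    intro x y h
    obtain ⟨i1, i2, i3, i4, i5, i6, i7⟩ := hf.supp x y h
    unfold IsPt at i1
    simp only at i1
    refine ⟨by omega, i2, i5, i6, i7, ?_, ?_, by omega⟩
    · by_contra hc
      have h1 := Row x (by omega) (by omega)
      rw [if_neg (by omega)] at h1
      have := le_rowSum f x y
      omega
    · by_contra hc
      have h1 := Col y (by omega) (by omega)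
      rw [if_neg (by omega)] at h1
      have := le_colSum f x y
      omega
  have h1 := hf.row_sub_col hq
  rw [if_neg (by omega), if_pos rfl, if_neg (by omega),
    rowSum_eq_single (q + (2 * n + 1)) fun w hw => by have := S _ _ hw; omega,
    colSum_eq_single (q - (2 * n + 1)) fun w hw => by have := S _ _ hw; omega] at h1
  -- The sums of row `q` and column `q` agree. Central points in both of them would stretch the
  -- interval over a full period, so both sums vanish.
  have h2 : f (q, q + (2 * n + 1)) = 0 := by
    by_contra hc
    have h3 := S _ _ hc
    have h4 := S (q - (2 * n + 1)) q (by omega)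
    omega
  have h3 : f (q - (2 * n + 1), q) = 0 := by omega
  have T : ∀ x y, f (x, y) ≠ 0 → ((x % 2 = 0 ∧ y % 2 = 0) ∨ y = x + (2 * n + 1)) ∧ p ≤ x ∧ y ≤ b ∧
      (x % 2 = 1 ∨ x = p) ∧ (y % 2 = 1 ∨ y = b) ∧ ¬ (x = p ∧ y = q) ∧ ¬ (x = q ∧ y = b) := by
    intro x y h
    have := S x y h
    refine ⟨by omega, by omega, by omega, ?_, ?_, by omega, by omega⟩
    · by_contra hc
      obtain rfl : q = x := by omega
      obtain rfl : y = q + (2 * n + 1) := by omega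
      exact h h2
    · by_contra hc
      obtain rfl : q = y := by omega
      obtain rfl : x = q - (2 * n + 1) := by omega
      exact h h3
  rcases Int.emod_two_eq_zero_or_one p with hp | hp
  · have h4 := Row p hp hpq
    rw [if_pos rfl] at h4
    rcases Int.emod_two_eq_zero_or_one b with hb2 | hb2
    · have h5 := Col b hb2 hab
      rw [if_pos rfl] at h5
      rw [rowSum_eq b (p + (2 * n + 1)) (by omega) fun w hw => by have := T _ _ hw; omega] at h4
      rw [colSum_eq p (b - (2 * n + 1)) (by omega) fun w hw => by have := T _ _ hw; omega] at h5
      by_cases hc : f (p, b) = 1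
      · refine .direct ⟨hp, hb2⟩ (eq_single_of_support hc fun x y h => ?_)
        have := T _ _ h
        by_cases hx : x = p
        · by_cases hy : y = p + (2 * n + 1)
          · subst hx hy; omega
          · omega
        · obtain rfl : y = b := by omega
          obtain rfl : x = y - (2 * n + 1) := by omega
          omega
      · refine .central ⟨hp, hb2⟩ (eq_pair_of_support (by omega) (by omega) (by omega)
          fun x y h => ?_)
        have := T _ _ h
        by_cases hx : x = p
        · by_cases hy : y = b
          · subst hx hy; omega
          · omega
        · omega
    · rw [rowSum_eq_single (p + (2 * n + 1)) fun w hw => by have := T _ _ hw; omega] at h4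
      exact .asc ⟨hp, hb2⟩ (eq_single_of_support h4 fun x y h => by have := T _ _ h; omega)
  · have h5 := Col b (by omega) hab
    rw [if_pos rfl, colSum_eq_single (b - (2 * n + 1)) fun w hw => by
      have := T _ _ hw; omega] at h5
    exact .desc ⟨hp, by omega⟩ (eq_single_of_support h5 fun x y h => by have := T _ _ h; omega)

end TwistedA

/-! ### The antichain and the reducible multiset of an interval -/

namespace TwistedA

/-- The multisets of points that are single points or two incomparable points. -/
def IsAntichainPair (t : ℤ × ℤ →₀ ℕ) : Prop :=
  (∃ X, t = Finsupp.single X 1) ∨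
    ∃ X Y, ¬ X ≤ Y ∧ ¬ Y ≤ X ∧ t = Finsupp.single X 1 + Finsupp.single Y 1

/-- The multisets of points that contain two points which compose to a third one. -/
def Reducible (n : ℕ) (f : ℤ × ℤ →₀ ℕ) : Prop :=
  ∃ X Y g, f X ≠ 0 ∧ f Y ≠ 0 ∧ X ≠ Y ∧ Adm n X Y (Finsupp.single g 1)

theorem Adm.of_single {n : ℕ} {p q a b x y : ℤ} (h : IsPt n (x, y)) (h1 : p ≤ x) (h2 : q ≤ y)
    (h3 : x ≤ a) (h4 : y ≤ b) (h5 : ¬ (x = p ∧ y = q)) (h6 : ¬ (x = a ∧ y = b))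
    (hb : ∀ H : ℤ → ℤ, H (lab n x) - H (lab n y) =
      H (lab n p) - H (lab n q) + H (lab n a) - H (lab n b)) :
    Adm n (p, q) (a, b) (Finsupp.single (x, y) 1) := by
  refine ⟨fun P hP => ?_, fun H => ?_⟩
  · rw [Finsupp.single_apply] at hP
    split_ifs at hP with hc
    · subst hc
      exact ⟨h, ⟨h1, h2⟩, by simpa using h5, ⟨h3, h4⟩, by simpa using h6⟩
    · exact absurd rfl hP
  · rw [flux_single]
    push_cast
    rw [one_mul]
    exact hb H

/-- The central strand cancels in the sum of the weights of the two central points. This relation,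
with the order of the two points reversed in `Adm.of_central'`, makes the outcomes `upper`, `lower`
and `central` reducible. -/
theorem Adm.of_central {n : ℕ} {u v : ℤ} (hu : u % 2 = 0) (hv : v % 2 = 0)
    (h : u + (2 * n + 1) < v) (h' : v < u + (4 * n + 2)) :
    Adm n (u, u + (2 * n + 1)) (v - (2 * n + 1), v) (Finsupp.single (u, v) 1) := by
  refine .of_single (by unfold IsPt; simp only; omega) (by omega) (by omega) (by omega) (by omega)
    (by omega) (by omega) fun H => ?_
  rw [lab_of_odd (v := u + (2 * n + 1)) (by omega), lab_of_odd (v := v - (2 * n + 1)) (by omega)]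
  ring

theorem Adm.of_central' {n : ℕ} {u v : ℤ} (hu : u % 2 = 0) (hv : v % 2 = 0)
    (h : u < v) (h' : v < u + (2 * n + 1)) :
    Adm n (v - (2 * n + 1), v) (u, u + (2 * n + 1)) (Finsupp.single (u, v) 1) := by
  refine .of_single (by unfold IsPt; simp only; omega) (by omega) (by omega) (by omega) (by omega)
    (by omega) (by omega) fun H => ?_
  rw [lab_of_odd (v := u + (2 * n + 1)) (by omega), lab_of_odd (v := v - (2 * n + 1)) (by omega)]
  ring

theorem Adm.of_swap {n : ℕ} {p q a b : ℤ}
    (h : p % 2 = 0 ∧ q % 2 = 0 ∧ a % 2 = 0 ∧ b % 2 = 0 ∧ p < a ∧ q < b) (haq : a < q)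
    (hb : b < p + (4 * n + 2)) :
    Adm n (p, q) (a, b) (Finsupp.single (p, b) 1 + Finsupp.single (a, q) 1) := by
  refine ⟨fun P hP => ?_, fun H => ?_⟩
  · rw [Finsupp.add_apply, Finsupp.single_apply, Finsupp.single_apply] at hP
    have : P = (p, b) ∨ P = (a, q) := by
      by_contra! hc
      rw [if_neg hc.1.symm, if_neg hc.2.symm] at hP
      exact hP rfl
    rcases this with rfl | rfl
    all_goals
      unfold IsPt
      simp only [Prod.mk_le_mk, ne_eq, Prod.mk.injEq]
      omega
  · rw [flux_add, flux_single, flux_single]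
    push_cast
    ring

end TwistedA

namespace TwistedA

/-- All multisets strictly between `α` and `β` of the weight of `α + β` are a fixed antichain
`t`, or a fixed reducible one. -/
def HasSocle (n : ℕ) (α β : ℤ × ℤ) : Prop :=
  ∃ t r, ∀ f, Adm n α β f → Adm n α β t ∧ IsAntichainPair t ∧ (f = t ∨ f = r ∧ Reducible n f)

theorem reducible_of_central {n : ℕ} {u v : ℤ} {f g : ℤ × ℤ →₀ ℕ} (hu : u % 2 = 0)
    (hv : v % 2 = 0) (h : u + (2 * n + 1) < v) (h' : v < u + (4 * n + 2))
    (hf : f = Finsupp.single (u, u + (2 * n + 1)) 1 + Finsupp.single (v - (2 * n + 1), v) 1 + g) :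
    Reducible n f := by
  refine ⟨_, _, _, ?_, ?_, ?_, Adm.of_central hu hv h h'⟩
  · rw [hf]; simp
  · rw [hf]; simp
  · simp only [ne_eq, Prod.mk.injEq]; omega

theorem reducible_of_central' {n : ℕ} {u v : ℤ} {f g : ℤ × ℤ →₀ ℕ} (hu : u % 2 = 0)
    (hv : v % 2 = 0) (h : u < v) (h' : v < u + (2 * n + 1))
    (hf : f = Finsupp.single (v - (2 * n + 1), v) 1 + Finsupp.single (u, u + (2 * n + 1)) 1 + g) :
    Reducible n f := by
  refine ⟨_, _, _, ?_, ?_, ?_, Adm.of_central' hu hv h h'⟩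
  · rw [hf]; simp
  · rw [hf]; simp
  · simp only [ne_eq, Prod.mk.injEq]; omega

/-- If `α` and `β` are opposite corners of a proper rectangle with even coordinates, the other two
corners form the antichain. One corner may be replaced by two central points, and the side of the
central row on which `α` lies decides which corner. In all other positions at most one multiset
exists. -/
theorem hasSocle_rect {n : ℕ} {p q a b : ℤ} (hα : IsPt n (p, q))
    (hβ : IsPt n (a, b)) (hpa : p ≤ a) (haq : a < q) (hqb : q ≤ b) (hb : b < p + (4 * n + 2)) :
    HasSocle n (p, q) (a, b) := by
  have O : ∀ f, Adm n (p, q) (a, b) f → RectOutcome n p q a b f := fun f hf =>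
    (hf.wAdm hα hβ hpa hqb hb).rectOutcome hα hβ hpa haq hqb hb
  by_cases he : p % 2 = 0 ∧ q % 2 = 0 ∧ a % 2 = 0 ∧ b % 2 = 0 ∧ p < a ∧ q < b
  · refine ⟨Finsupp.single (p, b) 1 + Finsupp.single (a, q) 1,
      if q < p + (2 * n + 1) then Finsupp.single (p, p + (2 * (n : ℤ) + 1)) 1 +
          Finsupp.single (b - (2 * (n : ℤ) + 1), b) 1 + Finsupp.single (a, q) 1
        else Finsupp.single (q - (2 * (n : ℤ) + 1), q) 1 +
          Finsupp.single (a, a + (2 * (n : ℤ) + 1)) 1 + Finsupp.single (p, b) 1,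
      fun f hf => ⟨.of_swap he haq hb, Or.inr ⟨_, _, ?_, ?_, rfl⟩, ?_⟩⟩
    · simp only [Prod.mk_le_mk]; omega
    · simp only [Prod.mk_le_mk]; omega
    cases O f hf with
    | swap h hf' => exact Or.inl hf'
    | upper h h' hf' =>
      refine Or.inr ⟨by rw [if_pos h'.1, hf'], reducible_of_central ?_ ?_ ?_ ?_ hf'⟩ <;> omega
    | lower h h' hf' =>
      refine Or.inr ⟨by rw [if_neg (by omega), hf'], reducible_of_central' ?_ ?_ ?_ ?_ hf'⟩ <;>
        omega
    | _ => omega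
  · by_cases hex : ∃ f, Adm n (p, q) (a, b) f
    · obtain ⟨t, ht⟩ := hex
      have anti : IsAntichainPair t := by
        cases O t ht with
        | swap => omega
        | upper => omega
        | lower => omega
        | ascDesc h hf' => exact Or.inl ⟨_, hf'⟩
        | descAsc h hf' => exact Or.inl ⟨_, hf'⟩
        | _ h hf' =>
          refine Or.inr ⟨_, _, ?_, ?_, hf'⟩ <;> simp only [Prod.mk_le_mk] <;> omega
      -- No second multiset occurs here; `0` only fills its place.
      refine ⟨t, 0, fun f hf => ⟨ht, anti, Or.inl ?_⟩⟩
      cases O t ht with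
      | swap => omega
      | upper => omega
      | lower => omega
      | _ h ht' =>
        cases O f hf with
        | swap => omega
        | upper => omega
        | lower => omega
        | _ h' hf' => first | omega | exact hf'.trans ht'.symm
    · exact ⟨0, 0, fun f hf => absurd ⟨f, hf⟩ hex⟩

theorem adm_direct {n : ℕ} {p q b : ℤ} (hp : p % 2 = 0) (hb : b % 2 = 0) (hpq : p < q)
    (hqb : q < b) (h : b < p + (4 * n + 2)) :
    Adm n (p, q) (q, b) (Finsupp.single (p, b) 1) :=
  .of_single (by unfold IsPt; simp only; omega) (by omega) (by omega) (by omega) (by omega)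
    (by omega) (by omega) fun H => by ring

theorem hasSocle_compose {n : ℕ} {p q a b : ℤ} (hα : IsPt n (p, q))
    (hβ : IsPt n (a, b)) (hpa : p ≤ a) (hqa : q ≤ a) (hqb : q ≤ b) (hb : b < p + (4 * n + 2)) :
    HasSocle n (p, q) (a, b) := by
  by_cases hex : ∃ f, Adm n (p, q) (a, b) f
  swap
  · exact ⟨0, 0, fun f hf => absurd ⟨f, hf⟩ hex⟩
  obtain ⟨t, ht⟩ := hex
  obtain rfl : q = a := by
    by_contra hne
    exact (ht.wAdm hα hβ hpa hqb hb).false_of_gap hα hβ hpa (by omega) hqb hb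
  have hpq := hα.lt
  have hab := hβ.lt
  simp only at hpq hab
  have O : ∀ f, Adm n (p, q) (q, b) f → ComposeOutcome n p b f := fun f hf =>
    (hf.wAdm hα hβ hpa hqb hb).composeOutcome hα hβ hb
  by_cases he : p % 2 = 0 ∧ b % 2 = 0
  · refine ⟨Finsupp.single (p, b) 1, Finsupp.single (p, p + (2 * (n : ℤ) + 1)) 1 +
      Finsupp.single (b - (2 * (n : ℤ) + 1), b) 1, fun f hf =>
      ⟨adm_direct he.1 he.2 hpq hab hb, Or.inl ⟨_, rfl⟩, ?_⟩⟩
    cases O f hf with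
    | direct h hf' => exact Or.inl hf'
    | central h hf' =>
      have := (hf.wAdm hα hβ hpa hqb hb).supp p (p + (2 * n + 1)) (by rw [hf']; simp)
      exact Or.inr ⟨hf', reducible_of_central (g := 0) he.1 he.2 (by omega) hb (by rw [hf', add_zero])⟩
    | _ => omega
  · refine ⟨t, 0, fun f hf => ⟨ht, ?_, Or.inl ?_⟩⟩
    · cases O t ht with
      | central => omega
      | _ h hf' => exact Or.inl ⟨_, hf'⟩
    · cases O t ht with
      | central => omega
      | _ h ht' =>
        cases O f hf with
        | central => omega
        | _ h' hf' => first | omega | exact hf'.trans ht'.symm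

theorem hasSocle_window {n : ℕ} {p q a b : ℤ} (hα : IsPt n (p, q))
    (hβ : IsPt n (a, b)) (hpa : p ≤ a) (hqb : q ≤ b) (hb : b < p + (4 * n + 2)) :
    HasSocle n (p, q) (a, b) := by
  rcases lt_or_ge a q with h | h
  · exact hasSocle_rect hα hβ hpa h hqb hb
  · exact hasSocle_compose hα hβ hpa h hqb hb

/-- A pair of points `α`, `β`, a point `g` and a multiset `f` of two central points, all of the
same weight. -/
def IsExceptional (n : ℕ) (p q b : ℤ) (α β g : ℤ × ℤ) (f : ℤ × ℤ →₀ ℕ) : Prop :=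
  p % 2 = 0 ∧ q % 2 = 0 ∧ b % 2 = 0 ∧ p + (2 * n + 1) < b ∧ b < q + (2 * n + 1) ∧
    q < p + (2 * n + 1) ∧ q < b ∧ p < q ∧ α = (p, q) ∧ β = (q, b) ∧ g = (p, b) ∧
    f = Finsupp.single (p, p + (2 * (n : ℤ) + 1)) 1 + Finsupp.single (b - (2 * (n : ℤ) + 1), b) 1

theorem single_ne_of_degree {X : ℤ × ℤ} {f : ℤ × ℤ →₀ ℕ} (h : f.degree ≠ 1) :
    Finsupp.single X 1 ≠ f := by
  rintro rfl
  simp at h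

/-- In the rectangle case a single point arises only from two central points whose first coordinates
have opposite parity, and then nothing else is admissible. So `α` and `β` compose, and two different
outcomes, one of them a single point, can only be `direct` and `central`. -/
theorem exceptional_window {n : ℕ} {p q a b : ℤ} (hα : IsPt n (p, q))
    (hβ : IsPt n (a, b)) (hpa : p ≤ a) (hqb : q ≤ b) (hb : b < p + (4 * n + 2))
    {g : ℤ × ℤ} {f : ℤ × ℤ →₀ ℕ} (hg : Adm n (p, q) (a, b) (Finsupp.single g 1))
    (hf : Adm n (p, q) (a, b) f) (hne : f ≠ Finsupp.single g 1) :
    IsExceptional n p q b (p, q) (a, b) g f := by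
  have Wg := hg.wAdm hα hβ hpa hqb hb
  have Wf := hf.wAdm hα hβ hpa hqb hb
  rcases lt_trichotomy a q with h | rfl | h
  · exfalso
    have O := Wg.rectOutcome hα hβ hpa h hqb hb
    have O' := Wf.rectOutcome hα hβ hpa h hqb hb
    cases O with
    | ascDesc i hg' =>
      cases O' with
      | ascDesc j hf' => exact hne (by rw [hf', hg'])
      | _ => omega
    | descAsc i hg' =>
      cases O' with
      | descAsc j hf' => exact hne (by rw [hf', hg'])
      | _ => omega
    | swap i hg' => exact single_ne_of_degree (by simp) hg'
    | upper i i' hg' => exact single_ne_of_degree (by simp) hg'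
    | lower i i' hg' => exact single_ne_of_degree (by simp) hg'
    | _ i hg' => exact single_ne_of_degree (by simp) hg'
  · have O := Wg.composeOutcome hα hβ hb
    have O' := Wf.composeOutcome hα hβ hb
    cases O with
    | central i hg' => exact absurd hg' (single_ne_of_degree (by simp))
    | direct i hg' =>
      cases O' with
      | direct j hf' => exact absurd (by rw [hf', hg']) hne
      | central j hf' =>
        have h1 := Wf.supp p (p + (2 * n + 1)) (by rw [hf']; simp)
        have h2 := Wf.supp (b - (2 * n + 1)) b (by rw [hf']; simp)
        have hg'' := (Finsupp.single_left_inj (one_ne_zero)).1 hg'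
        unfold IsPt at hα hβ
        simp only at hα hβ
        exact ⟨by omega, by omega, by omega, by omega, by omega, by omega, by omega, by omega,
          rfl, rfl, hg'', hf'⟩
      | _ => omega
    | _ i hg' =>
      cases O' with
      | central j hf' => omega
      | _ j hf' => first | omega | exact absurd (by rw [hf', hg']) hne
  · exact (Wf.false_of_gap hα hβ hpa h hqb hb).elim

/-- The shift exchanges the coordinates up to a period, so it negates all weights. Equalities
between weights therefore survive it. -/
theorem flux_equivMapDomain_tau {n : ℕ} (f : ℤ × ℤ →₀ ℕ) (H : ℤ → ℤ) :
    flux (fun v => H (lab n v)) (Finsupp.equivMapDomain (tau n) f) =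
      - flux (fun v => H (lab n v)) f := by
  induction f using Finsupp.induction_linear with
  | zero => simp [flux]
  | add f g hf hg =>
    rw [Finsupp.equivMapDomain_eq_mapDomain] at *
    rw [Finsupp.mapDomain_add, flux_add, flux_add, ← Finsupp.equivMapDomain_eq_mapDomain, hf,
      Finsupp.equivMapDomain_eq_mapDomain] at *
    rw [hg]; ring
  | single P k =>
    rw [Finsupp.equivMapDomain_single, flux_single, flux_single, tau_apply]
    simp only [lab_add_period]
    ring

theorem Adm.tau {n : ℕ} {α β : ℤ × ℤ} {f : ℤ × ℤ →₀ ℕ} (h : Adm n α β f) :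
    Adm n (TwistedA.tau n α) (TwistedA.tau n β) (Finsupp.equivMapDomain (TwistedA.tau n) f) := by
  refine ⟨fun P hP => ?_, fun H => ?_⟩
  · rw [Finsupp.equivMapDomain_apply] at hP
    obtain ⟨h1, h2, h3, h4, h5⟩ := h.supp _ hP
    rw [← (TwistedA.tau n).apply_symm_apply P]
    exact ⟨h1.tau, tau_le_tau.2 h2, (TwistedA.tau n).injective.ne h3, tau_le_tau.2 h4,
      (TwistedA.tau n).injective.ne h5⟩
  · rw [flux_equivMapDomain_tau, h.bal]
    simp only [tau_apply, lab_add_period]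
    ring

theorem Adm.of_tau {n : ℕ} {α β : ℤ × ℤ} {f : ℤ × ℤ →₀ ℕ}
    (h : Adm n (TwistedA.tau n α) (TwistedA.tau n β) (Finsupp.equivMapDomain (TwistedA.tau n) f)) :
    Adm n α β f := by
  refine ⟨fun P hP => ?_, fun H => ?_⟩
  · obtain ⟨h1, h2, h3, h4, h5⟩ := h.supp (TwistedA.tau n P) (by
      rwa [Finsupp.equivMapDomain_apply, Equiv.symm_apply_apply])
    refine ⟨?_, tau_le_tau.1 h2, fun h => h3 (by rw [h]), tau_le_tau.1 h4, fun h => h5 (by rw [h])⟩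
    simpa using h1.tau_symm
  · have := h.bal H
    rw [flux_equivMapDomain_tau] at this
    simp only [tau_apply, lab_add_period] at this
    linarith

theorem exists_equivMapDomain_tau (n : ℕ) (f : ℤ × ℤ →₀ ℕ) :
    ∃ g, f = Finsupp.equivMapDomain (tau n) g :=
  ⟨Finsupp.equivMapDomain (tau n).symm f, by ext; simp [Finsupp.equivMapDomain_apply]⟩

theorem Reducible.tau {n : ℕ} {f : ℤ × ℤ →₀ ℕ} (h : Reducible n f) :
    Reducible n (Finsupp.equivMapDomain (TwistedA.tau n) f) := by
  obtain ⟨X, Y, g, h1, h2, h3, h4⟩ := h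
  refine ⟨TwistedA.tau n X, TwistedA.tau n Y, TwistedA.tau n g, ?_, ?_,
    (TwistedA.tau n).injective.ne h3, ?_⟩
  · rwa [Finsupp.equivMapDomain_apply, Equiv.symm_apply_apply]
  · rwa [Finsupp.equivMapDomain_apply, Equiv.symm_apply_apply]
  · rw [← Finsupp.equivMapDomain_single]; exact h4.tau

theorem equivMapDomain_add_single (e : ℤ × ℤ ≃ ℤ × ℤ) (X Y : ℤ × ℤ) (k l : ℕ) :
    Finsupp.equivMapDomain e (Finsupp.single X k + Finsupp.single Y l) =
      Finsupp.single (e X) k + Finsupp.single (e Y) l := by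
  rw [Finsupp.equivMapDomain_eq_mapDomain, Finsupp.mapDomain_add, Finsupp.mapDomain_single,
    Finsupp.mapDomain_single]

theorem IsAntichainPair.tau {n : ℕ} {f : ℤ × ℤ →₀ ℕ} (h : IsAntichainPair f) :
    IsAntichainPair (Finsupp.equivMapDomain (TwistedA.tau n) f) := by
  rcases h with ⟨X, rfl⟩ | ⟨X, Y, h1, h2, rfl⟩
  · exact Or.inl ⟨_, Finsupp.equivMapDomain_single _ _ _⟩
  · refine Or.inr ⟨TwistedA.tau n X, TwistedA.tau n Y, ?_, ?_, equivMapDomain_add_single _ _ _ _ _⟩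
    · rwa [tau_le_tau]
    · rwa [tau_le_tau]

theorem HasSocle.tau {n : ℕ} {α β : ℤ × ℤ} (h : HasSocle n α β) :
    HasSocle n (TwistedA.tau n α) (TwistedA.tau n β) := by
  obtain ⟨t, r, h⟩ := h
  refine ⟨Finsupp.equivMapDomain (TwistedA.tau n) t, Finsupp.equivMapDomain (TwistedA.tau n) r,
    fun f hf => ?_⟩
  obtain ⟨g, rfl⟩ := exists_equivMapDomain_tau n f
  obtain ⟨h1, h2, h3⟩ := h g hf.of_tau
  refine ⟨h1.tau, h2.tau, h3.imp (fun h => by rw [h]) fun h => ⟨by rw [h.1], h.2.tau⟩⟩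

/-- Two points that are closer than a shift of the quiver lie in one period up to a shift. -/
theorem window_or_tau {n : ℕ} {α β : ℤ × ℤ} (h : ¬ tau n α ≤ β) :
    β.2 < α.1 + (4 * n + 2) ∨
      ((tau n).symm β).2 < ((tau n).symm α).1 + (4 * n + 2) := by
  simp only [tau_apply, Prod.le_def, tau_symm_apply] at *
  omega

theorem hasSocle {n : ℕ} {α β : ℤ × ℤ} (hα : IsPt n α) (hβ : IsPt n β) (hle : α ≤ β)
    (h : ¬ tau n α ≤ β) : HasSocle n α β := by
  rcases window_or_tau h with hw | hw
  · exact hasSocle_window hα hβ hle.1 hle.2 hw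
  · rw [← (tau n).apply_symm_apply α, ← (tau n).apply_symm_apply β]
    have hle' : (tau n).symm α ≤ (tau n).symm β := by rwa [tau_symm_le, Equiv.apply_symm_apply]
    exact (hasSocle_window hα.tau_symm hβ.tau_symm hle'.1 hle'.2 hw).tau

/-- The exceptional situation up to a shift. -/
theorem exceptional {n : ℕ} {α β : ℤ × ℤ} (hα : IsPt n α) (hβ : IsPt n β) (hle : α ≤ β)
    (h : ¬ tau n α ≤ β) {g : ℤ × ℤ} {f : ℤ × ℤ →₀ ℕ} (hg : Adm n α β (Finsupp.single g 1))
    (hf : Adm n α β f) (hne : f ≠ Finsupp.single g 1) :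
    ∃ p q b, IsExceptional n p q b α β g f ∨ ∃ α' β' g' f', IsExceptional n p q b α' β' g' f' ∧
      α = tau n α' ∧ β = tau n β' ∧ g = tau n g' ∧ f = Finsupp.equivMapDomain (tau n) f' := by
  rcases window_or_tau h with hw | hw
  · exact ⟨_, _, _, Or.inl (exceptional_window hα hβ hle.1 hle.2 hw hg hf hne)⟩
  · have hle' : (tau n).symm α ≤ (tau n).symm β := by rwa [tau_symm_le, Equiv.apply_symm_apply]
    obtain ⟨f', rfl⟩ := exists_equivMapDomain_tau n f
    rw [← (tau n).apply_symm_apply α, ← (tau n).apply_symm_apply β] at hg hf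
    rw [← (tau n).apply_symm_apply g, ← Finsupp.equivMapDomain_single] at hg hne
    exact ⟨_, _, _, Or.inr ⟨_, _, _, f', exceptional_window hα.tau_symm hβ.tau_symm hle'.1 hle'.2 hw
      hg.of_tau hf.of_tau fun h => hne (by rw [h]), (Equiv.apply_symm_apply _ _).symm,
      (Equiv.apply_symm_apply _ _).symm, (Equiv.apply_symm_apply _ _).symm, rfl⟩⟩

end TwistedA

namespace TwistedA

/-! Words and their heaps. -/

theorem not_near_iff {m : ℕ} {i j : Fin m} :
    ¬ Near i j ↔ (i : ℕ) + 1 < (j : ℕ) ∨ (j : ℕ) + 1 < (i : ℕ) := by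
  unfold Near; omega

theorem CommStep.symm {m : ℕ} {w w' : List (Fin m)} (h : CommStep w w') : CommStep w' w := by
  cases h with
  | swap u v a b h => exact .swap u v b a h.symm

/-- A property of words that is stable under commutation depends on the class only. -/
theorem commClass_induction {m : ℕ} {C : List (Fin m) → Prop}
    (hC : ∀ w w', CommStep w w' → C w → C w') {w w' : List (Fin m)}
    (h : commClass w = commClass w') (hw : C w) : C w' := by
  have : Quot.lift C (fun a b hab => propext ⟨hC _ _ hab, hC _ _ hab.symm⟩) (commClass w) =
      Quot.lift C (fun a b hab => propext ⟨hC _ _ hab, hC _ _ hab.symm⟩) (commClass w') := by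
    rw [h]
  exact this.mp hw

theorem move_induction {T : Type*} {near : T → T → Prop} {C : List T → Prop}
    (hC : ∀ A B P Q, ¬ near P Q → C (A ++ P :: Q :: B) → C (A ++ Q :: P :: B)) (P : T)
    (A F B : List T) (h : ∀ Q ∈ F, ¬ near P Q) (hL : C (A ++ P :: (F ++ B))) :
    C (A ++ (F ++ P :: B)) := by
  induction F generalizing A with
  | nil => exact hL
  | cons Q F ih =>
    have := ih (A ++ [Q]) (fun R hR => h R (List.mem_cons_of_mem _ hR))
      (by simpa using hC A (F ++ B) P Q (h Q (by simp)) hL)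
    simpa using this

/-- A property of lists that is stable under commutations passes to the list in which the
elements of a lower set come first. -/
theorem filter_induction {T : Type*} {near : T → T → Prop} {C : List T → Prop}
    (hC : ∀ A B P Q, ¬ near P Q → C (A ++ P :: Q :: B) → C (A ++ Q :: P :: B)) (f : T → Bool)
    (A L : List T) (h : L.Pairwise fun P Q => f P = false → f Q = true → ¬ near P Q)
    (hL : C (A ++ L)) : C (A ++ (L.filter f ++ L.filter fun P => !f P)) := by
  induction L generalizing A with
  | nil => exact hL
  | cons P L ih =>
    rw [List.pairwise_cons] at h
    have ih := ih (A ++ [P]) h.2 (by simpa using hL)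
    rw [List.append_assoc, List.singleton_append] at ih
    cases hP : f P with
    | true => simpa [hP] using ih
    | false =>
      have := move_induction hC P A (L.filter f) (L.filter fun P => !f P) (fun Q hQ => by
        rw [List.mem_filter] at hQ
        exact h.1 Q hQ.1 hP hQ.2) ih
      simpa [hP] using this

@[simp] theorem wordProd_nil {m : ℕ} : wordProd ([] : List (Fin m)) = 1 := rfl

@[simp] theorem wordProd_cons {m : ℕ} (i : Fin m) (w : List (Fin m)) :
    wordProd (i :: w) = simpleRefl i * wordProd w := by simp [wordProd]

@[simp] theorem wordProd_append {m : ℕ} (v w : List (Fin m)) :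
    wordProd (v ++ w) = wordProd v * wordProd w := by simp [wordProd]

theorem simpleRefl_comm {m : ℕ} {i j : Fin m} (h : ¬ Near i j) :
    simpleRefl i * simpleRefl j = simpleRefl j * simpleRefl i := by
  rw [not_near_iff] at h
  refine (Equiv.Perm.Disjoint.commute ?_).eq
  intro x
  unfold simpleRefl
  by_cases hx : x = i.castSucc ∨ x = i.succ
  · right
    apply Equiv.swap_apply_of_ne_of_ne <;> rcases hx with rfl | rfl <;>
      simp only [ne_eq, Fin.ext_iff, Fin.val_castSucc, Fin.val_succ] <;> omega
  · left
    rw [not_or] at hx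
    exact Equiv.swap_apply_of_ne_of_ne hx.1 hx.2

theorem CommStep.wordProd_eq {m : ℕ} {w w' : List (Fin m)} (h : CommStep w w') :
    wordProd w = wordProd w' := by
  cases h with
  | swap u v a b h =>
    simp only [wordProd_append, wordProd_cons, ← mul_assoc]
    rw [mul_assoc _ (simpleRefl a), simpleRefl_comm (not_near_iff.2 h), ← mul_assoc]

theorem simpleRefl_mul_self {m : ℕ} (i : Fin m) : simpleRefl i * simpleRefl i = 1 :=
  Equiv.swap_mul_self _ _

theorem rev_simpleRefl {m : ℕ} (i : Fin m) :
    Fin.revPerm * simpleRefl (diagInv i) = simpleRefl i * Fin.revPerm := by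
  unfold simpleRefl diagInv
  rw [Equiv.mul_swap_eq_swap_mul]
  simp only [Fin.revPerm_apply]
  rw [Equiv.swap_comm]
  simp [Fin.rev_castSucc, Fin.rev_succ]

/-- Unless the root is the first simple root `α_i`, the reflection `s_i` maps it to a positive root
that is inverted by the rest of the word. The word need not be reduced. -/
theorem exists_betaPair {m : ℕ} (w : List (Fin m)) (a b : Fin (m + 1)) (hab : a < b)
    (h : (wordProd w)⁻¹ b < (wordProd w)⁻¹ a) : ∃ k, betaPair w k = (a, b) := by
  induction w generalizing a b with
  | nil => simp at h; omega
  | cons i w ih =>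
    by_cases hi : a = i.castSucc ∧ b = i.succ
    · refine ⟨⟨0, by simp⟩, ?_⟩
      simp [betaPair, hi.1, hi.2]
    · rw [wordProd_cons, mul_inv_rev, Equiv.Perm.mul_apply, Equiv.Perm.mul_apply] at h
      have hinv : (simpleRefl i)⁻¹ = simpleRefl i := Equiv.swap_inv _ _
      rw [hinv] at h
      obtain ⟨k, hk⟩ := ih (simpleRefl i a) (simpleRefl i b) (by
        clear ih h
        unfold simpleRefl
        rw [Equiv.swap_apply_def, Equiv.swap_apply_def]
        simp only [Fin.ext_iff, Fin.lt_def, Fin.val_castSucc, Fin.val_succ] at hi hab ⊢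
        split_ifs <;> (try simp only [Fin.val_castSucc, Fin.val_succ]) <;> omega) h
      refine ⟨⟨k + 1, by simp⟩, ?_⟩
      simp only [betaPair, Prod.mk.injEq] at hk
      simp only [betaPair, List.take_succ_cons, wordProd_cons, List.get_eq_getElem,
        List.getElem_cons_succ, Equiv.Perm.mul_apply, Prod.mk.injEq]
      simp only [List.get_eq_getElem] at hk
      rw [hk.1, hk.2, ← Equiv.Perm.mul_apply, ← Equiv.Perm.mul_apply, simpleRefl_mul_self]
      simp

end TwistedA

/-! ### Slices: fundamental domains of the shift, and their reflections -/

namespace TwistedA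

/-- The points of `L` are crossings of a wiring diagram that starts in the state `σ`. -/
def Valid (n : ℕ) : (Fin (2 * n + 1 + 1) → ℤ) → List (ℤ × ℤ) → Prop
  | _, [] => True
  | σ, P :: L => σ (res n P).castSucc = lab n P.1 ∧ σ (res n P).succ = lab n P.2 ∧
      Valid n (σ ∘ simpleRefl (res n P)) L

/-- The list `L` runs through a fundamental domain of the shift, bounded below by the lower set
`J`, along the heap order. -/
structure IsSlice (n : ℕ) (J : Set (ℤ × ℤ)) (σ : Fin (2 * n + 1 + 1) → ℤ) (L : List (ℤ × ℤ)) :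
    Prop where
  lower : ∀ P Q, IsPt n P → IsPt n Q → P ≤ Q → Q ∈ J → P ∈ J
  mem : ∀ P, P ∈ L ↔ IsPt n P ∧ P ∉ J ∧ (tau n).symm P ∈ J
  sorted : L.Pairwise fun P Q => ¬ Q ≤ P
  valid : Valid n σ L
  prod : wordProd (L.map (res n)) = Fin.revPerm
  inj : Function.Injective σ

theorem valid_append {n : ℕ} {σ : Fin (2 * n + 1 + 1) → ℤ} {A B : List (ℤ × ℤ)} :
    Valid n σ (A ++ B) ↔ Valid n σ A ∧ Valid n (σ ∘ wordProd (A.map (res n))) B := by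
  induction A generalizing σ with
  | nil => simp [Valid]
  | cons P A ih =>
    simp only [List.cons_append, Valid, ih, List.map_cons, wordProd_cons, Equiv.Perm.coe_mul,
      Function.comp_assoc, and_assoc]

variable {n : ℕ} {J : Set (ℤ × ℤ)} {σ : Fin (2 * n + 1 + 1) → ℤ} {L : List (ℤ × ℤ)}

theorem IsSlice.convex (h : IsSlice n J σ L) {P Q R : ℤ × ℤ} (hP : P ∈ L) (hQ : Q ∈ L)
    (hR : IsPt n R) (hPR : P ≤ R) (hRQ : R ≤ Q) : R ∈ L := by
  rw [h.mem] at *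
  exact ⟨hR, fun hJ => hP.2.1 (h.lower _ _ hP.1 hR hPR hJ),
    h.lower _ _ hR.tau_symm hQ.1.tau_symm (by
      rw [tau_symm_le, Equiv.apply_symm_apply]; exact hRQ) hQ.2.2⟩

/-- Otherwise `P` lies below the backward shift of `Q`, which belongs to the lower set `J`, and so
`P` would too. -/
theorem IsSlice.not_tau_le (h : IsSlice n J σ L) {P Q : ℤ × ℤ} (hP : P ∈ L) (hQ : Q ∈ L) :
    ¬ tau n P ≤ Q := by
  rw [h.mem] at *
  intro hle
  exact hP.2.1 (h.lower _ _ hP.1 hQ.1.tau_symm (by rwa [le_tau_symm]) hQ.2.2)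

theorem simpleRefl_apply_of_not_near {m : ℕ} {i j : Fin m} (h : ¬ Near i j) :
    simpleRefl i j.castSucc = j.castSucc ∧ simpleRefl i j.succ = j.succ := by
  rw [not_near_iff] at h
  constructor <;> apply Equiv.swap_apply_of_ne_of_ne <;>
    simp only [ne_eq, Fin.ext_iff, Fin.val_castSucc, Fin.val_succ] <;> omega

theorem valid_swap {P Q : ℤ × ℤ} (h : ¬ Near (res n P) (res n Q)) (hv : Valid n σ (P :: Q :: L)) :
    Valid n σ (Q :: P :: L) := by
  have h' : ¬ Near (res n Q) (res n P) := fun hc => h ⟨hc.2, hc.1⟩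
  obtain ⟨h1, h2, h3, h4, h5⟩ := hv
  rw [Function.comp_apply, (simpleRefl_apply_of_not_near h).1] at h3
  rw [Function.comp_apply, (simpleRefl_apply_of_not_near h).2] at h4
  refine ⟨h3, h4, ?_, ?_, ?_⟩
  · rw [Function.comp_apply, (simpleRefl_apply_of_not_near h').1, h1]
  · rw [Function.comp_apply, (simpleRefl_apply_of_not_near h').2, h2]
  · rw [Function.comp_assoc, ← Equiv.Perm.coe_mul] at h5 ⊢
    rwa [simpleRefl_comm h']

/-- The point to check is that `P ≤ Q` fails. Otherwise some `R` with `P < R ≤ Q` in a row near `P`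
belongs to the slice by convexity, and the sorted list has no place for it between the adjacent
entries `P` and `Q`. -/
theorem IsSlice.swap (hn : 1 ≤ n) {A B : List (ℤ × ℤ)} {P Q : ℤ × ℤ}
    (h : ¬ Near (res n P) (res n Q)) (hs : IsSlice n J σ (A ++ P :: Q :: B)) :
    IsSlice n J σ (A ++ Q :: P :: B) := by
  have hso := hs.sorted
  simp only [List.pairwise_append, List.pairwise_cons, List.mem_cons, forall_eq_or_imp] at hso
  obtain ⟨hA, ⟨⟨hPQ, hPB⟩, hQB, hB⟩, hAB⟩ := hso
  have hP := ((hs.mem P).1 (by simp)).1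
  have hQ := ((hs.mem Q).1 (by simp)).1
  refine ⟨hs.lower, fun R => ?_, ?_, ?_, ?_, hs.inj⟩
  · rw [← hs.mem]; simp only [List.mem_append, List.mem_cons]; tauto
  · simp only [List.pairwise_append, List.pairwise_cons, List.mem_cons, forall_eq_or_imp]
    refine ⟨hA, ⟨⟨fun hle => ?_, hQB⟩, hPB, hB⟩, fun a ha => ⟨(hAB a ha).2.1, (hAB a ha).1,
      (hAB a ha).2.2⟩⟩
    obtain ⟨R, hR, h1, h2, h3, h4⟩ := hP.exists_near_le hn hQ hle fun he => hPQ (by rw [he])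
    have hRL := hs.convex (by simp) (by simp) hR h1 h3
    simp only [List.mem_append, List.mem_cons] at hRL
    rcases hRL with hR' | rfl | rfl | hR'
    · exact (hAB R hR').1 h1
    · exact h2 rfl
    · exact h h4
    · exact hQB R hR' h3
  · have hv := hs.valid
    rw [valid_append] at hv ⊢
    exact ⟨hv.1, valid_swap h hv.2⟩
  · rw [← hs.prod]
    simp only [List.map_append, List.map_cons]
    exact CommStep.wordProd_eq (.swap _ _ _ _ (not_near_iff.1 fun hc => h ⟨hc.2, hc.1⟩))

/-- All words of the class of a slice come from slices with the same boundary. -/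
theorem IsSlice.exists_of_commClass_eq (hn : 1 ≤ n) (hs : IsSlice n J σ L)
    {w : List (Fin (2 * n + 1))} (hw : commClass w = commClass (L.map (res n))) :
    ∃ L', w = L'.map (res n) ∧ IsSlice n J σ L' := by
  refine commClass_induction (C := fun w => ∃ L', w = L'.map (res n) ∧ IsSlice n J σ L') ?_
    hw.symm ⟨L, rfl, hs⟩
  rintro _ _ ⟨u, v, a, b, hab⟩ ⟨L', hL', hs'⟩
  obtain ⟨A, L₁, rfl, rfl, h1⟩ := List.map_eq_append_iff.1 hL'.symm
  obtain ⟨P, L₂, rfl, rfl, h2⟩ := List.map_eq_cons_iff.1 h1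
  obtain ⟨Q, B, rfl, rfl, rfl⟩ := List.map_eq_cons_iff.1 h2
  exact ⟨A ++ Q :: P :: B, by simp, hs'.swap hn (not_near_iff.2 hab)⟩

theorem IsSlice.isPt (hs : IsSlice n J σ L) {P : ℤ × ℤ} (hP : P ∈ L) : IsPt n P :=
  ((hs.mem P).1 hP).1

theorem IsPt.tau_ne {P : ℤ × ℤ} (h : IsPt n P) : TwistedA.tau n P ≠ P := by
  intro he
  have := h.lt
  rw [tau_apply, Prod.ext_iff] at he
  simp only at he
  omega

theorem valid_singleton {P : ℤ × ℤ} : Valid n σ [P] ↔ σ (res n P).castSucc = lab n P.1 ∧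
    σ (res n P).succ = lab n P.2 := by
  simp [Valid]

/-- This is the reflection functor on points. The removed first letter returns at the end with its
dual residue, as the point `tau P`, in which the same two strands cross in the opposite order. -/
theorem IsSlice.rotate {P : ℤ × ℤ} (hs : IsSlice n J σ (P :: L)) :
    IsSlice n (insert P J) (σ ∘ simpleRefl (res n P)) (L ++ [tau n P]) := by
  have hP := hs.isPt (P := P) (by simp)
  have hPm := (hs.mem P).1 (by simp)
  have hso := List.pairwise_cons.1 hs.sorted
  have hprod : wordProd (L.map (res n)) = simpleRefl (res n P) * Fin.revPerm := by
    rw [← hs.prod, List.map_cons, wordProd_cons, ← mul_assoc, simpleRefl_mul_self, one_mul]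
  obtain ⟨v1, v2, v3⟩ := hs.valid
  refine ⟨?_, ?_, ?_, ?_, ?_, ?_⟩
  · rintro Q R hQ hR hQR (rfl | hRJ)
    · by_cases hQJ : Q ∈ J
      · exact Or.inr hQJ
      · have : Q ∈ R :: L := (hs.mem Q).2 ⟨hQ, hQJ, hs.lower _ _ hQ.tau_symm hR.tau_symm (by
          rw [tau_symm_le, Equiv.apply_symm_apply]; exact hQR) hPm.2.2⟩
        rcases List.mem_cons.1 this with rfl | hm
        · exact Or.inl rfl
        · exact absurd hQR (hso.1 Q hm)
    · exact Or.inr (hs.lower _ _ hQ hR hQR hRJ)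
  · intro Q
    rw [List.mem_append, List.mem_singleton, Set.mem_insert_iff, Set.mem_insert_iff]
    constructor
    · rintro (hQ | rfl)
      · have hQm := (hs.mem Q).1 (List.mem_cons_of_mem _ hQ)
        refine ⟨hQm.1, ?_, Or.inr hQm.2.2⟩
        rintro (rfl | hc)
        · exact hso.1 _ hQ le_rfl
        · exact hQm.2.1 hc
      · refine ⟨hP.tau, ?_, Or.inl (Equiv.symm_apply_apply _ _)⟩
        rintro (hc | hc)
        · exact hP.tau_ne hc
        · exact hPm.2.1 (hs.lower _ _ hP hP.tau hP.le_tau_self hc)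
    · rintro ⟨hQ, hQJ, hQ'⟩
      rw [not_or] at hQJ
      rcases hQ' with hQ' | hQ'
      · exact Or.inr (by rw [← hQ', Equiv.apply_symm_apply])
      · rcases List.mem_cons.1 ((hs.mem Q).2 ⟨hQ, hQJ.2, hQ'⟩) with rfl | hm
        · exact absurd rfl hQJ.1
        · exact Or.inl hm
  · rw [List.pairwise_append]
    refine ⟨hso.2, List.pairwise_singleton _ _, fun Q hQ R hR => ?_⟩
    rw [List.mem_singleton] at hR
    subst hR
    exact hs.not_tau_le (by simp) (List.mem_cons_of_mem _ hQ)
  · rw [valid_append, valid_singleton]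
    refine ⟨v3, ?_, ?_⟩
    · rw [hprod, hP.res_tau, Function.comp_apply, Equiv.Perm.mul_apply, Function.comp_apply,
        ← Equiv.Perm.mul_apply, simpleRefl_mul_self, Fin.revPerm_apply, diagInv, Fin.rev_castSucc,
        Fin.rev_rev, Equiv.Perm.one_apply, v2]
      rfl
    · rw [hprod, hP.res_tau, Function.comp_apply, Equiv.Perm.mul_apply, Function.comp_apply,
        ← Equiv.Perm.mul_apply, simpleRefl_mul_self, Fin.revPerm_apply, diagInv, Fin.rev_succ,
        Fin.rev_rev, Equiv.Perm.one_apply, v1, tau_apply, lab_add_period]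
  · rw [List.map_append, wordProd_append, hprod, List.map_singleton, hP.res_tau, wordProd_cons,
      wordProd_nil, mul_one, mul_assoc, rev_simpleRefl, ← mul_assoc, simpleRefl_mul_self, one_mul]
  · exact hs.inj.comp (Equiv.injective _)

theorem IsSlice.rotate_symm {P : ℤ × ℤ} (hs : IsSlice n J σ (L ++ [P])) :
    IsSlice n (J \ {(tau n).symm P}) (σ ∘ simpleRefl (diagInv (res n P)))
      ((tau n).symm P :: L) := by
  have hP := hs.isPt (P := P) (by simp)
  have hPm := (hs.mem P).1 (by simp)
  have hso := hs.sorted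
  rw [List.pairwise_append] at hso
  obtain ⟨hL, -, hLP⟩ := hso
  have hres : res n ((tau n).symm P) = diagInv (res n P) := by
    have := hP.tau_symm.res_tau
    rw [Equiv.apply_symm_apply] at this
    rw [this, diagInv, diagInv, Fin.rev_rev]
  have hprod : wordProd (L.map (res n)) = simpleRefl (diagInv (res n P)) * Fin.revPerm := by
    have := hs.prod
    rw [List.map_append, wordProd_append, List.map_singleton, wordProd_cons, wordProd_nil,
      mul_one] at this
    rw [← rev_simpleRefl, diagInv, diagInv, Fin.rev_rev, ← this, mul_assoc, simpleRefl_mul_self,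
      mul_one]
  have hv := hs.valid
  rw [valid_append, valid_singleton, hprod] at hv
  obtain ⟨v1, v2, v3⟩ := hv
  refine ⟨?_, ?_, ?_, ?_, ?_, ?_⟩
  · rintro Q R hQ hR hQR ⟨hRJ, hRP⟩
    refine ⟨hs.lower _ _ hQ hR hQR hRJ, ?_⟩
    rintro rfl
    have h1 : P ≤ tau n R := by rwa [← tau_symm_le]
    have h2 : tau n R ∈ L ++ [P] := (hs.mem _).2 ⟨hR.tau, fun hc => hPm.2.1
      (hs.lower _ _ hPm.1 hR.tau h1 hc), by rwa [Equiv.symm_apply_apply]⟩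
    rw [List.mem_append, List.mem_singleton] at h2
    rcases h2 with h2 | rfl
    · exact hLP _ h2 _ (by simp) h1
    · simp at hRP
  · intro Q
    rw [List.mem_cons]
    constructor
    · rintro (rfl | hQ)
      · refine ⟨hP.tau_symm, fun hc => hc.2 rfl, hs.lower _ _ hP.tau_symm.tau_symm hP.tau_symm
          hP.tau_symm.tau_symm_le_self hPm.2.2, fun hc => ?_⟩
        have := hP.tau_symm.tau_symm.tau_ne
        rw [Equiv.apply_symm_apply] at this
        exact this hc.symm
      · have hQm := (hs.mem Q).1 (by simp [hQ])
        refine ⟨hQm.1, fun hc => hQm.2.1 hc.1, hQm.2.2, fun hc => ?_⟩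
        have : Q = P := (tau n).symm.injective hc
        subst this
        exact hLP _ hQ _ (by simp) le_rfl
    · rintro ⟨hQ, hQJ, hQ', hQ''⟩
      by_cases hc : Q ∈ J
      · left
        by_contra hne
        exact hQJ ⟨hc, hne⟩
      · right
        have := (hs.mem Q).2 ⟨hQ, hc, hQ'⟩
        rw [List.mem_append, List.mem_singleton] at this
        rcases this with h | rfl
        · exact h
        · exact absurd rfl hQ''
  · rw [List.pairwise_cons]
    refine ⟨fun Q hQ hle => ?_, hL⟩
    rw [le_tau_symm] at hle
    exact hs.not_tau_le (by simp [hQ]) (by simp) hle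
  · refine ⟨?_, ?_, ?_⟩
    · rw [Function.comp_apply, Equiv.Perm.mul_apply, Fin.revPerm_apply, Fin.rev_succ] at v3
      rw [hres, Function.comp_apply, tau_symm_apply, ← lab_add_period, sub_add_cancel]
      exact v3
    · rw [Function.comp_apply, Equiv.Perm.mul_apply, Fin.revPerm_apply, Fin.rev_castSucc] at v2
      rw [hres, Function.comp_apply, tau_symm_apply]
      exact v2
    · rw [hres, Function.comp_assoc, ← Equiv.Perm.coe_mul, simpleRefl_mul_self]
      exact v1
  · rw [List.map_cons, wordProd_cons, hres, hprod, ← mul_assoc, simpleRefl_mul_self, one_mul]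
  · exact hs.inj.comp (Equiv.injective _)

end TwistedA

/-! ### The slice of the defining word -/

namespace TwistedA

/-- The `j`-th point in the `k`-th factor of the standard slice. -/
def stdPt (n k j : ℕ) : ℤ × ℤ :=
  if j < n then
    if k % 2 = 0 then (k, k + 2 * (j + 1)) else (k + 1 - 2 * n + 2 * j, k + (2 * n + 1))
  else (k, k + (2 * n + 1))

/-- The strand at level `l` before the `j`-th crossing in the `k`-th factor. -/
def stdState (n k j l : ℕ) : ℤ :=
  if k % 2 = 0 then
    if l < j then k + 2 * l + 2 else if l = j then k else
      if l ≤ n then k + 2 * l else if l = n + 1 then 1 else k + 2 * n + 2 - 2 * l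
  else
    if 2 * n + 1 < l + j then k + 2 * n + 3 - 2 * l else if l + j = 2 * n + 1 then k + 2 * n + 1 else
      if l < n then k + 1 + 2 * l else if l = n then 1 else k + 1 + 2 * n - 2 * l

/-- The standard slice. -/
def stdList (n : ℕ) : List (ℤ × ℤ) :=
  ((List.range (2 * n + 1)).map fun k => (List.range (n + 1)).map (stdPt n k)).flatten

theorem isPt_stdPt (n k j : ℕ) : IsPt n (stdPt n k j) := by
  unfold stdPt IsPt
  split_ifs <;> simp only
  · omega
  · omega
  · exact Or.inr trivial

theorem res_stdPt {n k j : ℕ} (hj : j ≤ n) : (res n (stdPt n k j) : ℕ) =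
    if k % 2 = 0 then j else 2 * n - j := by
  rw [(isPt_stdPt n k j).res_val]
  unfold stdPt resNat
  split_ifs <;> simp only at * <;> omega

theorem simpleRefl_val {m : ℕ} (i : Fin m) (l : Fin (m + 1)) : (simpleRefl i l : ℕ) =
    if (l : ℕ) = i then (i : ℕ) + 1 else if (l : ℕ) = i + 1 then (i : ℕ) else l := by
  unfold simpleRefl
  rw [Equiv.swap_apply_def]
  simp only [Fin.ext_iff, Fin.val_castSucc, Fin.val_succ]
  split_ifs <;> simp

theorem stdState_valid {n k j : ℕ} (hj : j ≤ n) :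
    lab n (stdState n k j (res n (stdPt n k j)).castSucc) = lab n (stdPt n k j).1 ∧
    lab n (stdState n k j (res n (stdPt n k j)).succ) = lab n (stdPt n k j).2 := by
  rw [Fin.val_castSucc, Fin.val_succ, res_stdPt hj]
  rcases Nat.mod_two_eq_zero_or_one k with hk | hk
  · rw [if_pos hk]
    rcases hj.lt_or_eq with h | rfl
    · constructor <;> congr 1 <;> unfold stdState stdPt <;> split_ifs <;> omega
    -- The last crossing of a factor is central. The state keeps the number `1` for the central
    -- strand, so only the labels agree there, not the numbers.
    · refine ⟨?_, ?_⟩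
      · congr 1; unfold stdState stdPt; split_ifs <;> omega
      · rw [lab_of_odd, lab_of_odd]
        · unfold stdPt; split_ifs <;> simp only <;> omega
        · unfold stdState; split_ifs <;> omega
  · rw [if_neg (by omega)]
    rcases hj.lt_or_eq with h | rfl
    · constructor <;> congr 1 <;> unfold stdState stdPt <;> split_ifs <;> omega
    · refine ⟨?_, ?_⟩
      · rw [lab_of_odd, lab_of_odd]
        · unfold stdPt; split_ifs <;> simp only <;> omega
        · unfold stdState; split_ifs <;> omega
      · congr 1; unfold stdState stdPt; split_ifs <;> omega

theorem stdState_succ {n k j : ℕ} (hj : j < n) :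
    (fun l : Fin (2 * n + 1 + 1) => lab n (stdState n k j l)) ∘ simpleRefl (res n (stdPt n k j)) =
      fun l : Fin (2 * n + 1 + 1) => lab n (stdState n k (j + 1) l) := by
  funext l
  rw [Function.comp_apply, simpleRefl_val, res_stdPt hj.le]
  congr 1
  have := l.2
  generalize (l : ℕ) = l at *
  rcases Nat.mod_two_eq_zero_or_one k with hk | hk
  · rw [if_pos hk]
    obtain ⟨v, hv, hv'⟩ : ∃ v, (if l = j then j + 1 else if l = j + 1 then j else l) = v ∧
        (l = j ∧ v = j + 1 ∨ l = j + 1 ∧ v = j ∨ l ≠ j ∧ l ≠ j + 1 ∧ v = l) :=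
      ⟨_, rfl, by split_ifs <;> omega⟩
    rw [hv]
    unfold stdState
    simp only [if_pos hk]
    split_ifs <;> omega
  · rw [if_neg (show ¬ k % 2 = 0 by omega)]
    obtain ⟨v, hv, hv'⟩ : ∃ v, (if l = 2 * n - j then 2 * n - j + 1 else
        if l = 2 * n - j + 1 then 2 * n - j else l) = v ∧
        (l + j = 2 * n ∧ v = l + 1 ∨ l + j = 2 * n + 1 ∧ l = v + 1 ∨
          l + j ≠ 2 * n ∧ l + j ≠ 2 * n + 1 ∧ v = l) :=
      ⟨_, rfl, by split_ifs <;> omega⟩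
    rw [hv]
    unfold stdState
    simp only [if_neg (show ¬ k % 2 = 0 by omega)]
    split_ifs <;> omega

theorem stdState_last (n k : ℕ) :
    (fun l : Fin (2 * n + 1 + 1) => lab n (stdState n k n l)) ∘ simpleRefl (res n (stdPt n k n)) =
      fun l : Fin (2 * n + 1 + 1) => lab n (stdState n (k + 1) 0 l) := by
  funext l
  rw [Function.comp_apply, simpleRefl_val, res_stdPt le_rfl,
    show (if k % 2 = 0 then n else 2 * n - n) = n by split_ifs <;> omega]
  have := l.2
  generalize (l : ℕ) = l at *
  obtain ⟨v, hv, hv'⟩ : ∃ v, (if l = n then n + 1 else if l = n + 1 then n else l) = v ∧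
      (l = n ∧ v = n + 1 ∨ l = n + 1 ∧ v = n ∨ l ≠ n ∧ l ≠ n + 1 ∧ v = l) :=
    ⟨_, rfl, by split_ifs <;> omega⟩
  rw [hv]
  rcases Nat.mod_two_eq_zero_or_one k with hk | hk
  -- At the end of an even factor the strand at the outermost level changes its representative by
  -- one period.
  · by_cases hl : l = 2 * n + 1
    · rw [lab_eq_iff]
      refine Or.inr ?_
      unfold stdState
      simp only [if_pos hk, if_neg (show ¬ (k + 1) % 2 = 0 by omega)]
      refine ⟨by split_ifs <;> omega, by split_ifs <;> omega, 1, ?_⟩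
      split_ifs <;> omega
    · congr 1
      unfold stdState
      simp only [if_pos hk, if_neg (show ¬ (k + 1) % 2 = 0 by omega)]
      split_ifs <;> omega
  · congr 1
    unfold stdState
    simp only [if_neg (show ¬ k % 2 = 0 by omega), if_pos (show (k + 1) % 2 = 0 by omega)]
    split_ifs <;> omega

theorem valid_factor_aux (n k j : ℕ) (hj : j ≤ n) :
    Valid n (fun l => lab n (stdState n k 0 l)) ((List.range j).map (stdPt n k)) ∧
    (fun l : Fin (2 * n + 1 + 1) => lab n (stdState n k 0 l)) ∘
      wordProd (((List.range j).map (stdPt n k)).map (res n)) =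
      fun l : Fin (2 * n + 1 + 1) => lab n (stdState n k j l) := by
  induction j with
  | zero => exact ⟨trivial, rfl⟩
  | succ j ih =>
    obtain ⟨h1, h2⟩ := ih (by omega)
    rw [List.range_succ, List.map_append, List.map_append, valid_append, h2, wordProd_append,
      Equiv.Perm.coe_mul, ← Function.comp_assoc, h2]
    simp only [List.map_cons, List.map_nil, valid_singleton, wordProd_cons, wordProd_nil, mul_one]
    exact ⟨⟨h1, stdState_valid (by omega)⟩, stdState_succ (by omega)⟩

theorem valid_factor (n k : ℕ) :
    Valid n (fun l => lab n (stdState n k 0 l)) ((List.range (n + 1)).map (stdPt n k)) ∧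
    (fun l : Fin (2 * n + 1 + 1) => lab n (stdState n k 0 l)) ∘
      wordProd (((List.range (n + 1)).map (stdPt n k)).map (res n)) =
      fun l : Fin (2 * n + 1 + 1) => lab n (stdState n (k + 1) 0 l) := by
  obtain ⟨h1, h2⟩ := valid_factor_aux n k n le_rfl
  rw [List.range_succ, List.map_append, List.map_append, valid_append, h2, wordProd_append,
    Equiv.Perm.coe_mul, ← Function.comp_assoc, h2]
  simp only [List.map_cons, List.map_nil, valid_singleton, wordProd_cons, wordProd_nil, mul_one]
  exact ⟨⟨h1, stdState_valid le_rfl⟩, stdState_last n k⟩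

theorem valid_factors (n K : ℕ) :
    Valid n (fun l => lab n (stdState n 0 0 l))
      (((List.range K).map fun k => (List.range (n + 1)).map (stdPt n k)).flatten) ∧
    (fun l : Fin (2 * n + 1 + 1) => lab n (stdState n 0 0 l)) ∘ wordProd ((((List.range K).map
      fun k => (List.range (n + 1)).map (stdPt n k)).flatten).map (res n)) =
      fun l : Fin (2 * n + 1 + 1) => lab n (stdState n K 0 l) := by
  induction K with
  | zero => exact ⟨trivial, rfl⟩
  | succ K ih =>
    obtain ⟨h1, h2⟩ := ih
    obtain ⟨h3, h4⟩ := valid_factor n K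
    rw [List.range_succ (n := K), List.map_append, List.flatten_append, List.map_append, valid_append, h2,
      wordProd_append, Equiv.Perm.coe_mul, ← Function.comp_assoc, h2]
    simp only [List.map_cons, List.map_nil, List.flatten_cons, List.flatten_nil, List.append_nil]
      at *
    exact ⟨⟨h1, h3⟩, h4⟩

theorem stdState_injective (n : ℕ) :
    Function.Injective fun l : Fin (2 * n + 1 + 1) => lab n (stdState n 0 0 l) := by
  intro a b h
  have ha := a.2
  have hb := b.2
  ext
  simp only [lab_eq_iff] at h
  unfold stdState at h
  simp only [Nat.zero_mod, if_true, Nat.not_lt_zero, if_false] at h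
  rcases h with h | ⟨h1, h2, k, h3⟩
  · split_ifs at h <;> omega
  · rcases period_mul_cases n k with h0 | h0 | h0 <;> split_ifs at h1 h2 h3 <;> omega

/-- After all `2n + 1` factors the strands appear in reversed order. As their labels are distinct,
this identifies the product of the word with the longest element. -/
theorem stdState_rev (n : ℕ) (l : Fin (2 * n + 1 + 1)) :
    lab n (stdState n (2 * n + 1) 0 l) = lab n (stdState n 0 0 (Fin.rev l)) := by
  have hl := l.2
  rw [Fin.val_rev, lab_eq_iff]
  unfold stdState
  simp only [Nat.zero_mod, if_true, Nat.not_lt_zero, if_false,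
    if_neg (show ¬ (2 * n + 1) % 2 = 0 by omega)]
  by_cases h : (l : ℕ) = n
  · left
    split_ifs <;> omega
  · right
    refine ⟨by split_ifs <;> omega, by split_ifs <;> omega, ?_⟩
    by_cases h2 : (l : ℕ) < n
    · exact ⟨-1, by split_ifs <;> omega⟩
    · by_cases h3 : (l : ℕ) = 2 * n + 1
      · exact ⟨-1, by split_ifs <;> omega⟩
      · exact ⟨0, by split_ifs <;> omega⟩

theorem mem_stdList {n : ℕ} {P : ℤ × ℤ} : P ∈ stdList n ↔
    IsPt n P ∧ ¬ (P.1 < 0 ∧ P.2 < 2 * n + 1) ∧ P.2 - (4 * n + 2) < 0 ∧ P.1 < 2 * n + 1 := by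
  unfold stdList
  simp only [List.mem_flatten, List.mem_map, List.mem_range, exists_exists_and_eq_and]
  constructor
  · rintro ⟨k, hk, j, hj, rfl⟩
    refine ⟨isPt_stdPt n k j, ?_⟩
    unfold stdPt
    split_ifs <;> simp only <;> omega
  · obtain ⟨p, q⟩ := P
    simp only
    rintro ⟨h1, h2, h3, h4⟩
    unfold IsPt at h1
    simp only at h1
    by_cases hm : q = p + (2 * n + 1)
    · refine ⟨p.toNat, by omega, n, by omega, ?_⟩
      unfold stdPt
      rw [if_neg (by omega)]
      ext <;> simp only <;> omega
    · by_cases hm' : q < p + (2 * n + 1)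
      · refine ⟨p.toNat, by omega, ((q - p) / 2 - 1).toNat, by omega, ?_⟩
        unfold stdPt
        rw [if_pos (by omega), if_pos (by omega)]
        ext <;> simp only <;> omega
      · refine ⟨(q - (2 * n + 1)).toNat, by omega, ((p - q + 4 * n) / 2).toNat, by omega, ?_⟩
        unfold stdPt
        rw [if_pos (by omega), if_neg (by omega)]
        ext <;> simp only <;> omega

theorem stdList_sorted (n : ℕ) : (stdList n).Pairwise fun P Q => ¬ Q ≤ P := by
  unfold stdList
  rw [List.pairwise_flatten, List.pairwise_map]
  constructor
  · intro l hl
    obtain ⟨k, -, rfl⟩ := List.mem_map.1 hl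
    rw [List.pairwise_map]
    refine List.pairwise_lt_range.imp_of_mem fun {i j} hi hj hij => ?_
    rw [List.mem_range] at hi hj
    rw [Prod.le_def]
    unfold stdPt
    split_ifs <;> simp only <;> omega
  · refine List.pairwise_lt_range.imp fun {k k'} hk => ?_
    intro x hx y hy
    obtain ⟨i, hi, rfl⟩ := List.mem_map.1 hx
    obtain ⟨j, hj, rfl⟩ := List.mem_map.1 hy
    rw [List.mem_range] at hi hj
    rw [Prod.le_def]
    unfold stdPt
    split_ifs <;> simp only <;> omega

theorem isSlice_stdList (n : ℕ) : IsSlice n {P | P.1 < 0 ∧ P.2 < 2 * n + 1}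
    (fun l => lab n (stdState n 0 0 l)) (stdList n) := by
  obtain ⟨h1, h2⟩ := valid_factors n (2 * n + 1)
  refine ⟨fun P Q _ _ hPQ hQ => ?_, fun P => ?_, stdList_sorted n, h1, ?_, stdState_injective n⟩
  · rw [Prod.le_def] at hPQ
    simp only [Set.mem_ofPred_eq] at *
    omega
  · rw [mem_stdList]
    rfl
  · ext l : 1
    refine stdState_injective n ?_
    exact (congrFun h2 l).trans (stdState_rev n l)

theorem iterate_diagInv_val {n : ℕ} (k : ℕ) (i : Fin (2 * n + 1)) :
    ((diagInv^[k] i : Fin (2 * n + 1)) : ℕ) = if k % 2 = 0 then (i : ℕ) else 2 * n - i := by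
  have hinv : Function.Involutive (diagInv : Fin (2 * n + 1) → _) := fun i => Fin.rev_rev i
  rcases Nat.mod_two_eq_zero_or_one k with hk | hk
  · rw [hinv.iterate_even (Nat.even_iff.2 hk), if_pos hk]; rfl
  · rw [hinv.iterate_odd (Nat.odd_iff.2 hk), if_neg (by omega), diagInv, Fin.val_rev]
    omega

theorem twistedWord_eq (n : ℕ) : twistedWord n = (stdList n).map (res n) := by
  unfold twistedWord stdList
  rw [List.map_flatten, List.map_map]
  congr 1
  refine List.map_congr_left fun k _ => ?_
  refine List.ext_getElem (by simp [halfWord]) fun j h1 h2 => ?_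
  have hj : j ≤ n := by simp at h2; omega
  simp only [halfWord, List.getElem_map, List.getElem_ofFn, Function.comp_apply,
    List.getElem_range]
  ext
  exact (iterate_diagInv_val k _).trans (res_stdPt hj).symm

/-- Every twisted adapted class is the class of a slice. -/
theorem IsTwistedAdapted.exists_slice {n : ℕ} (hn : 1 ≤ n) {c : CommClass (2 * n + 1)}
    (hc : IsTwistedAdapted n c) : ∃ J σ L, c = commClass (L.map (res n)) ∧ IsSlice n J σ L := by
  unfold IsTwistedAdapted ReflEquiv at hc
  induction hc with
  | refl => exact ⟨_, _, _, by rw [twistedWord_eq], isSlice_stdList n⟩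
  | tail _ hstep ih =>
    obtain ⟨J, σ, L, rfl, hs⟩ := ih
    obtain ⟨i, w, ⟨h1, rfl⟩ | ⟨h1, rfl⟩⟩ := hstep
    · obtain ⟨L', hL', hs'⟩ := hs.exists_of_commClass_eq hn h1.symm
      obtain ⟨P, L₂, rfl, rfl, rfl⟩ := List.map_eq_cons_iff.1 hL'.symm
      refine ⟨_, _, _, ?_, hs'.rotate⟩
      rw [List.map_append, List.map_singleton, (hs'.isPt (P := P) (by simp)).res_tau]
    · obtain ⟨L', hL', hs'⟩ := hs.exists_of_commClass_eq hn h1.symm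
      obtain ⟨L₂, L₃, rfl, rfl, h3⟩ := List.map_eq_append_iff.1 hL'.symm
      obtain ⟨P, L₄, rfl, rfl, h4⟩ := List.map_eq_cons_iff.1 h3
      obtain rfl := List.map_eq_nil_iff.1 h4
      refine ⟨_, _, _, ?_, hs'.rotate_symm⟩
      have := (hs'.isPt (P := P) (by simp)).tau_symm.res_tau
      rw [Equiv.apply_symm_apply] at this
      rw [List.map_cons, this, diagInv, diagInv, Fin.rev_rev]

end TwistedA

/-! ### Positive roots as points of a slice -/

namespace TwistedA

/-- The product of the preceding letters leads from current levels back to starting positions, so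
the root of a letter records where its two strands start. -/
theorem Valid.beta {n : ℕ} {σ : Fin (2 * n + 1 + 1) → ℤ} {L : List (ℤ × ℤ)} (hv : Valid n σ L)
    (k : Fin (L.map (res n)).length) :
    σ (betaPair (L.map (res n)) k).1 = lab n (L[k]'(by simpa using k.2)).1 ∧
    σ (betaPair (L.map (res n)) k).2 = lab n (L[k]'(by simpa using k.2)).2 := by
  induction L generalizing σ with
  | nil => exact absurd k.2 (by simp)
  | cons P L ih =>
    obtain ⟨h1, h2, h3⟩ := hv
    obtain ⟨k, hk⟩ := k
    cases k with
    | zero => simpa [betaPair] using ⟨h1, h2⟩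
    | succ k => simpa [betaPair] using ih h3 ⟨k, by simpa using hk⟩

variable {n : ℕ} {J : Set (ℤ × ℤ)} {σ : Fin (2 * n + 1 + 1) → ℤ} {L : List (ℤ × ℤ)}

/-- The crossings of two given strands are the shifts of one crossing under powers of `tau`: even
powers keep the order of the strands and odd ones reverse it. Hence two strands cross at most once
in a slice. -/
theorem exists_tau_le_of_lab_eq {P Q : ℤ × ℤ} (hP : IsPt n P) (hQ : IsPt n Q)
    (h1 : lab n P.1 = lab n Q.1) (h2 : lab n P.2 = lab n Q.2) (hne : P ≠ Q) :
    tau n P ≤ Q ∨ tau n Q ≤ P := by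
  obtain ⟨p, q⟩ := P
  obtain ⟨a, b⟩ := Q
  rw [lab_eq_iff] at h1 h2
  unfold IsPt at hP hQ
  simp only [tau_apply, Prod.mk_le_mk, ne_eq, Prod.mk.injEq] at *
  rcases h1 with h1 | ⟨h1, h1', k, hk⟩ <;> rcases h2 with h2 | ⟨h2, h2', l, hl⟩
  · omega
  · rcases period_mul_cases n l with h | h | h <;> omega
  · rcases period_mul_cases n k with h | h | h <;> omega
  · rcases period_mul_cases n k with h | h | h <;>
      rcases period_mul_cases n (l - k) with h' | h' | h' <;> rw [mul_sub] at h' <;> omega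

theorem exists_tau_le_of_lab_swap {P Q : ℤ × ℤ} (hP : IsPt n P) (hQ : IsPt n Q)
    (h1 : lab n P.1 = lab n Q.2) (h2 : lab n P.2 = lab n Q.1) :
    tau n P ≤ Q ∨ tau n Q ≤ P := by
  obtain ⟨p, q⟩ := P
  obtain ⟨a, b⟩ := Q
  rw [lab_eq_iff] at h1 h2
  unfold IsPt at hP hQ
  simp only [tau_apply, Prod.mk_le_mk] at *
  rcases h1 with h1 | ⟨h1, h1', k, hk⟩ <;> rcases h2 with h2 | ⟨h2, h2', l, hl⟩
  · omega
  · rcases period_mul_cases n l with h | h | h <;> omega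
  · rcases period_mul_cases n k with h | h | h <;> omega
  · rcases period_mul_cases n l with h | h | h <;>
      rcases period_mul_cases n (k - l - 1) with h' | h' | h' <;>
      rw [mul_sub, mul_sub, mul_one] at h' <;> omega

theorem IsSlice.eq_of_lab_eq (hs : IsSlice n J σ L) {P Q : ℤ × ℤ} (hP : P ∈ L) (hQ : Q ∈ L)
    (h1 : lab n P.1 = lab n Q.1) (h2 : lab n P.2 = lab n Q.2) : P = Q := by
  by_contra hne
  rcases exists_tau_le_of_lab_eq (hs.isPt hP) (hs.isPt hQ) h1 h2 hne with h | h
  · exact hs.not_tau_le hP hQ h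
  · exact hs.not_tau_le hQ hP h

theorem IsSlice.lab_not_swap (hs : IsSlice n J σ L) {P Q : ℤ × ℤ} (hP : P ∈ L) (hQ : Q ∈ L)
    (h1 : lab n P.1 = lab n Q.2) (h2 : lab n P.2 = lab n Q.1) : False := by
  rcases exists_tau_le_of_lab_swap (hs.isPt hP) (hs.isPt hQ) h1 h2 with h | h
  · exact hs.not_tau_le hP hQ h
  · exact hs.not_tau_le hQ hP h

theorem IsSlice.exists_betaPair (hs : IsSlice n J σ L) (α : PosRoot (2 * n + 1)) :
    ∃ k, betaPair (L.map (res n)) k = α.1 := by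
  refine TwistedA.exists_betaPair _ α.1.1 α.1.2 α.2 ?_
  rw [hs.prod]
  have h : (Fin.revPerm : Equiv.Perm (Fin (2 * n + 1 + 1)))⁻¹ = Fin.revPerm := rfl
  rw [h, Fin.revPerm_apply, Fin.revPerm_apply, Fin.rev_lt_rev]
  exact α.2

theorem IsSlice.exists_pt (hs : IsSlice n J σ L) (α : PosRoot (2 * n + 1)) :
    ∃ P ∈ L, lab n P.1 = σ α.1.1 ∧ lab n P.2 = σ α.1.2 := by
  obtain ⟨k, hk⟩ := hs.exists_betaPair α
  have := hs.valid.beta k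
  rw [hk] at this
  exact ⟨_, List.getElem_mem _, this.1.symm, this.2.symm⟩

/-- A priori the root read at `P` could be negative. But the opposite positive root occurs too, by
`IsSlice.exists_pt`, and would give a second crossing of the same strands in the slice. No count of
the length is needed. -/
theorem IsSlice.exists_root (hs : IsSlice n J σ L) {P : ℤ × ℤ} (hP : P ∈ L) :
    ∃ α : PosRoot (2 * n + 1), lab n P.1 = σ α.1.1 ∧ lab n P.2 = σ α.1.2 := by
  obtain ⟨k, hk, rfl⟩ := List.mem_iff_getElem.1 hP
  obtain ⟨h1, h2⟩ := hs.valid.beta ⟨k, by simpa using hk⟩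
  set β := betaPair (L.map (res n)) ⟨k, by simpa using hk⟩ with hβ
  simp only [Fin.getElem_fin] at h1 h2
  rcases lt_trichotomy β.1 β.2 with h | h | h
  · exact ⟨⟨β, h⟩, h1.symm, h2.symm⟩
  · rw [h] at h1
    exact absurd (h1.symm.trans h2) (hs.isPt hP).lab_ne
  · obtain ⟨Q, hQ, h3, h4⟩ := hs.exists_pt ⟨(β.2, β.1), h⟩
    exact (hs.lab_not_swap hP hQ (by rw [h4, h1]) (by rw [h3, h2])).elim

theorem IsSlice.nodup (hs : IsSlice n J σ L) : L.Nodup :=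
  hs.sorted.imp fun h he => h he.ge

theorem IsSlice.wordLT_iff (hs : IsSlice n J σ L) {α β : PosRoot (2 * n + 1)} {P Q : ℤ × ℤ}
    (hP : P ∈ L) (hQ : Q ∈ L) (hα : lab n P.1 = σ α.1.1 ∧ lab n P.2 = σ α.1.2)
    (hβ : lab n Q.1 = σ β.1.1 ∧ lab n Q.2 = σ β.1.2) :
    WordLT (L.map (res n)) α β ↔ L.idxOf P < L.idxOf Q := by
  have key : ∀ (γ : PosRoot (2 * n + 1)) (R : ℤ × ℤ), R ∈ L →
      lab n R.1 = σ γ.1.1 ∧ lab n R.2 = σ γ.1.2 → ∀ k : Fin (L.map (res n)).length,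
      betaPair (L.map (res n)) k = γ.1 ↔ (k : ℕ) = L.idxOf R := by
    intro γ R hR hγ k
    obtain ⟨h1, h2⟩ := hs.valid.beta k
    simp only [Fin.getElem_fin] at h1 h2
    constructor
    · intro he
      rw [he] at h1 h2
      have : L[(k : ℕ)]'(by simpa using k.2) = R := hs.eq_of_lab_eq (List.getElem_mem _) hR
        (by rw [← h1, hγ.1]) (by rw [← h2, hγ.2])
      rw [← this, hs.nodup.idxOf_getElem]
    · intro he
      have hk : L[(k : ℕ)]'(by simpa using k.2) = R := by
        simp only [he]
        exact List.getElem_idxOf _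
      rw [hk] at h1 h2
      exact Prod.ext (hs.inj (h1.trans hγ.1)) (hs.inj (h2.trans hγ.2))
  constructor
  · rintro ⟨k, l, hkl, hk, hl⟩
    rw [key α P hP hα] at hk
    rw [key β Q hQ hβ] at hl
    rw [← hk, ← hl]
    exact hkl
  · intro h
    refine ⟨⟨L.idxOf P, by simpa using List.idxOf_lt_length_of_mem hP⟩,
      ⟨L.idxOf Q, by simpa using List.idxOf_lt_length_of_mem hQ⟩, h, ?_, ?_⟩
    · rw [key α P hP hα]
    · rw [key β Q hQ hβ]

theorem IsSlice.idxOf_lt (hs : IsSlice n J σ L) {P Q : ℤ × ℤ} (hP : P ∈ L) (hQ : Q ∈ L)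
    (hle : P ≤ Q) (hne : P ≠ Q) : L.idxOf P < L.idxOf Q := by
  by_contra hc
  have hlt : L.idxOf Q < L.idxOf P := lt_of_le_of_ne (not_lt.1 hc) fun he =>
    hne ((List.idxOf_inj hP).1 he.symm)
  have := List.pairwise_iff_getElem.1 hs.sorted _ _ (List.idxOf_lt_length_of_mem hQ)
    (List.idxOf_lt_length_of_mem hP) hlt
  rw [List.getElem_idxOf, List.getElem_idxOf] at this
  exact this hle

open Classical in
/-- Any lower set can be moved to the front of a slice. -/
theorem IsSlice.filter (hn : 1 ≤ n) (hs : IsSlice n J σ L) (f : ℤ × ℤ → Prop)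
    (hf : ∀ P Q, P ≤ Q → f Q → f P) :
    ∃ L', IsSlice n J σ L' ∧ commClass (L'.map (res n)) = commClass (L.map (res n)) ∧
      ∀ P ∈ L, ∀ Q ∈ L, f P → ¬ f Q → L'.idxOf P < L'.idxOf Q := by
  have := filter_induction (near := fun P Q => Near (res n P) (res n Q))
    (C := fun L' => IsSlice n J σ L' ∧ commClass (L'.map (res n)) = commClass (L.map (res n)))
    (fun A B P Q h hL => ⟨hL.1.swap hn h, by
      rw [← hL.2, List.map_append, List.map_append]
      exact (Quot.sound (.swap _ _ _ _ (not_near_iff.1 h))).symm⟩) (fun P => decide (f P)) [] L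
    (hs.sorted.imp_of_mem fun {P Q} hP hQ h h1 h2 hN => by
      rw [decide_eq_false_iff_not] at h1
      rw [decide_eq_true_iff] at h2
      rcases (hs.isPt hP).comparable_of_near (hs.isPt hQ) hN with h3 | h3
      · exact h1 (hf _ _ h3 h2)
      · exact h h3) ⟨hs, rfl⟩
  rw [List.nil_append] at this
  refine ⟨_, this.1, this.2, fun P hP Q hQ h1 h2 => ?_⟩
  have hP' : P ∈ L.filter fun P => decide (f P) := by simp [hP, h1]
  have hQ' : Q ∉ L.filter fun P => decide (f P) := by simp [h2]
  rw [List.idxOf_append_of_mem hP', List.idxOf_append_of_notMem hQ']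
  have := List.idxOf_lt_length_of_mem hP'
  omega

/-- The points of the positive roots in a slice of a class. -/
structure Model (n : ℕ) (c : CommClass (2 * n + 1)) (σ : Fin (2 * n + 1 + 1) → ℤ)
    (pt : PosRoot (2 * n + 1) → ℤ × ℤ) : Prop where
  inj : Function.Injective σ
  isPt : ∀ α, IsPt n (pt α)
  fst : ∀ α, lab n (pt α).1 = σ α.1.1
  snd : ∀ α, lab n (pt α).2 = σ α.1.2
  convex : ∀ α β R, IsPt n R → pt α ≤ R → R ≤ pt β → ∃ γ, pt γ = R
  not_tau_le : ∀ α β, ¬ tau n (pt α) ≤ pt β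
  index : ∀ w, commClass w = c → ∃ i : PosRoot (2 * n + 1) → ℕ, Function.Injective i ∧
    (∀ α β, WordLT w α β ↔ i α < i β) ∧ ∀ α β, pt α ≤ pt β → α ≠ β → i α < i β
  first : ∀ τ, ∃ w, commClass w = c ∧ ∀ α, ¬ pt α ≤ pt τ → WordLT w τ α
  last : ∀ τ, ∃ w, commClass w = c ∧ ∀ α, ¬ pt τ ≤ pt α → WordLT w α τ

theorem IsSlice.model (hn : 1 ≤ n) (hs : IsSlice n J σ L) : ∃ pt,
    Model n (commClass (L.map (res n))) σ pt ∧ ∀ P, P ∈ L ↔ ∃ α, pt α = P := by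
  choose pt h1 h2 h3 using hs.exists_pt
  have mem : ∀ P, P ∈ L ↔ ∃ α, pt α = P := by
    intro P
    constructor
    · intro hP
      obtain ⟨α, h4, h5⟩ := hs.exists_root hP
      exact ⟨α, hs.eq_of_lab_eq (h1 α) hP (by rw [h2, h4]) (by rw [h3, h5])⟩
    · rintro ⟨α, rfl⟩
      exact h1 α
  have ptinj : Function.Injective pt := fun α β h => by
    refine Subtype.ext (Prod.ext (hs.inj ?_) (hs.inj ?_))
    · rw [← h2, h, h2]
    · rw [← h3, h, h3]
  have mem' : ∀ L', IsSlice n J σ L' → ∀ α, pt α ∈ L' := fun L' hs' α => by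
    rw [hs'.mem, ← hs.mem]; exact h1 α
  refine ⟨pt, ⟨hs.inj, fun α => hs.isPt (h1 α), h2, h3, fun α β R hR h4 h5 =>
    (mem R).1 (hs.convex (h1 α) (h1 β) hR h4 h5), fun α β => hs.not_tau_le (h1 α) (h1 β),
    fun w hw => ?_, fun τ => ?_, fun τ => ?_⟩, mem⟩
  · obtain ⟨L', rfl, hs'⟩ := hs.exists_of_commClass_eq hn hw
    refine ⟨fun α => L'.idxOf (pt α), fun α β h => ptinj ((List.idxOf_inj (mem' L' hs' α)).1 h),
      fun α β => hs'.wordLT_iff (mem' L' hs' α) (mem' L' hs' β) ⟨h2 α, h3 α⟩ ⟨h2 β, h3 β⟩,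
      fun α β h hne => hs'.idxOf_lt (mem' L' hs' α) (mem' L' hs' β) h fun he => hne (ptinj he)⟩
  · obtain ⟨L', hs', hc, hL'⟩ := hs.filter hn (fun P => P ≤ pt τ) fun P Q h h' => h.trans h'
    refine ⟨_, hc, fun α hα => ?_⟩
    rw [hs'.wordLT_iff (mem' L' hs' τ) (mem' L' hs' α) ⟨h2 τ, h3 τ⟩ ⟨h2 α, h3 α⟩]
    exact hL' _ (h1 τ) _ (h1 α) le_rfl hα
  · obtain ⟨L', hs', hc, hL'⟩ := hs.filter hn (fun P => ¬ pt τ ≤ P) fun P Q h h' h'' =>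
      h' (h''.trans h)
    refine ⟨_, hc, fun α hα => ?_⟩
    rw [hs'.wordLT_iff (mem' L' hs' α) (mem' L' hs' τ) ⟨h2 α, h3 α⟩ ⟨h2 τ, h3 τ⟩]
    exact hL' _ (h1 α) _ (h1 τ) hα fun h => h le_rfl

end TwistedA

/-! ### From the orders on sequences to intervals of points -/

namespace TwistedA

theorem coeff_eq {m : ℕ} (β : PosRoot m) (i : Fin m) : (β.coeff i : ℤ) =
    (if β.1.1 ≤ i.castSucc then 1 else 0) - if β.1.2 ≤ i.castSucc then 1 else 0 := by
  have := β.2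
  unfold PosRoot.coeff
  split_ifs <;> first | rfl | (exfalso; grind)

/-- The sum telescopes along the interval of simple roots in `β`. -/
theorem sum_coeff_mul {m : ℕ} (β : PosRoot m) (g : Fin (m + 1) → ℤ) :
    ∑ i, (β.coeff i : ℤ) * (g i.castSucc - g i.succ) = g β.1.1 - g β.1.2 := by
  have key : ∀ a : Fin (m + 1), ∑ i : Fin m, (if a ≤ i.castSucc then (1 : ℤ) else 0) *
      (g i.castSucc - g i.succ) = g a - g (Fin.last m) := by
    intro a
    induction a using Fin.reverseInduction with
    | last =>
      rw [sub_self]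
      exact Finset.sum_eq_zero fun i _ => by
        rw [if_neg (not_le.2 (Fin.castSucc_lt_last i)), zero_mul]
    | cast j ih =>
      have : ∀ i : Fin m, (if j.castSucc ≤ i.castSucc then (1 : ℤ) else 0) =
          (if j.succ ≤ i.castSucc then 1 else 0) + if i = j then 1 else 0 := by
        intro i
        simp only [Fin.le_def, Fin.val_castSucc, Fin.val_succ, Fin.ext_iff]
        split_ifs <;> first | rfl | omega
      simp only [this, add_mul, Finset.sum_add_distrib, ih]
      simp only [ite_mul, one_mul, zero_mul, Finset.sum_ite_eq', Finset.mem_univ, if_true]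
      ring
  simp only [coeff_eq, sub_mul, Finset.sum_sub_distrib, key]
  ring

/-- A weight is determined by its pairings with functions on the `ε_a`; the indicator of an initial
segment recovers one simple coefficient. -/
theorem wt_eq_iff {m : ℕ} {s s' : RootSeq m} : wt s = wt s' ↔ ∀ g : Fin (m + 1) → ℤ,
    ∑ β, (s β : ℤ) * (g β.1.1 - g β.1.2) = ∑ β, (s' β : ℤ) * (g β.1.1 - g β.1.2) := by
  have key : ∀ (s : RootSeq m) (g : Fin (m + 1) → ℤ), ∑ β, (s β : ℤ) * (g β.1.1 - g β.1.2) =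
      ∑ i, (wt s i : ℤ) * (g i.castSucc - g i.succ) := by
    intro s g
    simp only [wt, ← sum_coeff_mul, Finset.mul_sum, Nat.cast_sum, Finset.sum_mul, Nat.cast_mul]
    rw [Finset.sum_comm]
    simp only [mul_assoc]
  constructor
  · intro h g
    rw [key, key, h]
  · intro h
    funext i
    have := h fun a => if a ≤ i.castSucc then 1 else 0
    simp only [← coeff_eq] at this
    unfold wt
    exact_mod_cast this

theorem eq_zero_of_wt_eq_zero {m : ℕ} {s : RootSeq m} (h : ∀ i, wt s i = 0) : s = 0 := by
  funext β
  have hlt := β.2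
  have hi := h ⟨β.1.1, by have := β.1.2.2; rw [Fin.lt_def] at hlt; omega⟩
  unfold wt at hi
  rw [Finset.sum_eq_zero_iff] at hi
  have := hi β (Finset.mem_univ _)
  unfold PosRoot.coeff at this
  rw [if_pos ⟨le_of_eq (Fin.ext rfl), lt_of_eq_of_lt (Fin.ext rfl) hlt⟩, mul_one] at this
  exact this

theorem wt_add {m : ℕ} (s s' : RootSeq m) : wt (s + s') = wt s + wt s' := by
  funext i
  simp [wt, add_mul, Finset.sum_add_distrib]

theorem eq_zero_of_wt_add {m : ℕ} {s s' : RootSeq m} (h : wt s' = wt (s + s')) : s = 0 :=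
  eq_zero_of_wt_eq_zero fun i => by
    rw [wt_add] at h
    have := congrFun h i
    simp only [Pi.add_apply] at this
    omega

theorem single_ne_zero {m : ℕ} (α : PosRoot m) : single α ≠ 0 := fun h => by
  have := congrFun h α
  simp [single] at this

theorem single_apply {m : ℕ} (α β : PosRoot m) : single α β = if β = α then 1 else 0 := by
  rw [single, Pi.single_apply]

theorem IsPair.exists_eq {m : ℕ} {p : RootSeq m} (h : IsPair p) :
    ∃ α β, α ≠ β ∧ p = single α + single β := by
  classical
  obtain ⟨h1, h2⟩ := h
  have h3 : ∀ β, p β = if p β = 1 then 1 else 0 := fun β => by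
    have := h1 β
    split_ifs <;> omega
  have h4 : (Finset.univ.filter fun β => p β = 1).card = 2 := by
    rw [Finset.card_filter, ← h2]
    exact Finset.sum_congr rfl fun β _ => (h3 β).symm
  obtain ⟨α, β, hne, h5⟩ := Finset.card_eq_two.1 h4
  refine ⟨α, β, hne, funext fun γ => ?_⟩
  have h6 : p γ = 1 ↔ γ = α ∨ γ = β := by
    have := Finset.ext_iff.1 h5 γ
    simpa using this
  rw [h3 γ, Pi.add_apply, single_apply, single_apply]
  simp only [h6]
  split_ifs <;> grind

/-- `s ≺ p` and both have the same weight. -/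
def Below {m : ℕ} (c : CommClass m) (s p : RootSeq m) : Prop := Prec c s p ∧ wt s = wt p

/-- The sequence of points that belongs to a sequence of positive roots. -/
noncomputable def ptSeq {m : ℕ} (pt : PosRoot m → ℤ × ℤ) (s : RootSeq m) : ℤ × ℤ →₀ ℕ :=
  ∑ β, Finsupp.single (pt β) (s β)

theorem flux_ptSeq {m : ℕ} (pt : PosRoot m → ℤ × ℤ) (s : RootSeq m) (h : ℤ → ℤ) :
    flux h (ptSeq pt s) = ∑ β, (s β : ℤ) * (h (pt β).1 - h (pt β).2) := by
  unfold ptSeq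
  have : ∀ A : Finset (PosRoot m), flux h (∑ β ∈ A, Finsupp.single (pt β) (s β)) =
      ∑ β ∈ A, (s β : ℤ) * (h (pt β).1 - h (pt β).2) := by
    classical
    intro A
    induction A using Finset.induction_on with
    | empty => simp [flux]
    | insert a A ha ih => rw [Finset.sum_insert ha, Finset.sum_insert ha, flux_add, ih, flux_single]
  exact this _

namespace Model

variable {n : ℕ} {c : CommClass (2 * n + 1)} {σ : Fin (2 * n + 1 + 1) → ℤ}
  {pt : PosRoot (2 * n + 1) → ℤ × ℤ}

theorem pt_injective (M : Model n c σ pt) : Function.Injective pt := fun α β h =>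
  Subtype.ext (Prod.ext (M.inj (by rw [← M.fst, h, M.fst])) (M.inj (by rw [← M.snd, h, M.snd])))

theorem ptSeq_apply (M : Model n c σ pt) (s : RootSeq (2 * n + 1)) (α : PosRoot (2 * n + 1)) :
    ptSeq pt s (pt α) = s α := by
  unfold ptSeq
  rw [Finsupp.finsetSum_apply, Finset.sum_eq_single α]
  · simp
  · intro β _ hne
    rw [Finsupp.single_apply, if_neg fun h => hne (M.pt_injective h)]
  · simp

theorem exists_pt_eq {s : RootSeq (2 * n + 1)} {X : ℤ × ℤ} (h : ptSeq pt s X ≠ 0) :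
    ∃ α, pt α = X := by
  unfold ptSeq at h
  rw [Finsupp.finsetSum_apply] at h
  obtain ⟨α, -, hα⟩ := Finset.exists_ne_zero_of_sum_ne_zero h
  exact ⟨α, by_contra fun hne => hα (by rw [Finsupp.single_apply, if_neg hne])⟩

theorem ptSeq_injective (M : Model n c σ pt) : Function.Injective (ptSeq pt) := fun s s' h =>
  funext fun α => by rw [← M.ptSeq_apply s, h, M.ptSeq_apply]

theorem exists_ptSeq_eq (M : Model n c σ pt) {T : ℤ × ℤ →₀ ℕ}
    (h : ∀ X, T X ≠ 0 → ∃ α, pt α = X) : ptSeq pt (fun α => T (pt α)) = T := by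
  ext X
  by_cases hX : ∃ α, pt α = X
  · obtain ⟨α, rfl⟩ := hX
    rw [M.ptSeq_apply]
  · rw [not_imp_comm.1 (h X) hX]
    exact not_imp_comm.1 exists_pt_eq hX

theorem ptSeq_single (M : Model n c σ pt) (α : PosRoot (2 * n + 1)) :
    ptSeq pt (single α) = Finsupp.single (pt α) 1 := by
  have h := M.exists_ptSeq_eq (T := Finsupp.single (pt α) 1) fun X hX =>
    ⟨α, by_contra fun hne => hX (by rw [Finsupp.single_apply, if_neg hne])⟩
  rw [← h]
  congr 1
  funext β
  rw [single_apply, Finsupp.single_apply]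
  exact if_congr ⟨fun h => by rw [h], fun h => (M.pt_injective h).symm⟩ rfl rfl

theorem wt_eq_iff (M : Model n c σ pt) {s : RootSeq (2 * n + 1)} {α β : PosRoot (2 * n + 1)} :
    wt s = wt (single α + single β) ↔ ∀ H : ℤ → ℤ, flux (fun v => H (lab n v)) (ptSeq pt s) =
      H (lab n (pt α).1) - H (lab n (pt α).2) + H (lab n (pt β).1) - H (lab n (pt β).2) := by
  have key : ∀ g : Fin (2 * n + 1 + 1) → ℤ, ∑ γ : PosRoot (2 * n + 1),
      ((single α + single β : RootSeq (2 * n + 1)) γ : ℤ) * (g γ.1.1 - g γ.1.2) =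
      g α.1.1 - g α.1.2 + g β.1.1 - g β.1.2 := by
    intro g
    simp only [Pi.add_apply, single_apply, Nat.cast_add, add_mul, Finset.sum_add_distrib,
      Nat.cast_ite, Nat.cast_one, Nat.cast_zero, ite_mul, one_mul, zero_mul, Finset.sum_ite_eq',
      Finset.mem_univ, if_true]
    ring
  rw [TwistedA.wt_eq_iff]
  simp only [key, flux_ptSeq, M.fst, M.snd]
  constructor
  · intro h H
    exact h fun a => H (σ a)
  · intro h g
    -- Since `σ` is injective, every function on positions comes from a function on labels.
    have := h (Function.extend σ g 0)
    simpa only [M.inj.extend_apply] using this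

/-- In every word `s` must drop at both `α` and `β`: a drop at only one would leave the other root
alone, whose weight is too small. For `τ` in the support, a word that puts the lower set of `τ`
first and one that puts its upper set last turn bounds in words into bounds in the heap order. -/
theorem comparable (M : Model n c σ pt) {s : RootSeq (2 * n + 1)} {α β : PosRoot (2 * n + 1)}
    (hne : α ≠ β) (h : Below c s (single α + single β)) :
    (pt α ≤ pt β ∨ pt β ≤ pt α) ∧ s α = 0 ∧ s β = 0 ∧ ∀ τ, s τ ≠ 0 →
      (pt α ≤ pt τ ∧ pt τ ≤ pt β) ∨ (pt β ≤ pt τ ∧ pt τ ≤ pt α) := by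
  have key : ∀ w, commClass w = c → s α = 0 ∧ s β = 0 ∧ ∀ τ, s τ ≠ 0 →
      ∃ κ ρ, (κ = α ∨ κ = β) ∧ (ρ = α ∨ ρ = β) ∧ ¬ WordLT w τ κ ∧ ¬ WordLT w ρ τ := by
    intro w hw
    obtain ⟨i, hi, hi1, -⟩ := M.index w hw
    obtain ⟨κ, ρ, h1, h2, h3, h4⟩ := h.1 w hw
    simp only [hi1] at h1 h2 ⊢
    have hmem : ∀ κ, s κ < (single α + single β : RootSeq (2 * n + 1)) κ →
        (κ = α ∨ κ = β) ∧ s κ = 0 := by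
      intro κ hκ
      rw [Pi.add_apply, single_apply, single_apply] at hκ
      by_cases ha : κ = α <;> by_cases hb : κ = β <;> simp_all
    obtain ⟨h5, h6⟩ := hmem κ h3
    obtain ⟨h7, h8⟩ := hmem ρ h4
    have hout : ∀ γ δ : PosRoot (2 * n + 1), γ ≠ δ → s γ = 0 →
        (∀ τ, i τ < i γ ∨ i γ < i τ → s τ = (single γ + single δ : RootSeq (2 * n + 1)) τ) →
        wt s = wt (single γ + single δ) → False := by
      intro γ δ hγ h0 hτ hwt
      have : s = single δ := by
        funext τ
        by_cases he : τ = γ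
        · subst he
          rw [h0, single_apply, if_neg hγ]
        · rw [hτ τ (lt_or_gt_of_ne fun h => he (hi h)), Pi.add_apply, single_apply, if_neg he,
            zero_add]
      exact single_ne_zero γ (eq_zero_of_wt_add (this ▸ hwt))
    have hκρ : κ ≠ ρ := by
      rintro rfl
      rcases h5 with rfl | rfl
      · exact hout κ β hne h6 h2 h.2
      · exact hout κ α hne.symm h6 (add_comm (single α) _ ▸ h2) (add_comm (single α) _ ▸ h.2)
    have h9 : s α = 0 ∧ s β = 0 := by
      rcases h5 with rfl | rfl <;> rcases h7 with rfl | rfl <;> tauto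
    refine ⟨h9.1, h9.2, fun τ hτ => ⟨κ, ρ, h5, h7, fun h10 => hτ ?_, fun h10 => hτ ?_⟩⟩
    · rw [h2 τ (Or.inl h10), Pi.add_apply, single_apply, single_apply, if_neg, if_neg]
      · rintro rfl; exact hτ h9.2
      · rintro rfl; exact hτ h9.1
    · rw [h2 τ (Or.inr h10), Pi.add_apply, single_apply, single_apply, if_neg, if_neg]
      · rintro rfl; exact hτ h9.2
      · rintro rfl; exact hτ h9.1
  obtain ⟨w, hw⟩ := Quot.exists_rep c
  obtain ⟨h1, h2, -⟩ := key w hw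
  have between : ∀ τ, s τ ≠ 0 →
      (pt α ≤ pt τ ∧ pt τ ≤ pt β) ∨ (pt β ≤ pt τ ∧ pt τ ≤ pt α) := by
    intro τ hτ
    obtain ⟨w, hw, hf⟩ := M.first τ
    obtain ⟨w', hw', hl⟩ := M.last τ
    obtain ⟨κ, -, h3, -, h4, -⟩ := (key w hw).2.2 τ hτ
    obtain ⟨-, ρ, -, h5, -, h6⟩ := (key w' hw').2.2 τ hτ
    have h7 := not_imp_comm.1 (hf κ) h4
    have h8 := not_imp_comm.1 (hl ρ) h6
    rcases h3 with rfl | rfl <;> rcases h5 with rfl | rfl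
    · exact absurd h1 (M.pt_injective (le_antisymm h7 h8) ▸ hτ)
    · exact Or.inl ⟨h7, h8⟩
    · exact Or.inr ⟨h7, h8⟩
    · exact absurd h2 (M.pt_injective (le_antisymm h7 h8) ▸ hτ)
  have h0 : s ≠ 0 := by
    rintro rfl
    refine single_ne_zero α (eq_zero_of_wt_add (s' := single β) ?_)
    have : wt (0 : RootSeq (2 * n + 1)) = 0 := by funext i; simp [wt]
    rw [← h.2, this]
    funext i
    have hi := congrFun h.2 i
    rw [this, wt_add] at hi
    simp only [Pi.add_apply, Pi.zero_apply] at hi ⊢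
    omega
  obtain ⟨τ, hτ⟩ := Function.ne_iff.1 h0
  exact ⟨(between τ hτ).imp (fun h => h.1.trans h.2) (fun h => h.1.trans h.2), h1, h2, between⟩

/-- One direction is `comparable`. Conversely every word of the class extends the order of points,
so `α` and `β` are the first and last places of difference in all of them. -/
theorem below_iff (M : Model n c σ pt) {s : RootSeq (2 * n + 1)} {α β : PosRoot (2 * n + 1)}
    (hne : α ≠ β) (hle : pt α ≤ pt β) :
    Below c s (single α + single β) ↔ Adm n (pt α) (pt β) (ptSeq pt s) := by
  constructor
  · intro h
    obtain ⟨-, h1, h2, h3⟩ := M.comparable hne h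
    refine ⟨fun P hP => ?_, M.wt_eq_iff.1 h.2⟩
    obtain ⟨τ, rfl⟩ := exists_pt_eq hP
    rw [M.ptSeq_apply] at hP
    have h4 : pt τ ≠ pt α := fun he => hP (by rw [M.pt_injective he, h1])
    have h5 : pt τ ≠ pt β := fun he => hP (by rw [M.pt_injective he, h2])
    rcases h3 τ hP with h6 | h6
    · exact ⟨M.isPt τ, h6.1, h4, h6.2, h5⟩
    · exact absurd (M.pt_injective (le_antisymm hle (h6.1.trans h6.2))) hne
  · intro h
    refine ⟨fun w hw => ?_, M.wt_eq_iff.2 h.bal⟩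
    obtain ⟨i, hi, hi1, hi2⟩ := M.index w hw
    have h0 : ∀ τ, s τ ≠ 0 → i α < i τ ∧ i τ < i β := by
      intro τ hτ
      rw [← M.ptSeq_apply s] at hτ
      obtain ⟨-, h1, h2, h3, h4⟩ := h.supp _ hτ
      exact ⟨hi2 _ _ h1 fun he => h2 (by rw [he]), hi2 _ _ h3 fun he => h4 (by rw [he])⟩
    have ha : s α = 0 := by_contra fun h1 => lt_irrefl _ (h0 α h1).1
    have hb : s β = 0 := by_contra fun h1 => lt_irrefl _ (h0 β h1).2
    refine ⟨α, β, Or.inr ((hi1 _ _).2 (hi2 _ _ hle hne)), fun τ hτ => ?_, ?_, ?_⟩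
    · rw [hi1, hi1] at hτ
      have hαβ := hi2 _ _ hle hne
      rw [Pi.add_apply, single_apply, single_apply, if_neg (by rintro rfl; omega),
        if_neg (by rintro rfl; omega)]
      by_contra h1
      have := h0 τ h1
      omega
    · rw [ha, Pi.add_apply, single_apply, if_pos rfl]; omega
    · rw [hb, Pi.add_apply, single_apply β β, if_pos rfl]; omega

theorem isSimplePair (M : Model n c σ pt) {α β : PosRoot (2 * n + 1)} (hne : α ≠ β)
    (h1 : ¬ pt α ≤ pt β) (h2 : ¬ pt β ≤ pt α) : IsSimplePair c (single α + single β) :=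
  fun ⟨_, h⟩ => (M.comparable hne h).1.elim h1 h2

theorem not_isSimpleSeq (M : Model n c σ pt) {s : RootSeq (2 * n + 1)}
    (h : Reducible n (ptSeq pt s)) : ¬ IsSimpleSeq c s := by
  obtain ⟨X, Y, g, hX, hY, hne, hg⟩ := h
  obtain ⟨α, rfl⟩ := exists_pt_eq hX
  obtain ⟨β, rfl⟩ := exists_pt_eq hY
  rw [M.ptSeq_apply] at hX hY
  have hαβ : α ≠ β := fun he => hne (by rw [he])
  rintro (⟨γ, k, rfl⟩ | h)
  · rw [Pi.single_apply] at hX hY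
    exact hαβ (((ite_ne_right_iff.1 hX).1).trans ((ite_ne_right_iff.1 hY).1).symm)
  · obtain ⟨h1, h2, -, h3, -⟩ := hg.supp g (by simp)
    obtain ⟨δ, rfl⟩ := M.convex α β g h1 h2 h3
    rw [← M.ptSeq_single, ← M.below_iff hαβ (h2.trans h3)] at hg
    exact h α β hαβ (Nat.pos_of_ne_zero hX) (Nat.pos_of_ne_zero hY) ⟨_, hg⟩

theorem isSimpleSeq (M : Model n c σ pt) {s : RootSeq (2 * n + 1)}
    (h : IsAntichainPair (ptSeq pt s)) : IsSimpleSeq c s := by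
  rcases h with ⟨X, hX⟩ | ⟨X, Y, h1, h2, h3⟩
  · obtain ⟨α, rfl⟩ := exists_pt_eq (pt := pt) (s := s) (X := X) (by simp [hX])
    rw [← M.ptSeq_single] at hX
    exact Or.inl ⟨α, 1, M.ptSeq_injective hX⟩
  · right
    intro α β hne hα hβ
    rw [← M.ptSeq_apply s, h3] at hα hβ
    simp only [Finsupp.add_apply, Finsupp.single_apply] at hα hβ
    have : pt α ≠ pt β := fun he => hne (M.pt_injective he)
    have h4 : X = pt α ∨ Y = pt α := by
      by_contra h4
      rw [not_or] at h4
      simp [h4.1, h4.2] at hα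
    have h5 : X = pt β ∨ Y = pt β := by
      by_contra h5
      rw [not_or] at h5
      simp [h5.1, h5.2] at hβ
    rcases h4 with rfl | rfl <;> rcases h5 with h5 | h5
    · exact absurd h5 this
    · exact M.isSimplePair hne (h5 ▸ h1) (h5 ▸ h2)
    · exact M.isSimplePair hne (h5 ▸ h2) (h5 ▸ h1)
    · exact absurd h5 this

theorem exists_below (M : Model n c σ pt) {α β : PosRoot (2 * n + 1)} (hne : α ≠ β) :
    ∃ t r, ∀ s, Below c s (single α + single β) →
      (Below c t (single α + single β) ∧ IsSimpleSeq c t) ∧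
        (s = t ∨ s = r ∧ ¬ IsSimpleSeq c s) := by
  have key : ∀ α β : PosRoot (2 * n + 1), α ≠ β → pt α ≤ pt β → ∃ t r, ∀ s,
      Below c s (single α + single β) → (Below c t (single α + single β) ∧ IsSimpleSeq c t) ∧
        (s = t ∨ s = r ∧ ¬ IsSimpleSeq c s) := by
    intro α β hne hle
    obtain ⟨T, R, h⟩ := hasSocle (M.isPt α) (M.isPt β) hle (M.not_tau_le α β)
    refine ⟨fun γ => T (pt γ), fun γ => R (pt γ), fun s hs => ?_⟩
    rw [M.below_iff hne hle] at hs ⊢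
    obtain ⟨h1, h2, h3⟩ := h _ hs
    have hT := M.exists_ptSeq_eq (T := T) fun X hX => by
      obtain ⟨h4, h5, -, h6, -⟩ := h1.supp X hX
      exact M.convex α β X h4 h5 h6
    refine ⟨⟨by rwa [hT], M.isSimpleSeq (by rwa [hT])⟩, h3.imp (fun h4 => ?_) fun h4 => ⟨?_, ?_⟩⟩
    · exact M.ptSeq_injective (h4.trans hT.symm)
    · funext γ
      rw [← h4.1, M.ptSeq_apply]
    · exact M.not_isSimpleSeq h4.2
  by_cases h1 : pt α ≤ pt β
  · exact key α β hne h1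
  by_cases h2 : pt β ≤ pt α
  · simpa only [add_comm] using key β α hne.symm h2
  · exact ⟨0, 0, fun s hs => absurd ⟨s, hs⟩ (M.isSimplePair hne h1 h2)⟩

/-- The earlier of the two left ends and the later of the two right ends serve for the composite; if
two ends coincide, their strict inequalities compose. -/
theorem prec_trans (M : Model n c σ pt) {s s' s'' : RootSeq (2 * n + 1)} (h : Prec c s s')
    (h' : Prec c s' s'') : Prec c s s'' := by
  intro w hw
  obtain ⟨i, hi, hi1, -⟩ := M.index w hw
  obtain ⟨κ, ρ, h1, h2, h3, h4⟩ := h w hw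
  obtain ⟨κ', ρ', h1', h2', h3', h4'⟩ := h' w hw
  simp only [hi1] at h1 h2 h1' h2'
  have hle : i κ ≤ i ρ := by rcases h1 with rfl | h1 <;> omega
  have hle' : i κ' ≤ i ρ' := by rcases h1' with rfl | h1' <;> omega
  obtain ⟨μ, hμ1, hμ2, hμ3⟩ : ∃ μ, i μ ≤ i κ ∧ i μ ≤ i κ' ∧ s μ < s'' μ := by
    rcases lt_trichotomy (i κ) (i κ') with h | h | h
    · exact ⟨κ, le_rfl, h.le, by rwa [← h2' κ (Or.inl h)]⟩
    · obtain rfl := hi h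
      exact ⟨κ, le_rfl, le_rfl, h3.trans h3'⟩
    · exact ⟨κ', h.le, le_rfl, by rwa [h2 κ' (Or.inl h)]⟩
  obtain ⟨ν, hν1, hν2, hν3⟩ : ∃ ν, i ρ ≤ i ν ∧ i ρ' ≤ i ν ∧ s ν < s'' ν := by
    rcases lt_trichotomy (i ρ) (i ρ') with h | h | h
    · exact ⟨ρ', h.le, le_rfl, by rwa [h2 ρ' (Or.inr h)]⟩
    · obtain rfl := hi h
      exact ⟨ρ, le_rfl, le_rfl, h4.trans h4'⟩
    · exact ⟨ρ, le_rfl, h.le, by rwa [← h2' ρ (Or.inr h)]⟩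
  refine ⟨μ, ν, ?_, fun τ hτ => ?_, hμ3, hν3⟩
  · rw [hi1]
    rcases eq_or_ne μ ν with h | h
    · exact Or.inl h
    · exact Or.inr (lt_of_le_of_ne (by omega) fun he => h (hi he))
  · rw [hi1, hi1] at hτ
    rw [h2 τ (by omega), h2' τ (by omega)]

end Model

theorem Prec.irrefl {m : ℕ} {c : CommClass m} (s : RootSeq m) : ¬ Prec c s s := fun h => by
  obtain ⟨w, hw⟩ := Quot.exists_rep c
  obtain ⟨κ, _, -, -, h1, -⟩ := h w hw
  exact lt_irrefl _ h1

/-! ### Distances, socles and radii -/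

namespace Model

variable {n : ℕ} {c : CommClass (2 * n + 1)} {σ : Fin (2 * n + 1 + 1) → ℤ}
  {pt : PosRoot (2 * n + 1) → ℤ × ℤ}

/-- The members below `s` of a chain that ends in `s`. -/
theorem chain_below (M : Model n c σ pt) {s : RootSeq (2 * n + 1)} {l : List (RootSeq (2 * n + 1))}
    (h1 : l.IsChain (Prec c)) (h2 : l.getLast? = some s)
    (h3 : ∀ t ∈ l, ¬ IsSimpleSeq c t ∧ wt t = wt s) :
    ∃ l', l = l' ++ [s] ∧ l'.Pairwise (Prec c) ∧ ∀ t ∈ l', Below c t s ∧ ¬ IsSimpleSeq c t := by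
  obtain ⟨l', rfl⟩ := List.getLast?_eq_some_iff.1 h2
  have : IsTrans _ (Prec c) := ⟨fun _ _ _ => M.prec_trans⟩
  have h4 := List.pairwise_append.1 (List.isChain_iff_pairwise.1 h1)
  exact ⟨l', rfl, h4.1, fun t ht => ⟨⟨h4.2.2 t ht s (by simp), (h3 t (by simp [ht])).2⟩,
    (h3 t (by simp [ht])).1⟩⟩

/-- All members of a chain before the pair itself are the one nonsimple sequence `r` below it, which
by irreflexivity occurs at most once. -/
theorem gdist_le (M : Model n c σ pt) {p : RootSeq (2 * n + 1)} (hp : IsPair p) :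
    gdist c p ≤ 2 := by
  obtain ⟨α, β, hne, rfl⟩ := hp.exists_eq
  obtain ⟨t, r, h⟩ := M.exists_below hne
  refine sSup_le ?_
  rintro k ⟨l, h1, h2, h3, rfl⟩
  obtain ⟨l', rfl, h4, h5⟩ := M.chain_below h1 h2 h3
  have h6 : ∀ s ∈ l', s = r := by
    intro s hs
    obtain ⟨h7, h8⟩ := h5 s hs
    obtain ⟨h9, rfl | h10⟩ := h s h7
    · exact absurd h9.2 h8
    · exact h10.1
  have h7 : l'.length ≤ 1 := by
    match l', h4, h6 with
    | [], _, _ => simp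
    | [_], _, _ => simp
    | a :: b :: l', h4, h6 =>
      obtain rfl := h6 a (by simp)
      obtain rfl := h6 b (by simp)
      exact absurd (List.rel_of_pairwise_cons h4 (by simp)) (Prec.irrefl _)
  rw [List.length_append, List.length_singleton]
  exact_mod_cast Nat.add_le_add_right h7 1

theorem isSimpleSeq_pair_iff {α β : PosRoot (2 * n + 1)} (hne : α ≠ β) :
    IsSimpleSeq c (single α + single β) ↔ IsSimplePair c (single α + single β) := by
  constructor
  · rintro (⟨γ, k, h⟩ | h)
    · have h1 := congrFun h α
      have h2 := congrFun h β
      simp only [Pi.add_apply, single_apply, Pi.single_apply] at h1 h2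
      grind
    · refine h α β hne ?_ ?_ <;> simp [single_apply]
  · refine fun h => Or.inr fun γ δ hγδ h1 h2 => ?_
    simp only [Pi.add_apply, single_apply] at h1 h2
    have : (γ = α ∧ δ = β) ∨ (γ = β ∧ δ = α) := by grind
    rcases this with ⟨rfl, rfl⟩ | ⟨rfl, rfl⟩
    · exact h
    · exact add_comm (single δ) _ ▸ h

theorem existsUnique_isSocle (M : Model n c σ pt) {p : RootSeq (2 * n + 1)} (hp : IsPair p) :
    ∃! s, IsSocle c p s := by
  obtain ⟨α, β, hne, rfl⟩ := hp.exists_eq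
  obtain ⟨t, r, h⟩ := M.exists_below hne
  by_cases hs : IsSimplePair c (single α + single β)
  · refine ⟨_, ⟨(isSimpleSeq_pair_iff hne).2 hs, rfl, Or.inl rfl⟩, ?_⟩
    rintro s ⟨-, h2, h3 | h3⟩
    · exact h3
    · exact absurd ⟨s, h3, h2.symm⟩ hs
  · obtain ⟨s, h1⟩ := not_not.1 hs
    obtain ⟨⟨h2, h3⟩, -⟩ := h s h1
    refine ⟨t, ⟨h3, h2.2.symm, Or.inr h2.1⟩, ?_⟩
    rintro s' ⟨h4, h5, rfl | h6⟩
    · exact absurd ((isSimpleSeq_pair_iff hne).1 h4) hs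
    · exact ((h s' ⟨h6, h5.symm⟩).2).resolve_right fun h7 => h7.2 h4

theorem rds_le (M : Model n c σ pt) (γ : PosRoot (2 * n + 1)) : rds c γ ≤ 2 :=
  sSup_le fun _ ⟨_, hp, _, _, hk⟩ => hk ▸ M.gdist_le hp

/-- A chain of length two contains a nonsimple sequence below the pair. It differs from `γ`, as a
single root is simple. -/
theorem exists_of_rds_eq_two (M : Model n c σ pt) {γ : PosRoot (2 * n + 1)} (h : rds c γ = 2) :
    ∃ α β s, pt α ≤ pt β ∧ Adm n (pt α) (pt β) (Finsupp.single (pt γ) 1) ∧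
      Adm n (pt α) (pt β) (ptSeq pt s) ∧ ptSeq pt s ≠ Finsupp.single (pt γ) 1 := by
  have h1 : (1 : ℕ∞) < rds c γ := by rw [h]; norm_num
  obtain ⟨k, ⟨p, hp, h2, h3, rfl⟩, h4⟩ := lt_sSup_iff.1 h1
  obtain ⟨k, ⟨l, h5, h6, h7, rfl⟩, h8⟩ := lt_sSup_iff.1 h4
  obtain ⟨l', rfl, -, h9⟩ := M.chain_below h5 h6 h7
  have h10 : l' ≠ [] := by
    rintro rfl
    simp at h8
  obtain ⟨s, hs⟩ := List.exists_mem_of_ne_nil _ h10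
  obtain ⟨h11, h12⟩ := h9 s hs
  have h13 : Below c (single γ) p := ⟨h2, h3.symm⟩
  have key : ∀ α β : PosRoot (2 * n + 1), α ≠ β → p = single α + single β → pt α ≤ pt β →
      ∃ α β s, pt α ≤ pt β ∧ Adm n (pt α) (pt β) (Finsupp.single (pt γ) 1) ∧
      Adm n (pt α) (pt β) (ptSeq pt s) ∧ ptSeq pt s ≠ Finsupp.single (pt γ) 1 := by
    rintro α β hne rfl hle
    refine ⟨α, β, s, hle, ?_, ?_, fun he => h12 (Or.inl ⟨γ, 1, ?_⟩)⟩
    · rw [← M.ptSeq_single, ← M.below_iff hne hle]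
      exact h13
    · rwa [← M.below_iff hne hle]
    · rw [← M.ptSeq_single] at he
      exact M.ptSeq_injective he
  obtain ⟨α, β, hne, hp'⟩ := hp.exists_eq
  rcases (M.comparable hne (hp' ▸ h11)).1 with hle | hle
  · exact key α β hne hp' hle
  · exact key β α hne.symm (hp'.trans (add_comm (single α) _)) hle

end Model

end TwistedA

/-! ### The position of the central strand and the folded multiplicity -/

namespace TwistedA

variable {n : ℕ} {J : Set (ℤ × ℤ)} {σ : Fin (2 * n + 1 + 1) → ℤ} {L : List (ℤ × ℤ)}

theorem isPt_central (n : ℕ) (x : ℤ) : IsPt n (x, x + (2 * n + 1)) := Or.inr rfl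

/-- The central points form a chain, of which the lower set `J` contains an initial part. Comparison
with one point of the slice shows that this part is neither empty nor everything. -/
theorem IsSlice.exists_center (hs : IsSlice n J σ L) :
    ∃ z : ℤ, ∀ x : ℤ, (x, x + (2 * n + 1)) ∈ J ↔ x < z := by
  have mono : ∀ x x' : ℤ, x ≤ x' → (x', x' + (2 * (n : ℤ) + 1)) ∈ J →
      (x, x + (2 * (n : ℤ) + 1)) ∈ J := fun x x' h =>
    hs.lower _ _ (isPt_central n x) (isPt_central n x') ⟨h, by simpa using h⟩
  obtain ⟨P, hP, -⟩ := hs.exists_pt (simpleRoot 0)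
  obtain ⟨hP, h1, h2⟩ := (hs.mem P).1 hP
  rw [tau_symm_apply] at h2
  have h3 : (P.2, P.2 + (2 * (n : ℤ) + 1)) ∉ J := fun h => h1 (hs.lower P _ hP (isPt_central n _)
    ⟨by have := hP.lt; simp only; omega, by simp only; omega⟩ h)
  have h4 : (P.2 - (4 * (n : ℤ) + 2) - (2 * n + 1),
      P.2 - (4 * (n : ℤ) + 2) - (2 * n + 1) + (2 * (n : ℤ) + 1)) ∈ J :=
    hs.lower _ _ (isPt_central n _) hP.tau_symm
      (by rw [tau_symm_apply]; exact ⟨by simp only; omega, by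
        unfold IsPt at hP; simp only; omega⟩) (by rwa [tau_symm_apply])
  obtain ⟨z, hz, hmin⟩ := Int.exists_least_of_bdd (P := fun x => (x, x + (2 * (n : ℤ) + 1)) ∉ J)
    ⟨_, fun x hx => le_of_not_gt fun h => hx (mono _ _ h.le h4)⟩ ⟨_, h3⟩
  exact ⟨z, fun x => ⟨fun hx => lt_of_not_ge fun h => hz (mono _ _ h hx),
    fun hx => by_contra fun h => absurd (hmin x h) (not_le.2 hx)⟩⟩

/-- The shift moves central points by `2n + 1` places along their chain. -/
theorem IsSlice.mem_central (hs : IsSlice n J σ L) {z : ℤ}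
    (hz : ∀ x : ℤ, (x, x + (2 * n + 1)) ∈ J ↔ x < z) (x : ℤ) :
    (x, x + (2 * (n : ℤ) + 1)) ∈ L ↔ z ≤ x ∧ x ≤ z + 2 * n := by
  have h : (tau n).symm (x, x + (2 * (n : ℤ) + 1)) =
      (x - (2 * n + 1), x - (2 * n + 1) + (2 * (n : ℤ) + 1)) := by
    rw [tau_symm_apply]
    ext <;> simp only <;> ring
  rw [hs.mem, h, hz, hz]
  have := isPt_central n x
  constructor
  · rintro ⟨-, h1, h2⟩; omega
  · rintro ⟨h1, h2⟩; exact ⟨this, by omega, by omega⟩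

theorem IsSlice.lt_of_mem (hs : IsSlice n J σ L) {P : ℤ × ℤ} (hP : P ∈ L)
    {i j : Fin (2 * n + 1 + 1)} (hi : σ i = lab n P.1) (hj : σ j = lab n P.2) : i < j := by
  obtain ⟨α, h1, h2⟩ := hs.exists_root hP
  rw [hs.inj (hi.trans h1), hs.inj (hj.trans h2)]
  exact α.2

theorem IsSlice.exists_state (hs : IsSlice n J σ L) {P : ℤ × ℤ} (hP : P ∈ L) :
    ∃ i j, i < j ∧ σ i = lab n P.1 ∧ σ j = lab n P.2 := by
  obtain ⟨α, h1, h2⟩ := hs.exists_root hP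
  exact ⟨_, _, α.2, h1.symm, h2.symm⟩

/-- The strands above the central strand are those that meet it in a central point with even
first coordinate. -/
theorem IsSlice.lt_center (hs : IsSlice n J σ L) {z : ℤ}
    (hz : ∀ x : ℤ, (x, x + (2 * n + 1)) ∈ J ↔ x < z) {y i : Fin (2 * n + 1 + 1)} (hy : σ y = -1)
    (hi : i < y) : ∃ x, x % 2 = 0 ∧ lab n x = σ i ∧ z ≤ x ∧ x ≤ z + 2 * n := by
  obtain ⟨⟨x, x'⟩, hP, h1, h2⟩ := hs.exists_pt ⟨(i, y), hi⟩
  simp only at h1 h2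
  have hpt := hs.isPt hP
  have hx' : x' % 2 = 1 := by
    by_contra h
    have := lab_nonneg_of_even (n := n) (v := x') (by omega)
    omega
  unfold IsPt at hpt
  simp only at hpt
  obtain rfl : x' = x + (2 * n + 1) := by omega
  exact ⟨x, by omega, h1, (hs.mem_central hz x).1 hP⟩

/-- The strands that start above the central one correspond to the central points of the slice with
even first coordinate. Counting these gives `n + 1` or `n`, according to the parity of `z`. -/
theorem IsSlice.center_pos (hs : IsSlice n J σ L) {z e : ℤ} {N : ℕ}
    (hz : ∀ x : ℤ, (x, x + (2 * n + 1)) ∈ J ↔ x < z) {y : Fin (2 * n + 1 + 1)} (hy : σ y = -1)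
    (he : e % 2 = 0) (hN : N ≤ n + 1)
    (hx : ∀ x : ℤ, x % 2 = 0 → (z ≤ x ∧ x ≤ z + 2 * n ↔ e ≤ x ∧ x < e + 2 * N)) :
    (y : ℕ) = N := by
  have h1 : ∀ k : Fin N, ∃ i : {i // i < y}, σ i = lab n (e + 2 * (k : ℕ)) := by
    intro k
    have hk := k.2
    have h2 := (hs.mem_central hz _).2 ((hx (e + 2 * (k : ℕ)) (by omega)).2 (by omega))
    obtain ⟨i, j, hij, h3, h4⟩ := hs.exists_state h2
    rw [lab_of_odd (by simp only; omega), ← hy] at h4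
    exact ⟨⟨i, hs.inj h4 ▸ hij⟩, h3⟩
  choose f hf using h1
  have hbij : Function.Bijective f := by
    constructor
    · intro k l h
      have h2 := (hf k).symm.trans ((congrArg (fun i : {i // i < y} => σ i) h).trans (hf l))
      have hk := k.2
      have hl := l.2
      rw [lab_eq_iff] at h2
      rcases h2 with h2 | ⟨-, -, m, hm⟩
      · omega
      · rcases period_mul_cases n m with h3 | h3 | h3 <;> (apply Fin.ext; omega)
    · rintro ⟨i, hi⟩
      obtain ⟨x, h2, h3, h4⟩ := hs.lt_center hz hy hi
      rw [hx x h2] at h4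
      refine ⟨⟨((x - e) / 2).toNat, by omega⟩, Subtype.ext (hs.inj ?_)⟩
      rw [hf, ← h3]
      congr 1
      simp only
      omega
  have := Fintype.card_of_bijective hbij
  rw [Fintype.card_fin, Fintype.card_subtype, Finset.filter_gt_eq_Iio, Fin.card_Iio] at this
  exact this.symm

/-- The strand in between is the one that meets the central strand at the first or at the last
central point of the slice. The lower set `J` decides which of the two meets the strand `j` in the
required order. -/
theorem IsSlice.above_center (hs : IsSlice n J σ L) {z x : ℤ}
    (hz : ∀ x : ℤ, (x, x + (2 * n + 1)) ∈ J ↔ x < z) {y j : Fin (2 * n + 1 + 1)} (hy : σ y = -1)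
    (hz2 : z % 2 = 1) (hx : x % 2 = 1) (h1 : z < x) (h2 : x < z + 2 * n)
    (hj : σ j = lab n (x + (2 * n + 1))) : (y : ℕ) + 2 ≤ j := by
  have h0 : (z - 1, z - 1 + (2 * (n : ℤ) + 1)) ∈ J := (hz _).2 (by omega)
  have h0' : (z, z + (2 * (n : ℤ) + 1)) ∉ J := fun h => lt_irrefl _ ((hz _).1 h)
  suffices h : ∃ i, y < i ∧ i < j by
    obtain ⟨i, h3, h4⟩ := h
    rw [Fin.lt_def] at h3 h4
    omega
  by_cases hc : (z - 1, x + (2 * (n : ℤ) + 1)) ∈ J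
  · have h3 : (z + (2 * (n : ℤ) + 1), x + (2 * (n : ℤ) + 1)) ∈ L := by
      rw [hs.mem, tau_symm_apply]
      refine ⟨Or.inl (by simp only; omega), fun h => h0' (hs.lower _ _ (isPt_central n _)
        (Or.inl (by simp only; omega)) ⟨by simp only; omega, by simp only; omega⟩ h),
        hs.lower _ _ (Or.inl (by simp only; omega)) (Or.inl (by simp only; omega))
        ⟨by simp only; omega, by simp only; omega⟩ hc⟩
    obtain ⟨i, -, -, h4, -⟩ := hs.exists_state h3
    refine ⟨i, hs.lt_of_mem ((hs.mem_central hz z).2 (by omega)) ?_ h4, hs.lt_of_mem h3 h4 hj⟩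
    rw [hy, lab_of_odd hz2]
  · have h3 : (z - 1, x + (2 * (n : ℤ) + 1)) ∈ L := by
      rw [hs.mem, tau_symm_apply]
      exact ⟨Or.inl (by simp only; omega), hc, hs.lower _ _ (Or.inl (by simp only; omega))
        (isPt_central n _) ⟨by simp only; omega, by simp only; omega⟩ h0⟩
    obtain ⟨i, -, -, h4, -⟩ := hs.exists_state h3
    refine ⟨i, hs.lt_of_mem ((hs.mem_central hz (z + 2 * n)).2 (by omega)) ?_ ?_,
      hs.lt_of_mem h3 h4 hj⟩
    · rw [hy, lab_of_odd (by simp only; omega)]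
    · rw [h4, lab_eq_iff]
      exact Or.inr ⟨by simp only; omega, by simp only; omega, 1, by simp only; omega⟩

theorem IsSlice.below_center (hs : IsSlice n J σ L) {z x : ℤ}
    (hz : ∀ x : ℤ, (x, x + (2 * n + 1)) ∈ J ↔ x < z) {y j : Fin (2 * n + 1 + 1)} (hy : σ y = -1)
    (hz2 : z % 2 = 0) (hx : x % 2 = 0) (h1 : z < x) (h2 : x < z + 2 * n)
    (hj : σ j = lab n x) : (j : ℕ) + 2 ≤ y := by
  have h0 : (z - 1, z - 1 + (2 * (n : ℤ) + 1)) ∈ J := (hz _).2 (by omega)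
  have h0' : (z, z + (2 * (n : ℤ) + 1)) ∉ J := fun h => lt_irrefl _ ((hz _).1 h)
  suffices h : ∃ i, j < i ∧ i < y by
    obtain ⟨i, h3, h4⟩ := h
    rw [Fin.lt_def] at h3 h4
    omega
  by_cases hc : (x, z + 2 * (n : ℤ)) ∈ J
  · have h3 : (x, z + (4 * (n : ℤ) + 2)) ∈ L := by
      rw [hs.mem, tau_symm_apply]
      refine ⟨Or.inl (by simp only; omega), fun h => h0' (hs.lower _ _ (isPt_central n _)
        (Or.inl (by simp only; omega)) ⟨by simp only; omega, by simp only; omega⟩ h),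
        hs.lower _ _ (Or.inl (by simp only; omega)) (Or.inl (by simp only; omega))
        ⟨by simp only; omega, by simp only; omega⟩ hc⟩
    obtain ⟨-, i, -, -, h4⟩ := hs.exists_state h3
    refine ⟨i, hs.lt_of_mem h3 hj h4, hs.lt_of_mem ((hs.mem_central hz z).2 (by omega)) ?_ ?_⟩
    · rw [h4, eq_comm, lab_eq_iff]
      exact Or.inr ⟨by simp only; omega, by simp only; omega, 1, by simp only; omega⟩
    · rw [hy, lab_of_odd (by simp only; omega)]
  · have h3 : (x, z + 2 * (n : ℤ)) ∈ L := by
      rw [hs.mem, tau_symm_apply]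
      exact ⟨Or.inl (by simp only; omega), hc, hs.lower _ _ (Or.inl (by simp only; omega))
        (isPt_central n _) ⟨by simp only; omega, by simp only; omega⟩ h0⟩
    obtain ⟨-, i, -, -, h4⟩ := hs.exists_state h3
    refine ⟨i, hs.lt_of_mem h3 hj h4,
      hs.lt_of_mem ((hs.mem_central hz (z + 2 * n)).2 (by omega)) h4 ?_⟩
    rw [hy, lab_of_odd (by simp only; omega)]

/-- In the exceptional situation the two strands lie on both sides of the central strand, and
not next to the middle. -/
theorem IsSlice.folded_of_mem (hs : IsSlice n J σ L) {x x' q : ℤ}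
    {u v m : Fin (2 * n + 1 + 1)} (hx : x % 2 = 0) (hx' : x' % 2 = 1) (hq : q % 2 = 0)
    (hxL : (x, x + (2 * (n : ℤ) + 1)) ∈ L) (hxL' : (x', x' + (2 * (n : ℤ) + 1)) ∈ L)
    (hu : σ u = lab n x) (hv : σ v = lab n (x' + (2 * n + 1))) (hm : σ m = lab n q)
    (hum : u < m) (hmv : m < v)
    (h : x < x' ∧ x' < q ∧ q < x + (2 * n + 1) ∨ x' < x ∧ x < q + (2 * n + 1) ∧ q < x') :
    (u : ℕ) < n ∧ n + 1 < (v : ℕ) := by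
  obtain ⟨z, hz⟩ := hs.exists_center
  obtain ⟨-, y, -, -, hy⟩ := hs.exists_state hxL
  rw [lab_of_odd (by simp only; omega)] at hy
  have huy := hs.lt_of_mem hxL hu (j := y) (by rw [hy, lab_of_odd (by simp only; omega)])
  have hyv := hs.lt_of_mem hxL' (i := y) (by rw [hy, lab_of_odd hx']) hv
  rw [hs.mem_central hz] at hxL hxL'
  have hmy : m ≠ y := by
    rintro rfl
    have := lab_nonneg_of_even (n := n) hq
    omega
  rw [Fin.lt_def] at huy hyv hum hmv
  rcases Int.emod_two_eq_zero_or_one z with hz2 | hz2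
  · have hyn := hs.center_pos hz hy (e := z) (N := n + 1) hz2 le_rfl (by intros; omega)
    refine ⟨?_, by omega⟩
    by_contra hc
    have hym : y < m := lt_of_le_of_ne (by rw [Fin.le_def]; omega) hmy.symm
    obtain ⟨⟨w, w'⟩, hP, h1, h2⟩ := hs.exists_pt ⟨(y, m), hym⟩
    simp only at h1 h2
    have hpt := hs.isPt hP
    have hw : w % 2 = 1 := by
      by_contra h
      have := lab_nonneg_of_even (n := n) (v := w) (by omega)
      omega
    unfold IsPt at hpt
    simp only at hpt
    obtain rfl : w' = w + (2 * n + 1) := by omega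
    rw [hs.mem_central hz] at hP
    rw [hm, lab_eq_iff] at h2
    have h3 : x = z ∨ x = z + 2 * n := by
      by_contra h3
      have := hs.below_center hz hy hz2 hx (by omega) (by omega) hu
      omega
    rcases h2 with h2 | ⟨-, -, k, hk⟩
    · omega
    · rcases period_mul_cases n k with h4 | h4 | h4 <;> omega
  · have hyn := hs.center_pos hz hy (e := z + 1) (N := n) (by omega) (by omega) (by intros; omega)
    refine ⟨by omega, ?_⟩
    by_contra hc
    have hym : m < y := lt_of_le_of_ne (by rw [Fin.le_def]; omega) hmy
    obtain ⟨w, h1, h2, h5⟩ := hs.lt_center hz hy hym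
    rw [hm, lab_eq_iff] at h2
    have h3 : x' = z ∨ x' = z + 2 * n := by
      by_contra h3
      have := hs.above_center hz hy hz2 hx' (by omega) (by omega) hv
      omega
    rcases h2 with h2 | ⟨-, -, k, hk⟩
    · omega
    · rcases period_mul_cases n k with h4 | h4 | h4 <;> omega

theorem foldedMult_le (γ : PosRoot (2 * n + 1)) : foldedMult γ ≤ 2 := by
  refine Finset.sup_le fun i _ => ?_
  calc ∑ j ∈ ({i, diagInv i} : Finset (Fin (2 * n + 1))), γ.coeff j
      ≤ ∑ j ∈ ({i, diagInv i} : Finset (Fin (2 * n + 1))), 1 :=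
        Finset.sum_le_sum fun j _ => by unfold PosRoot.coeff; split_ifs <;> omega
    _ ≤ 2 := by rw [Finset.sum_const, smul_eq_mul, mul_one]; exact Finset.card_le_two

theorem foldedMult_eq_two {γ : PosRoot (2 * n + 1)} (h1 : (γ.1.1 : ℕ) < n)
    (h2 : n + 1 < (γ.1.2 : ℕ)) : foldedMult γ = 2 := by
  refine le_antisymm (foldedMult_le γ) ?_
  have hlt := γ.1.2.2
  -- A neighbour of the middle vertex `n`; its orbit is `{n - 1, n + 1}`.
  let i : Fin (2 * n + 1) := ⟨n - 1, by omega⟩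
  have hi : i ≠ diagInv i := by
    rw [ne_eq, Fin.ext_iff]
    simp only [i, diagInv, Fin.val_rev]
    omega
  have h3 : ∑ j ∈ ({i, diagInv i} : Finset (Fin (2 * n + 1))), γ.coeff j = 2 := by
    rw [Finset.sum_pair hi]
    unfold PosRoot.coeff
    rw [if_pos, if_pos]
    · simp only [Fin.le_def, Fin.lt_def, Fin.val_castSucc, i, diagInv, Fin.val_rev]
      omega
    · simp only [Fin.le_def, Fin.lt_def, Fin.val_castSucc, i]
      omega
  rw [← h3]
  exact Finset.le_sup (f := fun i : Fin (2 * n + 1) =>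
    ∑ j ∈ ({i, diagInv i} : Finset (Fin (2 * n + 1))), γ.coeff j) (Finset.mem_univ i)

theorem isGreatest_foldedMult (hn : 1 ≤ n) :
    IsGreatest (Set.range (foldedMult (n := n))) 2 := by
  refine ⟨⟨⟨(0, Fin.last _), Fin.last_pos⟩, foldedMult_eq_two ?_ ?_⟩, ?_⟩
  · exact hn
  · simp only [Fin.val_last]; omega
  · rintro _ ⟨γ, rfl⟩
    exact foldedMult_le γ

theorem IsSlice.foldedMult_of_rds (hs : IsSlice n J σ L) {c : CommClass (2 * n + 1)}
    {pt : PosRoot (2 * n + 1) → ℤ × ℤ} (M : Model n c σ pt) (mem : ∀ P, P ∈ L ↔ ∃ α, pt α = P)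
    {γ : PosRoot (2 * n + 1)} (h : rds c γ = 2) : foldedMult γ = 2 := by
  obtain ⟨α, β, s, hle, h1, h2, h3⟩ := M.exists_of_rds_eq_two h
  have hf : ∀ X, ptSeq pt s X ≠ 0 → X ∈ L := fun X hX => (mem X).2 (Model.exists_pt_eq hX)
  have hγ1 := M.fst γ
  have hγ2 := M.snd γ
  have hα := (mem (pt α)).2 ⟨α, rfl⟩
  have hβ := (mem (pt β)).2 ⟨β, rfl⟩
  have key : (γ.1.1 : ℕ) < n ∧ n + 1 < (γ.1.2 : ℕ) := by
    obtain ⟨p, q, b, ⟨hp, hq, hb, i1, i2, i3, i4, i5, eα, eβ, eγ, ef⟩ |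
      ⟨α', β', g', f', ⟨hp, hq, hb, i1, i2, i3, i4, i5, rfl, rfl, rfl, rfl⟩, eα, eβ, eγ, ef⟩⟩ :=
      exceptional (M.isPt α) (M.isPt β) hle (M.not_tau_le α β) h1 h2 h3
    · rw [eγ] at hγ1 hγ2
      rw [eα] at hα
      rw [eβ] at hβ
      obtain ⟨-, m, -, -, hm⟩ := hs.exists_state hα
      refine hs.folded_of_mem (x := p) (x' := b - (2 * n + 1)) (q := q) (m := m) hp (by omega) hq
        (hf _ ?_) (hf _ ?_) hγ1.symm ?_ hm (hs.lt_of_mem hα hγ1.symm hm)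
        (hs.lt_of_mem hβ hm hγ2.symm) (by omega)
      · rw [ef]; simp
      · rw [ef]; simp
      · rw [← hγ2]; simp
    · rw [eγ, tau_apply] at hγ1 hγ2
      rw [eα, tau_apply] at hα
      rw [eβ, tau_apply] at hβ
      rw [equivMapDomain_add_single, tau_apply, tau_apply] at ef
      have per : ∀ v : ℤ, lab n (v + (4 * n + 2)) = lab n v := lab_add_period
      simp only [per] at hγ2
      obtain ⟨m, -, -, hm, -⟩ := hs.exists_state hα
      -- The shift exchanges the roles of the strands `p` and `b`: the root is now `(b, p + (4n +
      -- 2))`, and the central points are `(b, b + (2n + 1))` and `(p + (2n + 1), p + (4n + 2))`.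
      refine hs.folded_of_mem (x := b) (x' := p + (2 * n + 1)) (q := q) (m := m) hb (by omega) hq
        (hf _ ?_) (hf _ ?_) hγ1.symm ?_ hm (hs.lt_of_mem hβ hγ1.symm ?_)
        (hs.lt_of_mem hα hm ?_) (by omega)
      · have : ((b - (2 * (n : ℤ) + 1) + (4 * n + 2) : ℤ)) = b + (2 * n + 1) := by ring
        rw [ef]; simp [this]
      · have : (p + (4 * (n : ℤ) + 2) : ℤ) = p + (2 * n + 1) + (2 * n + 1) := by ring
        rw [ef]; simp [this]
      · rw [← hγ2, ← per p]; congr 1; ring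
      · simp only [per]; exact hm
      · simp only [per]; exact hγ2.symm
  exact foldedMult_eq_two key.1 key.2

end TwistedA

theorem mainTheorem7 (n : ℕ) (hn : 1 ≤ n) (c : TwistedA.CommClass (2 * n + 1))
    (hc : TwistedA.IsTwistedAdapted n c) :
    (IsGreatest (Set.range (TwistedA.foldedMult (n := n))) 2 ∧
      ∀ p : TwistedA.RootSeq (2 * n + 1), TwistedA.IsPair p → TwistedA.gdist c p ≤ 2) ∧
    (∀ γ : TwistedA.PosRoot (2 * n + 1), (∀ i, γ ≠ TwistedA.simpleRoot i) →
      TwistedA.rds c γ ≤ 2 ∧ (TwistedA.rds c γ = 2 → TwistedA.foldedMult γ = 2)) ∧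
    (∀ p : TwistedA.RootSeq (2 * n + 1), TwistedA.IsPair p →
      ∃! s : TwistedA.RootSeq (2 * n + 1), TwistedA.IsSocle c p s) := by
  obtain ⟨J, σ, L, rfl, hs⟩ := hc.exists_slice hn
  obtain ⟨pt, M, mem⟩ := hs.model hn
  exact ⟨⟨TwistedA.isGreatest_foldedMult hn, fun p hp => M.gdist_le hp⟩,
    fun γ _ => ⟨M.rds_le γ, hs.foldedMult_of_rds M mem⟩, fun p hp => M.existsUnique_isSocle hp⟩
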